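/- Let $\mathbf k$ be a field of characteristic $0$ and let $\mathsf{DGA}$ be the category of commutative dga's over $\mathbf k$: unital, associative, graded commutative algebras $A=\bigoplus_{n\ge 0}A^n$ with a differential $d:A^n\to A^{n+1}$ that is a graded derivation (the zero algebra is allowed, and is the final object). Let $P(A)=A[t,dt]=A\otimes\Lambda(t,dt)$, where $\Lambda(t,dt)$ is the free dga on $t$ in degree $0$ and $dt=d(t)$ in degree $1$, and $P(f)=f\otimes 1$. Put $\iota_A(a)=a\otimes 1$, $\delta^i_A(a(t))=a(i)$ for $i=0,1$, and let $$\tau_A: t\mapsto 1-t,\qquad \mu_A: t\mapsto s,\ s\mapsto t,\qquad c_A: t\mapsto ts,\qquad \nabla_A: t\mapsto t,\ s\mapsto t$$ be the symmetry $P\to P$, the interchange $P^2\to P^2$, the coproduct $P\to P^2$ and the folding map $P^2\to P$, where $P^2(A)=A[t,dt,s,ds]$. (1) With $\mathcal F=\{\text{surjections}\}$, $\mathcal W=\{\text{quasi-isomorphisms}\}$ and the functorial path $P$ with this structure, $\mathsf{DGA}$ is a P-category. That is, $\iota,\delta^i,\tau,\mu,c,\nabla$ are natural and satisfy: - $\delta^i_A\iota_A=1$;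 $\tau_A\tau_A=1$, $\tau_A\iota_A=\iota_A$, $\delta^i_A\tau_A=\delta^{1-i}_A$; $\mu$ is an automorphism with $\delta^i_{P(A)}\mu_A=P(\delta^i_A)$ and $P(\delta^i_A)\mu_A=\delta^i_{P(A)}$; - $(P,\delta^1,c)$ is a comonad, $c_A\iota_A=\iota_{P(A)}\iota_A$, and $\delta^0_{P(A)}c_A=P(\delta^0_A)c_A=\iota_A\delta^0_A$; - $\delta^i_A\nabla_A=\delta^i_A\delta^i_{P(A)}$ and $\nabla_A\iota_{P(A)}=1$; $\mathsf{DGA}$ has finite products (and in particular a final object $e$), and the following axioms hold: - (P$_1$) $\mathcal F$ and $\mathcal W$ contain all isomorphisms and are closed under composition, $\mathcal W$ satisfies two out of three, and every $A\to e$ is in $\mathcal F$. - (P$_2$) $\iota_A\in\mathcal W$, $(\delta^0_A,\delta^1_A):P(A)\to A\times A$ is in $\mathcal F$, and $\delta^0_A,\delta^1_A\in\mathcal F\cap\mathcal W$. - (P$_3$) For $u:A\to C$ and $v:B\to C$ with $v\in\mathcal F$, the fibre product $A\times_CB$ exists and $\pi_1:A\times_CB\to A$ is in $\mathcal F$; if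 also $v\in\mathcal W$ then $\pi_1\in\mathcal F\cap\mathcal W$; if $u\in\mathcal W$ then $\pi_2:A\times_CB\to B$ is in $\mathcal W$. - (P$_4$) $P(\mathcal F)\subset\mathcal F$, $P(\mathcal W)\subset\mathcal W$, and $P(A\times_CB)=P(A)\times_{P(C)}P(B)$ for the fibre products in (P$_3$). - (P$_5$) For every $v:A\to B$ in $\mathcal F$, the map $\bar v=((\delta^0_A,\delta^1_A),P(v))$ from $P(A)$ to the fibre product $\mathcal P(v,v)$ of $v\times v:A\times A\to B\times B$ and $(\delta^0_B,\delta^1_B):P(B)\to B\times B$ is in $\mathcal F$. (2) A dga $A$ is $0$-connected if its unit induces an isomorphism $\mathbf k\cong H^0(A)$; let $\mathsf{DGA}^0$ be the full subcategory of $0$-connected dga's, and $\mathrm{Ho}(\mathsf{DGA}^0)$ its localization at the quasi-isomorphisms. A dga $A$ is Sullivan minimal if, as a graded algebra, it is the free graded commutative algebra $\Lambda V$ on a graded subspace $V=\bigoplus_{n\ge 1}V^n$, where $V=\bigcup_{m\ge 0}V(m)$ for an increasing sequence of graded subspaces with $d=0$ on $V(0)$ and $dV(m+1)\subset\Lambda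 V(m)$, and if $dA\subset A^+\cdot A^+$, where $A^+=\bigoplus_{n\ge1}A^n$. Let $\mathsf{Smin}$ be the full subcategory of Sullivan minimal dga's and $\pi\,\mathsf{Smin}$ its quotient by the congruence generated by the homotopy relation: $f,g:A\to B$ are homotopic if there is $h:A\to B[t,dt]$ with $\delta^0_Bh=f$ and $\delta^1_Bh=g$. Every Sullivan minimal dga is $0$-connected, and the composite $\mathsf{Smin}\hookrightarrow\mathsf{DGA}^0\to\mathrm{Ho}(\mathsf{DGA}^0)$ of the inclusion with the localization functor factors through $\mathsf{Smin}\to\pi\,\mathsf{Smin}$ and induces an equivalence of categories $$\pi\,\mathsf{Smin}\ \xrightarrow{\ \sim\ }\ \mathrm{Ho}(\mathsf{DGA}^0).$$ -/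

import Mathlib

open CategoryTheory CategoryTheory.Limits Polynomial

universe u v w

/-! ## Categories with a functorial path and P-categories -/

section PCategories

variable (C : Type w) [Category.{v} C]

/-- A functorial path: a functor `P` with natural transformations `ι : 1 ⟶ P`, `δ⁰, δ¹ : P ⟶ 1`
such that `δ⁰ ι = δ¹ ι = 1`. -/
structure FunctorialPath where
  P : C ⥤ C
  ι : 𝟭 C ⟶ P
  δ : Fin 2 → (P ⟶ 𝟭 C)
  ι_δ : ∀ (i : Fin 2) (A : C), ι.app A ≫ (δ i).app A = 𝟙 A

variable {C}

namespace FunctorialPath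

variable (p : FunctorialPath C)

/-- There is a homotopy `h : A ⟶ P B` from `f` to `g`. -/
def Homotopic {A B : C} (f g : A ⟶ B) : Prop :=
  ∃ h : A ⟶ p.P.obj B, h ≫ (p.δ 0).app B = f ∧ h ≫ (p.δ 1).app B = g

/-- A symmetry `τ : P ⟶ P` (the index `1 - i` is computed in `Fin 2`, so it swaps `0` and `1`). -/
structure Symmetry where
  τ : p.P ⟶ p.P
  τ_τ : ∀ A, τ.app A ≫ τ.app A = 𝟙 (p.P.obj A)
  ι_τ : ∀ A, p.ι.app A ≫ τ.app A = p.ι.app A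
  τ_δ : ∀ (i : Fin 2) (A : C), τ.app A ≫ (p.δ i).app A = (p.δ (1 - i)).app A

/-- An interchange `μ : P² ≅ P²`. -/
structure Interchange where
  μ : p.P ⋙ p.P ≅ p.P ⋙ p.P
  μ_δ : ∀ (i : Fin 2) (A : C),
    μ.hom.app A ≫ (p.δ i).app (p.P.obj A) = p.P.map ((p.δ i).app A)
  μ_map_δ : ∀ (i : Fin 2) (A : C),
    μ.hom.app A ≫ p.P.map ((p.δ i).app A) = (p.δ i).app (p.P.obj A)

/-- A coproduct `c : P ⟶ P²`: the triple `(P, δ¹, c)` is a comonad (first three equations), and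
`c` is compatible with `ι` and `δ⁰` (last three equations). -/
structure Coproduct where
  c : p.P ⟶ p.P ⋙ p.P
  coassoc : ∀ A, c.app A ≫ c.app (p.P.obj A) = c.app A ≫ p.P.map (c.app A)
  c_δ_one : ∀ A, c.app A ≫ (p.δ 1).app (p.P.obj A) = 𝟙 (p.P.obj A)
  c_map_δ_one : ∀ A, c.app A ≫ p.P.map ((p.δ 1).app A) = 𝟙 (p.P.obj A)
  ι_c : ∀ A, p.ι.app A ≫ c.app A = p.ι.app A ≫ p.ι.app (p.P.obj A)
  c_δ_zero : ∀ A, c.app A ≫ (p.δ 0).app (p.P.obj A) = (p.δ 0).app A ≫ p.ι.app A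
  c_map_δ_zero : ∀ A, c.app A ≫ p.P.map ((p.δ 0).app A) = (p.δ 0).app A ≫ p.ι.app A

/-- A folding map `∇ : P² ⟶ P`. -/
structure FoldingMap where
  nabla : p.P ⋙ p.P ⟶ p.P
  nabla_δ : ∀ (i : Fin 2) (A : C),
    nabla.app A ≫ (p.δ i).app A = (p.δ i).app (p.P.obj A) ≫ (p.δ i).app A
  ι_nabla : ∀ A, p.ι.app (p.P.obj A) ≫ nabla.app A = 𝟙 (p.P.obj A)

/-- The map `(δ⁰, δ¹) : P A ⟶ A × A`. -/
noncomputable def endpoints [HasFiniteProducts C] (A : C) : p.P.obj A ⟶ A ⨯ A :=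
  prod.lift ((p.δ 0).app A) ((p.δ 1).app A)

lemma endpoints_naturality [HasFiniteProducts C] {A B : C} (f : A ⟶ B) :
    p.endpoints A ≫ prod.map f f = p.P.map f ≫ p.endpoints B := by
  ext <;> simp [endpoints]

end FunctorialPath

variable (C) in
/-- A functorial path together with a symmetry, an interchange, a coproduct and a folding map. -/
structure PathStructure extends FunctorialPath C where
  symmetry : toFunctorialPath.Symmetry
  interchange : toFunctorialPath.Interchange
  coproduct : toFunctorialPath.Coproduct
  folding : toFunctorialPath.FoldingMap

/-- The category `C` with the path structure `p`, the class `F` of fibrations and the class `W` of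
weak equivalences is a P-category. Fibre products are treated through arbitrary pull-back squares,
so that the axioms do not depend on a choice of limits. -/
structure IsPCategory (p : PathStructure C) (F W : MorphismProperty C) : Prop where
  [hasFiniteProducts : HasFiniteProducts C]
  -- (P1)
  fib_of_isIso : ∀ {A B : C} (f : A ⟶ B), IsIso f → F f
  we_of_isIso : ∀ {A B : C} (f : A ⟶ B), IsIso f → W f
  fib_comp : ∀ {A B D : C} (f : A ⟶ B) (g : B ⟶ D), F f → F g → F (f ≫ g)
  we_twoOutOfThree : W.HasTwoOutOfThreeProperty
  fib_terminal : ∀ A : C, F (terminal.from A)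
  -- (P2)
  we_ι : ∀ A, W (p.ι.app A)
  fib_endpoints : ∀ A, F (p.endpoints A)
  trivialFib_δ : ∀ (i : Fin 2) (A : C), F ((p.δ i).app A) ∧ W ((p.δ i).app A)
  -- (P3)
  hasPullback : ∀ {A B D : C} (a : A ⟶ D) (b : B ⟶ D), F b → HasPullback a b
  fib_fst : ∀ {X A B D : C} {fst : X ⟶ A} {snd : X ⟶ B} {a : A ⟶ D} {b : B ⟶ D},
    IsPullback fst snd a b → F b → F fst
  trivialFib_fst : ∀ {X A B D : C} {fst : X ⟶ A} {snd : X ⟶ B} {a : A ⟶ D} {b : B ⟶ D},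
    IsPullback fst snd a b → F b → W b → F fst ∧ W fst
  we_snd : ∀ {X A B D : C} {fst : X ⟶ A} {snd : X ⟶ B} {a : A ⟶ D} {b : B ⟶ D},
    IsPullback fst snd a b → F b → W a → W snd
  -- (P4)
  fib_map : ∀ {A B : C} (f : A ⟶ B), F f → F (p.P.map f)
  we_map : ∀ {A B : C} (f : A ⟶ B), W f → W (p.P.map f)
  isPullback_map : ∀ {X A B D : C} {fst : X ⟶ A} {snd : X ⟶ B} {a : A ⟶ D} {b : B ⟶ D},
    IsPullback fst snd a b → F b →
      IsPullback (p.P.map fst) (p.P.map snd) (p.P.map a) (p.P.map b)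
  -- (P5): `X` is the double mapping path `𝒫(f, f)` with its two projections
  fib_lift : ∀ {X A B : C} (f : A ⟶ B) {fst : X ⟶ A ⨯ A} {snd : X ⟶ p.P.obj B}
    (sq : IsPullback fst snd (prod.map f f) (p.endpoints B)), F f →
      F (sq.lift (p.endpoints A) (p.P.map f) (p.endpoints_naturality f))

end PCategories

/-! ## Commutative differential graded algebras -/

/-- Commutative differential graded algebras over `k`: associative unital `k`-algebras `A` with a
grading `A = ⨁_{n ≥ 0} Aⁿ`, graded commutative, with a differential of degree `1` which is a
graded derivation. -/
structure CDGA (k : Type u) [Field k] where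
  carrier : Type u
  [ring : Ring carrier]
  [algebra : Algebra k carrier]
  grading : ℕ → Submodule k carrier
  [gradedAlgebra : GradedAlgebra grading]
  mul_comm' : ∀ {i j : ℕ} {a b : carrier}, a ∈ grading i → b ∈ grading j →
    a * b = (-1 : k) ^ (i * j) • (b * a)
  d : carrier →ₗ[k] carrier
  d_mem : ∀ {i : ℕ} {a : carrier}, a ∈ grading i → d a ∈ grading (i + 1)
  d_d : ∀ a, d (d a) = 0
  leibniz : ∀ {i : ℕ} {a : carrier} (b : carrier), a ∈ grading i →
    d (a * b) = d a * b + (-1 : k) ^ i • (a * d b)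

namespace CDGA

variable {k : Type u} [Field k]

instance : CoeSort (CDGA k) (Type u) := ⟨carrier⟩

attribute [instance] ring algebra gradedAlgebra

/-- Morphisms of dga's: morphisms of unital `k`-algebras that preserve degrees and commute with
the differentials. -/
@[ext]
structure Hom (A B : CDGA k) where
  toAlgHom : A →ₐ[k] B
  map_mem : ∀ {i : ℕ} {a : A}, a ∈ A.grading i → toAlgHom a ∈ B.grading i
  map_d : ∀ a : A, toAlgHom (A.d a) = B.d (toAlgHom a)

instance : Category (CDGA k) where
  Hom := Hom
  id A := ⟨AlgHom.id k A, fun h => h, fun _ => rfl⟩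
  comp f g := ⟨g.toAlgHom.comp f.toAlgHom, fun h => g.map_mem (f.map_mem h), fun a => by
    simp [f.map_d, g.map_d]⟩

instance {A B : CDGA k} : FunLike (A ⟶ B) A B where
  coe f := f.toAlgHom
  coe_injective _ _ h := Hom.ext (DFunLike.coe_injective h)

instance {A B : CDGA k} : AlgHomClass (A ⟶ B) k A B where
  map_mul f := map_mul f.toAlgHom
  map_one f := map_one f.toAlgHom
  map_add f := map_add f.toAlgHom
  map_zero f := map_zero f.toAlgHom
  commutes f := f.toAlgHom.commutes

@[simp] lemma id_apply {A : CDGA k} (a : A) : (𝟙 A : A ⟶ A) a = a := rfl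

@[simp] lemma comp_apply {A B D : CDGA k} (f : A ⟶ B) (g : B ⟶ D) (a : A) :
    (f ≫ g) a = g (f a) := rfl

@[simp] lemma toAlgHom_apply {A B : CDGA k} (f : A ⟶ B) (a : A) : f.toAlgHom a = f a := rfl

lemma hom_ext {A B : CDGA k} {f g : A ⟶ B} (h : ∀ a, f a = g a) : f = g :=
  DFunLike.ext f g h

lemma hom_d {A B : CDGA k} (f : A ⟶ B) (a : A) : f (A.d a) = B.d (f a) := f.map_d a

lemma hom_mem {A B : CDGA k} (f : A ⟶ B) {i : ℕ} {a : A} (h : a ∈ A.grading i) :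
    f a ∈ B.grading i := f.map_mem h

/-! ### Cohomology, quasi-isomorphisms, 0-connected dga's -/

/-- The cocycles of degree `n`. -/
def cocycles (A : CDGA k) (n : ℕ) : Submodule k A := A.grading n ⊓ LinearMap.ker A.d

/-- The coboundaries of degree `n`: the image of `Aⁿ⁻¹` under `d` (zero for `n = 0`). -/
def coboundaries (A : CDGA k) : ℕ → Submodule k A
  | 0 => ⊥
  | n + 1 => (A.grading n).map A.d

/-- The cohomology `Hⁿ(A)`. -/
abbrev cohomology (A : CDGA k) (n : ℕ) : Type u :=
  A.cocycles n ⧸ (A.coboundaries n).submoduleOf (A.cocycles n)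

lemma hom_mem_cocycles {A B : CDGA k} (f : A ⟶ B) (n : ℕ) :
    ∀ a ∈ A.cocycles n, f.toAlgHom.toLinearMap a ∈ B.cocycles n := by
  rintro a ⟨h, h'⟩
  refine ⟨f.map_mem h, ?_⟩
  have h'' : A.d a = 0 := h'
  simp [← hom_d, h'']

lemma hom_mem_coboundaries {A B : CDGA k} (f : A ⟶ B) (n : ℕ) :
    ∀ a ∈ A.coboundaries n, f a ∈ B.coboundaries n := by
  cases n with
  | zero =>
    intro a h
    have h' : a = 0 := h
    simp [h']
  | succ n =>
    rintro _ ⟨a, h, rfl⟩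
    exact ⟨f a, f.map_mem h, (hom_d f a).symm⟩

/-- The map `Hⁿ(f) : Hⁿ(A) → Hⁿ(B)`. -/
def cohomologyMap {A B : CDGA k} (f : A ⟶ B) (n : ℕ) : A.cohomology n →ₗ[k] B.cohomology n :=
  Submodule.mapQ _ _ (f.toAlgHom.toLinearMap.restrict (hom_mem_cocycles f n))
    (fun a h => hom_mem_coboundaries f n a h)

variable (k) in
/-- The class of surjections. -/
def surjections : MorphismProperty (CDGA k) := fun _ _ f => Function.Surjective f

variable (k) in
/-- The class of quasi-isomorphisms. -/
def quasiIsos : MorphismProperty (CDGA k) :=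
  fun _ _ f => ∀ n, Function.Bijective (cohomologyMap f n)

lemma algebraMap_mem_cocycles (A : CDGA k) (c : k) : algebraMap k A c ∈ A.cocycles 0 := by
  have h1 : (1 : A) ∈ A.grading 0 := SetLike.GradedOne.one_mem
  have hd : A.d 1 = 0 := by
    have := A.leibniz 1 h1
    simpa using this
  rw [Algebra.algebraMap_eq_smul_one]
  exact Submodule.smul_mem _ _ ⟨h1, hd⟩

/-- The map `k → H⁰(A)` induced by the unit `η : k → A`. -/
def unitCohomology (A : CDGA k) : k →ₗ[k] A.cohomology 0 :=
  (Submodule.mkQ _).comp ((Algebra.linearMap k A).codRestrict (A.cocycles 0)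
    A.algebraMap_mem_cocycles)

variable (k) in
/-- 0-connected dga's: the unit induces an isomorphism `k ≅ H⁰(A)`. -/
def zeroConnected : ObjectProperty (CDGA k) := fun A => Function.Bijective A.unitCohomology

/-! ### Sullivan minimal dga's -/

/-- The underlying graded algebra of `A` is the free graded commutative algebra `ΛV` on the graded
subspace `V = (Vⁿ)` of `A`: every degree-preserving linear map from `V` to a graded commutative
algebra `B` extends uniquely to a morphism of graded algebras `A → B`. -/
def IsFreeOn (A : CDGA k) (V : ℕ → Submodule k A) : Prop :=
  (∀ n, V n ≤ A.grading n) ∧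
  ∀ (B : Type u) [Ring B] [Algebra k B] (ℬ : ℕ → Submodule k B) [GradedAlgebra ℬ],
    (∀ {i j : ℕ} {a b : B}, a ∈ ℬ i → b ∈ ℬ j → a * b = (-1 : k) ^ (i * j) • (b * a)) →
    ∀ φ : ∀ n, V n →ₗ[k] B, (∀ n v, φ n v ∈ ℬ n) →
      ∃! f : A →ₐ[k] B, (∀ n, ∀ a ∈ A.grading n, f a ∈ ℬ n) ∧ ∀ n (v : V n), f v = φ n v

/-- `A⁺`, the span of the elements of positive degree. -/
def positivePart (A : CDGA k) : Submodule k A := ⨆ n, A.grading (n + 1)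

variable (k) in
/-- Sullivan minimal dga's: as a graded algebra `A = ΛV` with `V` concentrated in positive degrees;
`V` is the union of an increasing sequence of graded subspaces `V(0) ⊆ V(1) ⊆ ⋯` (here `E m n` is
the part of degree `n` of `V(m)`) with `d = 0` on `V(0)` and `d V(m+1) ⊆ Λ V(m)`; and
`d A ⊆ A⁺ · A⁺`. -/
def sullivanMinimal : ObjectProperty (CDGA k) := fun A =>
  ∃ V : ℕ → Submodule k A, V 0 = ⊥ ∧ A.IsFreeOn V ∧
    (∃ E : ℕ → ℕ → Submodule k A,
      (∀ n, Monotone fun m => E m n) ∧ (∀ n, ⨆ m, E m n = V n) ∧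
      (∀ n, ∀ x ∈ E 0 n, A.d x = 0) ∧
      ∀ m n, ∀ x ∈ E (m + 1) n, A.d x ∈ Algebra.adjoin k (⋃ j, (E m j : Set A))) ∧
    ∀ a : A, A.d a ∈ A.positivePart * A.positivePart

/-! ### The path `A[t, dt]` -/

section Coefficientwise

variable {R S : Type u} [Ring R] [Algebra k R] [Ring S] [Algebra k S]

/-- The linear map `R[t] → S[t]` which applies a linear map `f : R → S` to every coefficient. -/
noncomputable def coeffMap (f : R →ₗ[k] S) : R[X] →ₗ[k] S[X] :=
  Polynomial.lsum fun i => ((Polynomial.monomial i).restrictScalars k).comp f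

@[simp] lemma coeffMap_monomial (f : R →ₗ[k] S) (i : ℕ) (a : R) :
    coeffMap f (monomial i a) = monomial i (f a) := by
  simp [coeffMap, Polynomial.sum_monomial_index]

@[simp] lemma coeff_coeffMap (f : R →ₗ[k] S) (p : R[X]) (i : ℕ) :
    (coeffMap f p).coeff i = f (p.coeff i) := by
  induction p using Polynomial.induction_on' with
  | add p q hp hq => simp [hp, hq]
  | monomial n a =>
    simp only [coeffMap_monomial, coeff_monomial]
    split_ifs <;> simp

end Coefficientwise

/-- The sign automorphism of `A`, equal to `(-1)ⁿ` on `Aⁿ`. -/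
noncomputable def sign (A : CDGA k) : A →ₐ[k] A :=
  (DirectSum.toAlgebra k (fun i => A.grading i) (fun i => (-1 : k) ^ i • (A.grading i).subtype)
    (by simp) (by
      intro i j a b
      simp only [LinearMap.smul_apply, Submodule.subtype_apply, SetLike.coe_gMul, smul_mul_assoc,
        mul_smul_comm, smul_smul, pow_add, mul_comm])).comp
    (DirectSum.decomposeAlgEquiv A.grading).toAlgHom

lemma sign_of_mem (A : CDGA k) {n : ℕ} {a : A} (h : a ∈ A.grading n) :
    A.sign a = (-1 : k) ^ n • a := by
  lift a to A.grading n using h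
  change DirectSum.toModule k ℕ A (fun i => (-1 : k) ^ i • (A.grading i).subtype)
    (DirectSum.decompose A.grading (a : A)) = _
  rw [DirectSum.decompose_coe, ← DirectSum.lof_eq_of k, DirectSum.toModule_lof]
  rfl

/-- Two linear maps agree if they agree on homogeneous elements. -/
lemma linearMap_ext (A : CDGA k) {M : Type*} [AddCommGroup M] [Module k M] {f g : A →ₗ[k] M}
    (h : ∀ n, ∀ a ∈ A.grading n, f a = g a) : f = g := by
  ext a
  induction a using DirectSum.Decomposition.inductionOn A.grading with
  | zero => simp
  | homogeneous m => exact h _ _ m.2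
  | add m m' h h' => simp [h, h']

lemma d_sign (A : CDGA k) (a : A) : A.d (A.sign a) = - A.sign (A.d a) := by
  refine LinearMap.congr_fun (f := A.d.comp A.sign.toLinearMap)
    (g := -(A.sign.toLinearMap.comp A.d)) (A.linearMap_ext fun n a h => ?_) a
  simp [A.sign_of_mem h, A.sign_of_mem (A.d_mem h), pow_succ]

lemma sign_mem (A : CDGA k) {n : ℕ} {a : A} (h : a ∈ A.grading n) : A.sign a ∈ A.grading n := by
  rw [A.sign_of_mem h]
  exact Submodule.smul_mem _ _ h

lemma leibniz_sign (A : CDGA k) (a b : A) : A.d (a * b) = A.d a * b + A.sign a * A.d b := by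
  refine LinearMap.congr_fun (f := A.d.comp (LinearMap.mulRight k b))
    (g := (LinearMap.mulRight k b).comp A.d +
      (LinearMap.mulRight k (A.d b)).comp A.sign.toLinearMap)
    (A.linearMap_ext fun n a h => ?_) a
  simp [A.sign_of_mem h, A.leibniz b h]

lemma mul_eq_sign_mul (A : CDGA k) {x : A} (hx : x ∈ A.grading 1) (a : A) :
    a * x = x * A.sign a := by
  refine LinearMap.congr_fun (f := LinearMap.mulRight k x)
    (g := (LinearMap.mulLeft k x).comp A.sign.toLinearMap) (A.linearMap_ext fun n a h => ?_) a
  simp [A.sign_of_mem h, A.mul_comm' h hx]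

lemma commute_of_mem_zero (A : CDGA k) {x : A} (hx : x ∈ A.grading 0) (a : A) : Commute a x := by
  refine LinearMap.congr_fun (f := LinearMap.mulRight k x)
    (g := LinearMap.mulLeft k x) (A.linearMap_ext fun n a h => ?_) a
  simp [A.mul_comm' h hx]

lemma mul_self_of_mem_one [CharZero k] (A : CDGA k) {x : A} (hx : x ∈ A.grading 1) :
    x * x = 0 := by
  have h := A.mul_comm' hx hx
  have h2 : (2 : k) • (x * x) = 0 := by
    rw [two_smul]
    nth_rewrite 1 [h]
    simp
  exact (smul_eq_zero.mp h2).resolve_left two_ne_zero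

/-- The elements of `A[t, dt] = A ⊗ Λ(t, dt)`: the pair `⟨p, q⟩` of elements of `A[t]` stands for
`p + dt · q`, where `Λ(t, dt)` is the free graded commutative algebra on `t` of degree `0` and `dt`
of degree `1`. (Recall that `dt · q = (-1)ⁿ q · dt` for `q` of degree `n`.) -/
@[ext]
structure PathAlg (A : CDGA k) : Type u where
  fst : A[X]
  snd : A[X]

namespace PathAlg

variable (A : CDGA k)

/-- The underlying set of `A[t, dt]` is `A[t] × A[t]`. -/
def equivProd : PathAlg A ≃ A[X] × A[X] where
  toFun x := (x.fst, x.snd)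
  invFun y := ⟨y.1, y.2⟩

noncomputable instance addCommGroup : AddCommGroup (PathAlg A) := (equivProd A).addCommGroup

noncomputable instance : Module k (PathAlg A) := (equivProd A).module k

variable {A}

@[simp] lemma fst_add (x y : PathAlg A) : (x + y).1 = x.1 + y.1 := rfl
@[simp] lemma snd_add (x y : PathAlg A) : (x + y).2 = x.2 + y.2 := rfl
@[simp] lemma fst_zero : (0 : PathAlg A).1 = 0 := rfl
@[simp] lemma snd_zero : (0 : PathAlg A).2 = 0 := rfl
@[simp] lemma fst_smul (c : k) (x : PathAlg A) : (c • x).1 = c • x.1 := rfl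
@[simp] lemma snd_smul (c : k) (x : PathAlg A) : (c • x).2 = c • x.2 := rfl

/-- The sign automorphism of `A[t]`, applied to each coefficient. -/
noncomputable abbrev polySign (A : CDGA k) : A[X] →+* A[X] :=
  Polynomial.mapRingHom A.sign.toRingHom

/-- `(p + dt · q) (p' + dt · q') = p p' + dt · (q p' + σ(p) q')`, since `p · dt = dt · σ(p)`. -/
noncomputable instance : Mul (PathAlg A) :=
  ⟨fun x y => ⟨x.1 * y.1, x.2 * y.1 + polySign A x.1 * y.2⟩⟩

noncomputable instance : One (PathAlg A) := ⟨⟨1, 0⟩⟩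

@[simp] lemma fst_one : (1 : PathAlg A).1 = 1 := rfl
@[simp] lemma snd_one : (1 : PathAlg A).2 = 0 := rfl
@[simp] lemma fst_mul (x y : PathAlg A) : (x * y).1 = x.1 * y.1 := rfl
@[simp] lemma snd_mul (x y : PathAlg A) : (x * y).2 = x.2 * y.1 + polySign A x.1 * y.2 := rfl

noncomputable instance : Ring (PathAlg A) :=
  { addCommGroup A with
    mul := (· * ·)
    one := 1
    mul_assoc := fun x y z => by
      ext1 <;> simp only [fst_mul, snd_mul, map_mul, mul_add, add_mul, mul_assoc, add_assoc]
    one_mul := fun x => by ext1 <;> simp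
    mul_one := fun x => by ext1 <;> simp
    zero_mul := fun x => by ext1 <;> simp
    mul_zero := fun x => by ext1 <;> simp
    left_distrib := fun x y z => by
      ext1 <;> simp only [fst_mul, snd_mul, fst_add, snd_add, mul_add]
      abel
    right_distrib := fun x y z => by
      ext1 <;> simp only [fst_mul, snd_mul, fst_add, snd_add, map_add, add_mul]
      abel }

lemma polySign_smul (c : k) (p : A[X]) : polySign A (c • p) = c • polySign A p := by
  ext i; simp

noncomputable instance : Algebra k (PathAlg A) :=
  Algebra.ofModule
    (fun c x y => by
      ext1
      · simp
      · simp only [snd_mul, fst_smul, snd_smul, polySign_smul, smul_add, smul_mul_assoc])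
    (fun c x y => by
      ext1
      · simp
      · simp only [snd_mul, fst_smul, snd_smul, smul_add, mul_smul_comm])

/-- The polynomials with all coefficients in a given subspace. -/
def polyIn (V : Submodule k A) : Submodule k A[X] where
  carrier := {p | ∀ i, p.coeff i ∈ V}
  add_mem' hp hq i := by
    rw [coeff_add]; exact V.add_mem (hp i) (hq i)
  zero_mem' i := by simp
  smul_mem' c p hp i := by
    rw [coeff_smul]; exact V.smul_mem c (hp i)

lemma mem_polyIn {V : Submodule k A} {p : A[X]} : p ∈ polyIn V ↔ ∀ i, p.coeff i ∈ V := Iff.rfl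

/-- The shift of the grading: `Aⁿ⁻¹` in degree `n`, and `0` in degree `0`. -/
def shift (A : CDGA k) : ℕ → Submodule k A
  | 0 => ⊥
  | n + 1 => A.grading n

/-- The elements of degree `n` of `A[t, dt]`: `p + dt · q` with `p` in `Aⁿ[t]` and `q` in
`Aⁿ⁻¹[t]`. -/
def grading (A : CDGA k) (n : ℕ) : Submodule k (PathAlg A) :=
  { carrier := {x | x.1 ∈ polyIn (A.grading n) ∧ x.2 ∈ polyIn (shift A n)}
    add_mem' := fun hx hy => ⟨Submodule.add_mem _ hx.1 hy.1, Submodule.add_mem _ hx.2 hy.2⟩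
    zero_mem' := ⟨Submodule.zero_mem _, Submodule.zero_mem _⟩
    smul_mem' := fun c _ hx => ⟨Submodule.smul_mem _ c hx.1, Submodule.smul_mem _ c hx.2⟩ }

lemma mem_grading {n : ℕ} {x : PathAlg A} :
    x ∈ grading A n ↔ (∀ i, x.1.coeff i ∈ A.grading n) ∧ ∀ i, x.2.coeff i ∈ shift A n := Iff.rfl

lemma polyIn_mul {V V' V'' : Submodule k A} (h : ∀ a ∈ V, ∀ b ∈ V', a * b ∈ V'') {p q : A[X]}
    (hp : p ∈ polyIn V) (hq : q ∈ polyIn V') : p * q ∈ polyIn V'' := by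
  intro i
  rw [coeff_mul]
  exact Submodule.sum_mem _ fun x _ => h _ (hp _) _ (hq _)

lemma polySign_mem {n : ℕ} {p : A[X]} (hp : p ∈ polyIn (A.grading n)) :
    polySign A p ∈ polyIn (A.grading n) := by
  intro i
  simpa using A.sign_mem (hp i)

lemma shift_mul (i j : ℕ) : ∀ a ∈ shift A i, ∀ b ∈ A.grading j, a * b ∈ shift A (i + j) := by
  intro a ha b hb
  cases i with
  | zero =>
    have ha' : a = 0 := ha
    simp [ha']
  | succ i =>
    rw [Nat.add_right_comm]
    exact SetLike.GradedMul.mul_mem (A := A.grading) ha hb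

lemma mul_shift (i j : ℕ) : ∀ a ∈ A.grading i, ∀ b ∈ shift A j, a * b ∈ shift A (i + j) := by
  intro a ha b hb
  cases j with
  | zero =>
    have hb' : b = 0 := hb
    simp [hb']
  | succ j => exact SetLike.GradedMul.mul_mem (A := A.grading) ha hb

instance : SetLike.GradedMonoid (grading A) where
  one_mem := by
    refine mem_grading.mpr ⟨fun i => ?_, fun i => by simp⟩
    simp only [fst_one, coeff_one]
    split_ifs
    · exact SetLike.GradedOne.one_mem
    · exact Submodule.zero_mem _
  mul_mem i j x y hx hy :=
    ⟨polyIn_mul (fun _ ha _ hb => SetLike.GradedMul.mul_mem ha hb) hx.1 hy.1,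
      Submodule.add_mem _ (polyIn_mul (shift_mul i j) hx.2 hy.1)
        (polyIn_mul (mul_shift i j) (polySign_mem hx.1) hy.2)⟩

/-- The projection of `A` to `Aⁿ⁻¹`, zero for `n = 0`. -/
noncomputable def shiftProj (A : CDGA k) : ℕ → (A →ₗ[k] A)
  | 0 => 0
  | n + 1 => GradedAlgebra.proj A.grading n

/-- The projection of `A[t, dt]` to its part of degree `n`. -/
noncomputable def proj (A : CDGA k) (n : ℕ) : PathAlg A →ₗ[k] PathAlg A :=
  { toFun := fun x => ⟨coeffMap (GradedAlgebra.proj A.grading n) x.1, coeffMap (shiftProj A n) x.2⟩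
    map_add' := fun x y => by ext1 <;> simp
    map_smul' := fun c x => by ext1 <;> simp }

lemma fst_proj (n : ℕ) (x : PathAlg A) :
    (proj A n x).1 = coeffMap (GradedAlgebra.proj A.grading n) x.1 := rfl

lemma snd_proj (n : ℕ) (x : PathAlg A) : (proj A n x).2 = coeffMap (shiftProj A n) x.2 := rfl

lemma proj_of_mem {n : ℕ} {x : PathAlg A} (hx : x ∈ grading A n) (m : ℕ) :
    proj A m x = if n = m then x else 0 := by
  have h1 : ∀ {n : ℕ} {a : A}, a ∈ A.grading n → ∀ m,
      GradedAlgebra.proj A.grading m a = if n = m then a else 0 := by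
    intro n a ha m
    split_ifs with h
    · subst h; exact DirectSum.decompose_of_mem_same _ ha
    · exact DirectSum.decompose_of_mem_ne _ ha h
  have h2 : ∀ {n : ℕ} {a : A}, a ∈ shift A n → ∀ m,
      shiftProj A m a = if n = m then a else 0 := by
    intro n a ha m
    cases n with
    | zero =>
      have ha' : a = 0 := ha
      simp [ha']
    | succ n =>
      cases m with
      | zero => simp [shiftProj]
      | succ m => simpa [shiftProj] using h1 ha m
  ext i
  · rw [fst_proj, coeff_coeffMap, h1 (hx.1 i)]
    split_ifs <;> simp
  · rw [snd_proj, coeff_coeffMap, h2 (hx.2 i)]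
    split_ifs <;> simp

lemma iSup_grading : ⨆ n, grading A n = ⊤ := by
  rw [eq_top_iff]
  have key1 : ∀ (i : ℕ) (a : A), (⟨monomial i a, 0⟩ : PathAlg A) ∈ ⨆ n, grading A n := by
    intro i a
    induction a using DirectSum.Decomposition.inductionOn A.grading with
    | zero =>
      rw [map_zero]
      exact Submodule.zero_mem (⨆ n, grading A n)
    | @homogeneous n m =>
      refine Submodule.mem_iSup_of_mem n (mem_grading.mpr ⟨fun j => ?_, fun j => by simp⟩)
      simp only [coeff_monomial]
      split_ifs
      · exact m.2
      · exact Submodule.zero_mem _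
    | add m m' h h' =>
      convert Submodule.add_mem _ h h' using 1
      ext1 <;> simp
  have key2 : ∀ (i : ℕ) (a : A), (⟨0, monomial i a⟩ : PathAlg A) ∈ ⨆ n, grading A n := by
    intro i a
    induction a using DirectSum.Decomposition.inductionOn A.grading with
    | zero =>
      rw [map_zero]
      exact Submodule.zero_mem (⨆ n, grading A n)
    | @homogeneous n m =>
      refine Submodule.mem_iSup_of_mem (n + 1) (mem_grading.mpr ⟨fun j => by simp, fun j => ?_⟩)
      simp only [coeff_monomial]
      split_ifs
      · exact m.2
      · exact Submodule.zero_mem _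
    | add m m' h h' =>
      convert Submodule.add_mem _ h h' using 1
      ext1 <;> simp
  rintro ⟨p, q⟩ -
  have h1 : (⟨p, 0⟩ : PathAlg A) ∈ ⨆ n, grading A n := by
    induction p using Polynomial.induction_on' with
    | add p p' h h' =>
      convert Submodule.add_mem _ h h' using 1
      ext1 <;> simp
    | monomial i a => exact key1 i a
  have h2 : (⟨0, q⟩ : PathAlg A) ∈ ⨆ n, grading A n := by
    induction q using Polynomial.induction_on' with
    | add p p' h h' =>
      convert Submodule.add_mem _ h h' using 1
      ext1 <;> simp
    | monomial i a => exact key2 i a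
  convert Submodule.add_mem _ h1 h2 using 1
  ext1 <;> simp

lemma isInternal_grading : DirectSum.IsInternal (grading A) := by
  have h : ∀ (x : DirectSum ℕ fun n => grading A n) (m : ℕ),
      proj A m (DirectSum.coeAddMonoidHom (grading A) x) = x m := by
    intro x m
    induction x using DirectSum.induction_on with
    | zero => simp
    | of n y =>
      rw [DirectSum.coeAddMonoidHom_of, proj_of_mem y.2, DirectSum.coe_of_apply]
      split_ifs <;> rfl
    | add x y hx hy => simp [hx, hy]
  refine ⟨(injective_iff_map_eq_zero _).mpr fun x hx => ?_, ?_⟩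
  · ext m : 1
    apply Subtype.ext
    rw [← h, hx]
    simp
  · intro x
    have hx : x ∈ ⨆ n, grading A n := by rw [iSup_grading]; trivial
    rw [Submodule.iSup_eq_range_dfinsupp_lsum] at hx
    exact hx

noncomputable instance : GradedAlgebra (grading A) where
  toDecomposition := isInternal_grading.chooseDecomposition

/-- `d (p + dt · q) = dp + dt · (∂p/∂t - dq)`, where `d` acts on the coefficients of `p` and `q`. -/
noncomputable def d (A : CDGA k) : PathAlg A →ₗ[k] PathAlg A where
  toFun x := ⟨coeffMap A.d x.1, derivative x.1 - coeffMap A.d x.2⟩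
  map_add' x y := by
    ext1
    · simp
    · simp only [fst_add, snd_add, map_add]
      abel
  map_smul' c x := by
    ext1
    · simp
    · simp [smul_sub]

@[simp] lemma fst_d (x : PathAlg A) : (d A x).1 = coeffMap A.d x.1 := rfl
@[simp] lemma snd_d (x : PathAlg A) : (d A x).2 = derivative x.1 - coeffMap A.d x.2 := rfl

lemma poly_mul_comm {i j : ℕ} {V V' : Submodule k A} (h : ∀ a ∈ V, ∀ b ∈ V',
    a * b = (-1 : k) ^ (i * j) • (b * a)) {p q : A[X]}
    (hp : p ∈ polyIn V) (hq : q ∈ polyIn V') :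
    p * q = (-1 : k) ^ (i * j) • (q * p) := by
  ext n
  rw [coeff_smul, coeff_mul, coeff_mul, ← Finset.Nat.sum_antidiagonal_swap, Finset.smul_sum]
  exact Finset.sum_congr rfl fun x _ => h _ (hp _) _ (hq _)

lemma polySign_of_mem {n : ℕ} {p : A[X]} (hp : p ∈ polyIn (A.grading n)) :
    polySign A p = (-1 : k) ^ n • p := by
  ext i
  simpa using A.sign_of_mem (hp i)

lemma polySign_of_mem_shift {n : ℕ} {p : A[X]} (hp : p ∈ polyIn (shift A n)) :
    polySign A p = -((-1 : k) ^ n • p) := by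
  ext i
  cases n with
  | zero =>
    have h : p.coeff i = 0 := hp i
    simp [h]
  | succ n => simpa [pow_succ] using A.sign_of_mem (hp i)

lemma coeffMap_d_mul (p q : A[X]) :
    coeffMap A.d (p * q) = coeffMap A.d p * q + polySign A p * coeffMap A.d q := by
  ext n
  simp [coeff_mul, A.leibniz_sign, Finset.sum_add_distrib]

lemma coeffMap_d_polySign (p : A[X]) :
    coeffMap A.d (polySign A p) = - polySign A (coeffMap A.d p) := by
  ext n
  simp [A.d_sign]

lemma derivative_coeffMap (p : A[X]) :
    derivative (coeffMap A.d p) = coeffMap A.d (derivative p) := by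
  ext n
  simp only [coeff_derivative, coeff_coeffMap, ← Nat.cast_succ, ← nsmul_eq_mul', map_nsmul]

lemma neg_one_pow_mul_self (n : ℕ) : (-1 : k) ^ n * (-1 : k) ^ n = 1 := by
  rw [← mul_pow]; simp

lemma polySign_polySign {n : ℕ} {p : A[X]} (hp : p ∈ polyIn (A.grading n)) :
    polySign A (polySign A p) = p := by
  rw [polySign_of_mem hp, polySign_smul, polySign_of_mem hp, smul_smul, neg_one_pow_mul_self,
    one_smul]

lemma shift_succ_mem {n : ℕ} {a : A} (ha : a ∈ shift A n) : A.d a ∈ A.grading n := by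
  cases n with
  | zero =>
    have ha' : a = 0 := ha
    simp [ha']
  | succ n => exact A.d_mem ha

lemma shift_mul_comm (i j : ℕ) : ∀ a ∈ shift A i, ∀ b ∈ A.grading j,
    (-1 : k) ^ j • (a * b) = (-1 : k) ^ (i * j) • (b * a) := by
  intro a ha b hb
  cases i with
  | zero =>
    have ha' : a = 0 := ha
    simp [ha']
  | succ i =>
    rw [A.mul_comm' ha hb, smul_smul, ← pow_add]
    congr 2
    ring

variable (A) in
/-- The element `t` of `A[t, dt]`. -/
noncomputable def t : PathAlg A := ⟨X, 0⟩

lemma t_pow (i : ℕ) : (t A) ^ i = ⟨X ^ i, 0⟩ := by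
  induction i with
  | zero => ext1 <;> simp
  | succ i ih =>
    rw [pow_succ, ih]
    ext1 <;> simp [t, pow_succ]

lemma t_mem : t A ∈ grading A 0 := by
  refine ⟨fun i => ?_, fun i => by simp [t]⟩
  simp only [t, coeff_X]
  split_ifs
  · exact SetLike.GradedOne.one_mem
  · exact Submodule.zero_mem _

lemma d_one : A.d 1 = 0 := by
  have h := A.leibniz 1 (SetLike.GradedOne.one_mem (A := A.grading))
  simpa using h

lemma d_t : d A (t A) = ⟨0, 1⟩ := by
  ext n
  · simp only [fst_d, t, coeff_coeffMap, coeff_X, coeff_zero]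
    split_ifs <;> simp [d_one]
  · simp [t]

variable (A) in
/-- The inclusion `A → A[t, dt]`. -/
noncomputable def incl : A →ₐ[k] PathAlg A :=
  AlgHom.ofLinearMap
    { toFun := fun a => ⟨C a, 0⟩
      map_add' := fun a b => by ext1 <;> simp
      map_smul' := fun c a => by ext1 <;> simp [smul_C] }
    (by ext1 <;> simp)
    (fun a b => by ext1 <;> simp)

lemma incl_apply (a : A) : incl A a = ⟨C a, 0⟩ := rfl

lemma incl_mem {i : ℕ} {a : A} (h : a ∈ A.grading i) : incl A a ∈ grading A i := by
  refine ⟨fun n => ?_, fun n => by simp [incl_apply]⟩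
  simp only [incl_apply, coeff_C]
  split_ifs
  · exact h
  · exact Submodule.zero_mem _

lemma incl_d (a : A) : incl A (A.d a) = d A (incl A a) := by
  ext n
  · simp only [fst_d, incl_apply, coeff_coeffMap, coeff_C]
    split_ifs <;> simp
  · simp [incl_apply]

lemma algHom_ext {B : Type u} [Ring B] [Algebra k B] {f g : PathAlg A →ₐ[k] B}
    (h : ∀ a, f (incl A a) = g (incl A a)) (ht : f (t A) = g (t A))
    (hdt : f (d A (t A)) = g (d A (t A))) : f = g := by
  have key : ∀ p : A[X], f ⟨p, 0⟩ = g ⟨p, 0⟩ := by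
    intro p
    induction p using Polynomial.induction_on' with
    | add p q hp hq =>
      have e : (⟨p + q, 0⟩ : PathAlg A) = ⟨p, 0⟩ + ⟨q, 0⟩ := by ext1 <;> simp
      rw [e, map_add, map_add, hp, hq]
    | monomial i a =>
      have e : (⟨monomial i a, 0⟩ : PathAlg A) = incl A a * (t A) ^ i := by
        rw [t_pow, incl_apply]
        ext1 <;> simp [C_mul_X_pow_eq_monomial]
      rw [e, map_mul, map_mul, map_pow, map_pow, h, ht]
  refine AlgHom.ext fun x => ?_
  have e : x = (⟨x.1, 0⟩ : PathAlg A) + d A (t A) * ⟨x.2, 0⟩ := by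
    rw [d_t]
    ext1 <;> simp
  rw [e, map_add, map_add, map_mul, map_mul, hdt, key, key]

lemma d_pow {B : CDGA k} (b : B) (hb : b ∈ B.grading 0) (i : ℕ) : B.d (b ^ (i + 1)) = B.d b * ((i + 1 : ℕ) * b ^ i) := by
  have h1 : ∀ x : B, B.d (b * x) = B.d b * x + b * B.d x := fun x => by
    simpa using B.leibniz x hb
  induction i with
  | zero => simp
  | succ i ih =>
    rw [pow_succ', h1, ih, ← mul_assoc, (B.commute_of_mem_zero hb (B.d b)).eq.symm, mul_assoc,
      ← mul_add]
    congr 1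
    have hc : Commute b (((i + 1 : ℕ) : B)) := (Nat.cast_commute _ _).symm
    rw [← mul_assoc, hc.eq, mul_assoc, ← pow_succ']
    push_cast
    noncomm_ring

section lift

variable {B : CDGA k} (f : A ⟶ B) (b : B) (hb : b ∈ B.grading 0)

/-- Evaluation `A[t] → B` along `f`, with `t ↦ b`. -/
noncomputable def eval : A[X] →ₐ[k] B :=
  eval₂AlgHom f.toAlgHom b fun a => B.commute_of_mem_zero hb (f a)

lemma eval_monomial (i : ℕ) (a : A) : eval f b hb (monomial i a) = f a * b ^ i := by
  simp [eval]

lemma eval_mul_db (p : A[X]) : eval f b hb p * B.d b = B.d b * eval f b hb (polySign A p) := by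
  induction p using Polynomial.induction_on' with
  | add p q hp hq => rw [map_add, add_mul, hp, hq, map_add, map_add, mul_add]
  | monomial i a =>
    have hs : f (A.sign a) = B.sign (f a) := by
      refine LinearMap.congr_fun (f := f.toAlgHom.toLinearMap.comp A.sign.toLinearMap)
        (g := B.sign.toLinearMap.comp f.toAlgHom.toLinearMap)
        (A.linearMap_ext fun n a h => ?_) a
      simp [A.sign_of_mem h, B.sign_of_mem (hom_mem f h)]
    have hm : polySign A (monomial i a) = monomial i (A.sign a) := by simp
    rw [hm, eval_monomial, eval_monomial, hs, mul_assoc,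
      ((B.commute_of_mem_zero hb (B.d b)).pow_right i).eq.symm, ← mul_assoc,
      B.mul_eq_sign_mul (B.d_mem hb), mul_assoc]

lemma d_eval (p : A[X]) :
    B.d (eval f b hb p) = eval f b hb (coeffMap A.d p) + B.d b * eval f b hb (derivative p) := by
  induction p using Polynomial.induction_on' with
  | add p q hp hq => simp only [map_add, hp, hq, mul_add]; abel
  | monomial i a =>
    rw [coeffMap_monomial, derivative_monomial, eval_monomial, eval_monomial, eval_monomial,
      B.leibniz_sign, hom_d]
    congr 1
    cases i with
    | zero =>
      have hd : B.d 1 = 0 := (B.algebraMap_mem_cocycles 1).2 |> fun h => by simpa using h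
      simp [hd]
    | succ i =>
      rw [d_pow b hb, ← mul_assoc, B.mul_eq_sign_mul (B.d_mem hb), mul_assoc]
      have hs : B.sign (B.sign (f a)) = f a := by
        refine LinearMap.congr_fun (f := B.sign.toLinearMap.comp B.sign.toLinearMap)
          (g := LinearMap.id) (B.linearMap_ext fun n a h => ?_) (f a)
        simp [B.sign_of_mem h, smul_smul, neg_one_pow_mul_self]
      rw [hs, map_mul, map_natCast, mul_assoc]
      simp

lemma eval_mem {n : ℕ} {p : A[X]} (hp : p ∈ polyIn (A.grading n)) :
    eval f b hb p ∈ B.grading n := by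
  have hpow : ∀ i : ℕ, b ^ i ∈ B.grading 0 := fun i => by
    simpa using SetLike.pow_mem_graded i hb
  rw [p.as_sum_range, map_sum]
  refine Submodule.sum_mem _ fun i _ => ?_
  rw [eval_monomial]
  exact SetLike.GradedMul.mul_mem (A := B.grading) (hom_mem f (hp i)) (hpow i)

/-- The algebra morphism `A[t, dt] → B` with `t ↦ b`, `dt ↦ db`, for `b` of degree `0`. -/
noncomputable def lift [CharZero k] : PathAlg A →ₐ[k] B :=
  AlgHom.ofLinearMap
    { toFun := fun x => eval f b hb x.1 + B.d b * eval f b hb x.2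
      map_add' := fun x y => by
        rw [fst_add, snd_add, map_add, map_add, mul_add]
        abel
      map_smul' := fun c x => by
        rw [fst_smul, snd_smul, map_smul, map_smul, mul_smul_comm, ← smul_add, RingHom.id_apply] }
    (by simp)
    (fun x y => by
      change eval f b hb (x.1 * y.1) + B.d b * eval f b hb (x.2 * y.1 + polySign A x.1 * y.2) =
        (eval f b hb x.1 + B.d b * eval f b hb x.2) * (eval f b hb y.1 + B.d b * eval f b hb y.2)
      have h0 : B.d b * eval f b hb x.2 * (B.d b * eval f b hb y.2) = 0 := by
        rw [mul_assoc, ← mul_assoc (eval f b hb x.2), eval_mul_db, ← mul_assoc, ← mul_assoc,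
          B.mul_self_of_mem_one (B.d_mem hb), zero_mul, zero_mul]
      have h1 : eval f b hb x.1 * (B.d b * eval f b hb y.2) =
          B.d b * (eval f b hb (polySign A x.1) * eval f b hb y.2) := by
        rw [← mul_assoc, eval_mul_db, mul_assoc]
      rw [add_mul, mul_add, mul_add, h0, h1, map_mul, map_add, map_mul, map_mul]
      noncomm_ring)

variable [CharZero k]

lemma lift_apply (x : PathAlg A) :
    lift f b hb x = eval f b hb x.1 + B.d b * eval f b hb x.2 := rfl

lemma lift_mem {i : ℕ} {x : PathAlg A} (hx : x ∈ grading A i) : lift f b hb x ∈ B.grading i := by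
  rw [lift_apply]
  refine Submodule.add_mem _ (eval_mem f b hb hx.1) ?_
  cases i with
  | zero =>
    have h : x.2 = 0 := Polynomial.ext fun n => hx.2 n
    simp [h]
  | succ i =>
    rw [add_comm]
    exact SetLike.GradedMul.mul_mem (A := B.grading) (B.d_mem hb) (eval_mem f b hb hx.2)

lemma lift_d (x : PathAlg A) : lift f b hb (d A x) = B.d (lift f b hb x) := by
  rw [lift_apply, lift_apply, fst_d, snd_d, map_add, d_eval, B.leibniz _ (B.d_mem hb), d_eval,
    B.d_d, map_sub, mul_add, ← mul_assoc (B.d b) (B.d b), B.mul_self_of_mem_one (B.d_mem hb)]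
  simp only [zero_add, pow_one, neg_smul, one_smul, zero_mul, add_zero, mul_sub]
  abel

lemma lift_incl (a : A) : lift f b hb (incl A a) = f a := by
  simp [lift_apply, incl_apply, eval]

lemma lift_t : lift f b hb (t A) = b := by
  simp [lift_apply, t, eval]

end lift

end PathAlg

/-- The dga `A[t, dt] = A ⊗ Λ(t, dt)`. -/
noncomputable def path (A : CDGA k) : CDGA k where
  carrier := PathAlg A
  grading := PathAlg.grading A
  mul_comm' := by
    intro i j x y hx hy
    have e1 : x.1 * y.1 = (-1 : k) ^ (i * j) • (y.1 * x.1) :=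
      PathAlg.poly_mul_comm (fun a ha b hb => A.mul_comm' ha hb) hx.1 hy.1
    have key : ∀ {i j : ℕ} {p q : A[X]}, p ∈ PathAlg.polyIn (PathAlg.shift A i) →
        q ∈ PathAlg.polyIn (A.grading j) →
        p * q = (-1 : k) ^ (i * j) • (PathAlg.polySign A q * p) := by
      intro i j p q hp hq
      rw [PathAlg.polySign_of_mem hq, smul_mul_assoc, smul_comm]
      have : (-1 : k) ^ j • (p * q) = (-1 : k) ^ (i * j) • (q * p) := by
        ext n
        rw [coeff_smul, coeff_smul, coeff_mul, coeff_mul, ← Finset.Nat.sum_antidiagonal_swap,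
          Finset.smul_sum, Finset.smul_sum]
        exact Finset.sum_congr rfl fun x _ => PathAlg.shift_mul_comm i j _ (hp _) _ (hq _)
      rw [← this, smul_smul, PathAlg.neg_one_pow_mul_self, one_smul]
    ext1
    · exact e1
    · rw [PathAlg.snd_mul, PathAlg.snd_smul, PathAlg.snd_mul, key hx.2 hy.1, smul_add, add_comm,
        key hy.2 hx.1, mul_comm j i, smul_smul, PathAlg.neg_one_pow_mul_self, one_smul]
  d := PathAlg.d A
  d_mem := by
    intro i x hx
    refine ⟨fun n => ?_, Submodule.sub_mem _ (fun n => ?_) (fun n => ?_)⟩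
    · simpa using A.d_mem (hx.1 n)
    · rw [coeff_derivative, ← Nat.cast_succ, ← nsmul_eq_mul']
      exact Submodule.smul_of_tower_mem _ _ (hx.1 _)
    · rw [coeff_coeffMap]
      exact PathAlg.shift_succ_mem (hx.2 n)
  d_d x := by
    ext n
    · simp [A.d_d]
    · simp [A.d_d, PathAlg.derivative_coeffMap]
  leibniz := by
    intro i x y hx
    ext1
    · simp only [PathAlg.fst_d, PathAlg.fst_mul, PathAlg.fst_add, PathAlg.fst_smul,
        PathAlg.coeffMap_d_mul, PathAlg.polySign_of_mem hx.1, smul_mul_assoc]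
    · have h1 := PathAlg.polySign_polySign hx.1
      have h2 : (-1 : k) ^ i • (PathAlg.polySign A x.1) = x.1 := by
        rw [PathAlg.polySign_of_mem hx.1, smul_smul, PathAlg.neg_one_pow_mul_self, one_smul]
      simp only [PathAlg.snd_d, PathAlg.fst_d, PathAlg.fst_mul, PathAlg.snd_mul, PathAlg.snd_add,
        PathAlg.snd_smul, map_add, PathAlg.coeffMap_d_mul, PathAlg.coeffMap_d_polySign, h1,
        derivative_mul]
      have h3 : (-1 : k) ^ i • (x.2 * coeffMap A.d y.1 +
          PathAlg.polySign A x.1 * (derivative y.1 - coeffMap A.d y.2)) =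
          -(PathAlg.polySign A x.2 * coeffMap A.d y.1) +
            x.1 * (derivative y.1 - coeffMap A.d y.2) := by
        rw [smul_add, ← smul_mul_assoc, ← smul_mul_assoc, h2, PathAlg.polySign_of_mem_shift hx.2,
          neg_mul, neg_neg]
      rw [h3]
      noncomm_ring

namespace path

/-- The element `t` of `A[t, dt]`. -/
noncomputable def t (A : CDGA k) : path A := PathAlg.t A

lemma t_mem (A : CDGA k) : t A ∈ (path A).grading 0 := PathAlg.t_mem

/-- The inclusion `A → A[t, dt]`. -/
noncomputable def incl (A : CDGA k) : A ⟶ path A := ⟨PathAlg.incl A, PathAlg.incl_mem, PathAlg.incl_d⟩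

/-- A morphism out of `A[t, dt]` is determined by its values on `A` and on `t`. -/
lemma hom_ext {A B : CDGA k} {f g : path A ⟶ B} (h : ∀ a, f (incl A a) = g (incl A a))
    (ht : f (t A) = g (t A)) : f = g :=
  Hom.ext (PathAlg.algHom_ext (f := f.toAlgHom) (g := g.toAlgHom) h ht
    ((hom_d f (t A)).trans ((congrArg B.d ht).trans (hom_d g (t A)).symm)))

variable {A B : CDGA k} (f : A ⟶ B) (b : B) (hb : b ∈ B.grading 0) [CharZero k]

/-- The morphism `A[t, dt] → B` which is `f` on `A` and sends `t` to an element `b` of degree `0`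
(hence `dt` to `db`). -/
noncomputable def lift : path A ⟶ B :=
  ⟨PathAlg.lift f b hb, PathAlg.lift_mem f b hb, PathAlg.lift_d f b hb⟩

@[simp] lemma lift_incl (a : A) : lift f b hb (incl A a) = f a := PathAlg.lift_incl f b hb a

@[simp] lemma lift_t : lift f b hb (t A) = b := PathAlg.lift_t f b hb

end path

lemma natCast_mem (A : CDGA k) (n : ℕ) : (n : A) ∈ A.grading 0 := SetLike.natCast_mem_graded _ n

lemma mul_mem_zero {A : CDGA k} {a b : A} (ha : a ∈ A.grading 0) (hb : b ∈ A.grading 0) :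
    a * b ∈ A.grading 0 := by
  simpa only [add_zero] using SetLike.mul_mem_graded ha hb

/-- Two morphisms out of `A[t, dt, s, ds]` agree if they agree on `A`, on `t` and on `s`. -/
lemma path_path_hom_ext {A B : CDGA k} {f g : path (path A) ⟶ B}
    (h : ∀ a, f (path.incl (path A) (path.incl A a)) = g (path.incl (path A) (path.incl A a)))
    (ht : f (path.incl (path A) (path.t A)) = g (path.incl (path A) (path.t A)))
    (hs : f (path.t (path A)) = g (path.t (path A))) : f = g := by
  refine path.hom_ext (fun x => ?_) hs
  have e : path.incl (path A) ≫ f = path.incl (path A) ≫ g := path.hom_ext h ht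
  exact DFunLike.congr_fun e x

section structureMaps

variable [CharZero k]

/-- The map `f ⊗ 1 : A[t, dt] → B[t, dt]`: it is `f` on `A` and sends `t` to `t`. -/
noncomputable def pathMap {A B : CDGA k} (f : A ⟶ B) : path A ⟶ path B :=
  path.lift (f ≫ path.incl B) (path.t B) (path.t_mem B)

@[simp] lemma pathMap_incl {A B : CDGA k} (f : A ⟶ B) (a : A) :
    pathMap f (path.incl A a) = path.incl B (f a) :=
  path.lift_incl _ _ _ _

@[simp] lemma pathMap_t {A B : CDGA k} (f : A ⟶ B) : pathMap f (path.t A) = path.t B :=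
  path.lift_t _ _ _

variable (k) in
/-- The functor `P(A) = A[t, dt]`, `P(f) = f ⊗ 1`. -/
noncomputable def pathFunctor : CDGA k ⥤ CDGA k where
  obj A := path A
  map f := pathMap f
  map_id A := path.hom_ext (by simp) (by simp)
  map_comp f g := path.hom_ext (by simp) (by simp)

/-- The evaluation `A[t, dt] → A` at `t = i`. -/
noncomputable def evalAt (A : CDGA k) (i : Fin 2) : path A ⟶ A :=
  path.lift (𝟙 A) ((i : ℕ) : A) (A.natCast_mem i)

@[simp] lemma evalAt_incl (A : CDGA k) (i : Fin 2) (a : A) : evalAt A i (path.incl A a) = a :=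
  path.lift_incl _ _ _ a

@[simp] lemma evalAt_t (A : CDGA k) (i : Fin 2) : evalAt A i (path.t A) = ((i : ℕ) : A) :=
  path.lift_t _ _ _

variable (k) in
/-- The functorial path `P(A) = A[t, dt]`, with `ι_A(a) = a` and `δⁱ_A(a(t)) = a(i)`. -/
noncomputable def functorialPath : FunctorialPath (CDGA k) where
  P := pathFunctor k
  ι := { app := fun A => path.incl A
         naturality := fun A B f => hom_ext fun a => (pathMap_incl f a).symm }
  δ i :=
    { app := fun A => evalAt A i
      naturality := fun A B f => by
        change pathMap f ≫ evalAt B i = evalAt A i ≫ f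
        exact path.hom_ext (by simp) (by simp) }
  ι_δ i A := hom_ext fun a => path.lift_incl _ _ _ a

/-- The symmetry `A[t, dt] → A[t, dt]`, `t ↦ 1 - t`. -/
noncomputable def symmMap (A : CDGA k) : path A ⟶ path A :=
  path.lift (path.incl A) (1 - path.t A)
    (Submodule.sub_mem _ SetLike.GradedOne.one_mem (path.t_mem A))

@[simp] lemma symmMap_incl (A : CDGA k) (a : A) : symmMap A (path.incl A a) = path.incl A a :=
  path.lift_incl _ _ _ a

@[simp] lemma symmMap_t (A : CDGA k) : symmMap A (path.t A) = 1 - path.t A :=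
  path.lift_t _ _ _

/- In `P²(A) = path (path A)` the two variables are `path.incl (path A) (path.t A)`, written `t`,
and `path.t (path A)`, written `s`. -/

/-- The interchange `A[t, dt, s, ds] → A[t, dt, s, ds]`, `t ↦ s`, `s ↦ t`. -/
noncomputable def interchangeMap (A : CDGA k) : path (path A) ⟶ path (path A) :=
  path.lift
    (path.lift (path.incl A ≫ path.incl (path A)) (path.t (path A)) (path.t_mem (path A)))
    (path.incl (path A) (path.t A)) (hom_mem _ (path.t_mem A))

@[simp] lemma interchangeMap_incl_incl (A : CDGA k) (a : A) :
    interchangeMap A (path.incl (path A) (path.incl A a)) =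
      path.incl (path A) (path.incl A a) := by
  simp [interchangeMap]

@[simp] lemma interchangeMap_incl_t (A : CDGA k) :
    interchangeMap A (path.incl (path A) (path.t A)) = path.t (path A) := by
  simp [interchangeMap]

@[simp] lemma interchangeMap_t (A : CDGA k) :
    interchangeMap A (path.t (path A)) = path.incl (path A) (path.t A) := by
  simp [interchangeMap]

/-- The coproduct `A[t, dt] → A[t, dt, s, ds]`, `t ↦ t s`. -/
noncomputable def coproductMap (A : CDGA k) : path A ⟶ path (path A) :=
  path.lift (path.incl A ≫ path.incl (path A)) (path.incl (path A) (path.t A) * path.t (path A))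
    (mul_mem_zero (hom_mem _ (path.t_mem A)) (path.t_mem (path A)))

@[simp] lemma coproductMap_incl (A : CDGA k) (a : A) :
    coproductMap A (path.incl A a) = path.incl (path A) (path.incl A a) :=
  path.lift_incl _ _ _ a

@[simp] lemma coproductMap_t (A : CDGA k) :
    coproductMap A (path.t A) = path.incl (path A) (path.t A) * path.t (path A) :=
  path.lift_t _ _ _

/-- The folding map `A[t, dt, s, ds] → A[t, dt]`, `t ↦ t`, `s ↦ t`. -/
noncomputable def foldingHom (A : CDGA k) : path (path A) ⟶ path A :=
  path.lift (𝟙 (path A)) (path.t A) (path.t_mem A)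

@[simp] lemma foldingHom_incl (A : CDGA k) (x : path A) :
    foldingHom A (path.incl (path A) x) = x :=
  path.lift_incl _ _ _ x

@[simp] lemma foldingHom_t (A : CDGA k) : foldingHom A (path.t (path A)) = path.t A :=
  path.lift_t _ _ _

lemma interchangeMap_interchangeMap (A : CDGA k) :
    interchangeMap A ≫ interchangeMap A = 𝟙 (path (path A)) :=
  path_path_hom_ext (by simp) (by simp) (by simp)

variable (k) in
/-- The functorial path `A[t, dt]` with its symmetry, interchange, coproduct and folding map. -/
noncomputable def pathStructure : PathStructure (CDGA k) where
  toFunctorialPath := functorialPath k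
  symmetry :=
    { τ :=
        { app := fun A => symmMap A
          naturality := fun A B f => by
            change pathMap f ≫ symmMap B = symmMap A ≫ pathMap f
            exact path.hom_ext (by simp) (by simp) }
      τ_τ := fun A => by
        change symmMap A ≫ symmMap A = 𝟙 (path A)
        exact path.hom_ext (by simp) (by simp)
      ι_τ := fun A => by
        change path.incl A ≫ symmMap A = path.incl A
        exact hom_ext (by simp)
      τ_δ := fun i A => by
        change symmMap A ≫ evalAt A i = evalAt A (1 - i)
        refine path.hom_ext (by simp) ?_
        fin_cases i <;> simp }
  interchange :=
    { μ :=
        { hom :=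
            { app := fun A => interchangeMap A
              naturality := fun A B f => by
                change pathMap (pathMap f) ≫ interchangeMap B =
                  interchangeMap A ≫ pathMap (pathMap f)
                exact path_path_hom_ext (by simp) (by simp) (by simp) }
          inv :=
            { app := fun A => interchangeMap A
              naturality := fun A B f => by
                change pathMap (pathMap f) ≫ interchangeMap B =
                  interchangeMap A ≫ pathMap (pathMap f)
                exact path_path_hom_ext (by simp) (by simp) (by simp) }
          hom_inv_id := by
            ext A : 2
            exact interchangeMap_interchangeMap A
          inv_hom_id := by
            ext A : 2
            exact interchangeMap_interchangeMap A }
      μ_δ := fun i A => by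
        change interchangeMap A ≫ evalAt (path A) i = pathMap (evalAt A i)
        exact path_path_hom_ext (by simp) (by simp) (by simp)
      μ_map_δ := fun i A => by
        change interchangeMap A ≫ pathMap (evalAt A i) = evalAt (path A) i
        exact path_path_hom_ext (by simp) (by simp) (by simp) }
  coproduct :=
    { c :=
        { app := fun A => coproductMap A
          naturality := fun A B f => by
            change pathMap f ≫ coproductMap B =
              coproductMap A ≫ pathMap (pathMap f)
            exact path.hom_ext (by simp) (by simp) }
      coassoc := fun A => by
        change coproductMap A ≫ coproductMap (path A) =
          coproductMap A ≫ pathMap (coproductMap A)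
        exact path.hom_ext (by simp) (by simp [mul_assoc])
      c_δ_one := fun A => by
        change coproductMap A ≫ evalAt (path A) 1 = 𝟙 (path A)
        exact path.hom_ext (by simp) (by simp)
      c_map_δ_one := fun A => by
        change coproductMap A ≫ pathMap (evalAt A 1) = 𝟙 (path A)
        exact path.hom_ext (by simp) (by simp)
      ι_c := fun A => by
        change path.incl A ≫ coproductMap A = path.incl A ≫ path.incl (path A)
        exact hom_ext (by simp)
      c_δ_zero := fun A => by
        change coproductMap A ≫ evalAt (path A) 0 = evalAt A 0 ≫ path.incl A
        exact path.hom_ext (by simp) (by simp)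
      c_map_δ_zero := fun A => by
        change coproductMap A ≫ pathMap (evalAt A 0) = evalAt A 0 ≫ path.incl A
        exact path.hom_ext (by simp) (by simp) }
  folding :=
    { nabla :=
        { app := fun A => foldingHom A
          naturality := fun A B f => by
            change pathMap (pathMap f) ≫ foldingHom B =
              foldingHom A ≫ pathMap f
            exact path_path_hom_ext (by simp) (by simp) (by simp) }
      nabla_δ := fun i A => by
        change foldingHom A ≫ evalAt A i = evalAt (path A) i ≫ evalAt A i
        exact path_path_hom_ext (by simp) (by simp) (by simp)
      ι_nabla := fun A => by
        change path.incl (path A) ≫ foldingHom A = 𝟙 (path A)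
        exact hom_ext (by simp) }

end structureMaps

/-! ### The categories in the equivalence -/

/-- `0`-connected dga's, as a full subcategory. -/
abbrev ZeroConnectedCDGA (k : Type u) [Field k] := (zeroConnected k).FullSubcategory

/-- Sullivan minimal dga's, as a full subcategory. -/
abbrev SullivanMinimalCDGA (k : Type u) [Field k] := (sullivanMinimal k).FullSubcategory

/-- The quasi-isomorphisms between `0`-connected dga's. -/
def zeroConnectedQuasiIsos (k : Type u) [Field k] : MorphismProperty (ZeroConnectedCDGA k) :=
  (quasiIsos k).inverseImage (zeroConnected k).ι

/-- The homotopy category `Ho(0-connected dga's)`: the localization at the quasi-isomorphisms. -/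
abbrev HoZeroConnected (k : Type u) [Field k] := (zeroConnectedQuasiIsos k).Localization

/-- The relation "there is a homotopy `A → B[t, dt]` from `f` to `g`" between morphisms of Sullivan
minimal dga's. -/
def homotopyRel (k : Type u) [Field k] [CharZero k] : HomRel (SullivanMinimalCDGA k) :=
  fun _ _ f g => (functorialPath k).Homotopic f.hom g.hom

/-- The category `π(Sullivan minimal dga's)`: the quotient by the congruence generated by the
homotopy relation. -/
abbrev PiSullivanMinimal (k : Type u) [Field k] [CharZero k] :=
  CategoryTheory.Quotient (homotopyRel k)

end CDGA

/-! ## Graded algebras -/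

/-! For the P-category, everything is tested on elements. Fibre products are graded subalgebras of
products, pull-back squares are characterised by pairs of elements (`isPullback_iff`), and
quasi-isomorphisms are tested on cocycles that need not be homogeneous (`quasiIsos_iff`); so (P₃) is
a diagram chase. (P₂) rests on the Poincaré lemma: in characteristic 0 the `dt`-part of an element
of A[t, dt] can be integrated. (P₄) holds coefficient by coefficient. For (P₅), a path is lifted
along v arbitrarily and its ends are then corrected by u(1 - t) + wt with u, w in the kernel of v.

The equivalence rests on two facts. The first is that morphisms from a Sullivan minimal M lift
through surjective quasi-isomorphisms (`IsFreeOn.exists_lift`). If v is such a map then so is the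
map of (P₅), hence homotopies lift as well, and v induces a bijection on [M, -], the classes for the
equivalence relation generated by homotopy. The factorization through the mapping path extends this
to all quasi-isomorphisms. Now [M, -] inverts quasi-isomorphisms and is generated by the class of
the identity, while homotopic maps agree in the homotopy category; a Yoneda argument
(`bijective_app_of_isInvertedBy`) identifies [M, -] with Hom(M, -) there. Full faithfulness follows,
and homotopy need not be shown to be transitive.

The second fact, which gives essential surjectivity, is that minimal models exist
(`exists_minimalModel`). All conceivable generators form one inductive type: a generator records its
degree, a term for its differential, written in generators of the same type, and its image in A. The
free algebra on all of them has a derivation D, whose square need not vanish, and a graded morphism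
to A. A model is the subalgebra generated by a set S of generators on which D² = 0, the morphism
commutes with the differentials, and the differentials are well-founded. Successive stages are then
subsets of a fixed set, limits are unions, and Zorn's lemma applies. A maximal set of new generators
of degree n that keeps Hⁿ injective makes Hⁿ surjective and Hⁿ⁺¹ injective, since a class violating
either would supply one more admissible generator. The differential of a generator of degree n lies
in the subalgebra generated in degrees at most n, so for degree reasons it is decomposable, which is
minimality. -/

section GradedAlgebras

variable {k : Type*} [Field k] {R : Type*} [Ring R] [Algebra k R]

namespace GradedAlgebra

section proj

variable (𝒜 : ℕ → Submodule k R) [GradedAlgebra 𝒜]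

lemma proj_mem (n : ℕ) (x : R) : proj 𝒜 n x ∈ 𝒜 n := (DirectSum.decompose 𝒜 x n).2

variable {𝒜} in
lemma proj_eq_self {n : ℕ} {x : R} (hx : x ∈ 𝒜 n) : proj 𝒜 n x = x :=
  DirectSum.decompose_of_mem_same _ hx

variable {𝒜} in
lemma proj_eq_zero {n m : ℕ} {x : R} (hx : x ∈ 𝒜 n) (h : n ≠ m) : proj 𝒜 m x = 0 :=
  DirectSum.decompose_of_mem_ne _ hx h

lemma proj_mul (n : ℕ) (x y : R) :
    proj 𝒜 n (x * y) = ∑ ij ∈ Finset.HasAntidiagonal.antidiagonal n, proj 𝒜 ij.1 x * proj 𝒜 ij.2 y := by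
  simp only [proj_apply, DirectSum.decompose_mul]
  exact DirectSum.coe_mul_apply_eq_sum_antidiagonal 𝒜 _ _ n

lemma proj_zero_mul (x y : R) : proj 𝒜 0 (x * y) = proj 𝒜 0 x * proj 𝒜 0 y := by
  rw [proj_mul, Finset.Nat.antidiagonal_zero, Finset.sum_singleton]

lemma proj_algebraMap_zero (c : k) : proj 𝒜 0 (algebraMap k R c) = algebraMap k R c :=
  proj_eq_self (SetLike.algebraMap_mem_graded 𝒜 c)

lemma proj_algebraMap_of_ne {n : ℕ} (hn : n ≠ 0) (c : k) : proj 𝒜 n (algebraMap k R c) = 0 :=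
  proj_eq_zero (SetLike.algebraMap_mem_graded 𝒜 c) hn.symm

lemma exists_forall_ge_proj_eq_zero (x : R) : ∃ N, ∀ n, N ≤ n → proj 𝒜 n x = 0 := by
  induction x using DirectSum.Decomposition.inductionOn 𝒜 with
  | zero => exact ⟨0, by simp⟩
  | @homogeneous m x => exact ⟨m + 1, fun n hn => proj_eq_zero x.2 (by omega)⟩
  | add x y hx hy =>
    obtain ⟨N, hN⟩ := hx
    obtain ⟨M, hM⟩ := hy
    exact ⟨max N M, fun n hn => by
      rw [map_add, hN n (le_trans (le_max_left _ _) hn), hM n (le_trans (le_max_right _ _) hn),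
        add_zero]⟩

variable {𝒜} in
lemma ext_proj {x y : R} (h : ∀ n, proj 𝒜 n x = proj 𝒜 n y) : x = y :=
  (DirectSum.decompose 𝒜).injective (DFinsupp.ext fun n => Subtype.ext (h n))

lemma sum_range_proj {x : R} {N : ℕ} (h : ∀ n, N ≤ n → proj 𝒜 n x = 0) :
    ∑ i ∈ Finset.range N, proj 𝒜 i x = x := by
  refine ext_proj (𝒜 := 𝒜) fun n => ?_
  rw [map_sum, Finset.sum_eq_single n, proj_eq_self (proj_mem 𝒜 n x)]
  · exact fun i _ hi => proj_eq_zero (proj_mem 𝒜 i x) hi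
  · intro hn
    rw [h n (by simpa using hn), map_zero]

variable {𝒜} in
-- The shift `c` is 1 for differentials and 0 for morphisms.
lemma linearMap_proj {S : Type*} [Ring S] [Algebra k S] {ℬ : ℕ → Submodule k S} [GradedAlgebra ℬ]
    (c : ℕ) (f : R →ₗ[k] S) (hf : ∀ n, ∀ x ∈ 𝒜 n, f x ∈ ℬ (n + c)) (n : ℕ) (x : R) :
    proj ℬ (n + c) (f x) = f (proj 𝒜 n x) := by
  induction x using DirectSum.Decomposition.inductionOn 𝒜 with
  | zero => simp
  | @homogeneous m x =>
    by_cases h : m = n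
    · subst h
      rw [proj_eq_self x.2, proj_eq_self (hf _ _ x.2)]
    · rw [proj_eq_zero x.2 h, map_zero, proj_eq_zero (hf _ _ x.2) (by omega)]
  | add x y hx hy => rw [map_add, map_add, map_add, map_add, hx, hy]

end proj

/-- A grading is determined by a system of projections. -/
noncomputable abbrev ofProj (𝒜 : ℕ → Submodule k R) [SetLike.GradedMonoid 𝒜]
    (π : ℕ → R →ₗ[k] R) (hmem : ∀ n x, π n x ∈ 𝒜 n)
    (hself : ∀ n, ∀ x ∈ 𝒜 n, π n x = x) (hne : ∀ n m, ∀ x ∈ 𝒜 n, n ≠ m → π m x = 0)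
    (hsum : ∀ x, ∃ N, ∑ i ∈ Finset.range N, π i x = x) : GradedAlgebra 𝒜 :=
  have h : DirectSum.IsInternal 𝒜 := by
    have h : ∀ (x : DirectSum ℕ fun n => 𝒜 n) (m : ℕ),
        π m (DirectSum.coeAddMonoidHom 𝒜 x) = x m := by
      intro x m
      induction x using DirectSum.induction_on with
      | zero => simp
      | of n y =>
        rw [DirectSum.coeAddMonoidHom_of, DirectSum.coe_of_apply]
        split_ifs with h
        · subst h
          exact hself _ _ y.2
        · exact (hne _ _ _ y.2 h).trans (by simp)
      | add x y hx hy => simp [hx, hy]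
    refine ⟨(injective_iff_map_eq_zero _).mpr fun x hx => ?_, fun x => ?_⟩
    · ext m : 1
      apply Subtype.ext
      rw [← h, hx]
      simp
    · obtain ⟨N, hN⟩ := hsum x
      refine ⟨∑ i ∈ Finset.range N, DirectSum.of (fun n => 𝒜 n) i ⟨π i x, hmem i x⟩, ?_⟩
      rw [map_sum]
      simpa using hN
  { toDecomposition := h.chooseDecomposition }

section subalgebra

variable (𝒜 : ℕ → Submodule k R) [GradedAlgebra 𝒜]

/-- The grading of a subalgebra induced by a grading of the algebra. -/
def restrict (S : Subalgebra k R) (n : ℕ) : Submodule k S := (𝒜 n).comap S.val.toLinearMap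

instance (S : Subalgebra k R) : SetLike.GradedMonoid (restrict 𝒜 S) where
  one_mem := SetLike.GradedOne.one_mem (A := 𝒜)
  mul_mem _ _ _ _ hx hy := SetLike.GradedMul.mul_mem (A := 𝒜) hx hy

/-- A subalgebra which is stable under the projections is graded. -/
noncomputable abbrev restrictGradedAlgebra (S : Subalgebra k R)
    (hS : ∀ x ∈ S, ∀ n, proj 𝒜 n x ∈ S) : GradedAlgebra (restrict 𝒜 S) :=
  ofProj _ (fun n => ((proj 𝒜 n).restrict (p := S.toSubmodule) (q := S.toSubmodule)
      fun x hx => hS x hx n))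
    (fun n x => proj_mem 𝒜 n x)
    (fun n x hx => Subtype.ext (proj_eq_self hx))
    (fun n m x hx h => Subtype.ext (proj_eq_zero hx h))
    (fun x => by
      obtain ⟨N, hN⟩ := exists_forall_ge_proj_eq_zero 𝒜 (x : R)
      refine ⟨N, Subtype.ext ?_⟩
      rw [AddSubmonoidClass.coe_finsetSum]
      exact sum_range_proj 𝒜 hN)

lemma proj_mem_adjoin {s : Set R} (hs : ∀ x ∈ s, ∃ n, x ∈ 𝒜 n) {x : R}
    (hx : x ∈ Algebra.adjoin k s) (n : ℕ) : proj 𝒜 n x ∈ Algebra.adjoin k s := by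
  induction hx using Algebra.adjoin_induction generalizing n with
  | mem x hx =>
    obtain ⟨m, hm⟩ := hs x hx
    by_cases h : m = n
    · subst h
      rw [proj_eq_self hm]
      exact Algebra.subset_adjoin hx
    · rw [proj_eq_zero hm h]
      exact zero_mem _
  | algebraMap c =>
    by_cases h : n = 0
    · subst h
      rw [proj_algebraMap_zero]
      exact Subalgebra.algebraMap_mem _ c
    · rw [proj_algebraMap_of_ne 𝒜 h]
      exact zero_mem _
  | add x y _ _ hx hy =>
    rw [map_add]
    exact add_mem (hx n) (hy n)
  | mul x y _ _ hx hy =>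
    rw [proj_mul]
    exact sum_mem fun ij _ => mul_mem (hx _) (hy _)

/-- The degree `0` part of an algebra generated in positive degrees. -/
lemma proj_zero_mem_of_mem_adjoin {s : Set R} (hs : ∀ x ∈ s, ∃ n, x ∈ 𝒜 (n + 1)) {x : R}
    (hx : x ∈ Algebra.adjoin k s) : ∃ c : k, proj 𝒜 0 x = algebraMap k R c := by
  induction hx using Algebra.adjoin_induction with
  | mem x hx =>
    obtain ⟨m, hm⟩ := hs x hx
    exact ⟨0, by rw [proj_eq_zero hm (by omega), map_zero]⟩
  | algebraMap c => exact ⟨c, proj_algebraMap_zero 𝒜 c⟩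
  | add x y _ _ hx hy =>
    obtain ⟨c, hc⟩ := hx
    obtain ⟨d, hd⟩ := hy
    exact ⟨c + d, by rw [map_add, hc, hd, map_add]⟩
  | mul x y _ _ hx hy =>
    obtain ⟨c, hc⟩ := hx
    obtain ⟨d, hd⟩ := hy
    exact ⟨c * d, by rw [proj_zero_mul, hc, hd, map_mul]⟩

end subalgebra

end GradedAlgebra

/-- Two skew derivations which agree on generators along a morphism agree on the algebra that they
generate. -/
lemma map_derivation_of_mem_adjoin {S : Type*} [Ring S] [Algebra k S] (F : R →ₐ[k] S)
    (D : R →ₗ[k] R) (D' : S →ₗ[k] S) (σ : R → R) (σ' : S → S)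
    (hD : ∀ x y, D (x * y) = D x * y + σ x * D y)
    (hD' : ∀ x y, D' (x * y) = D' x * y + σ' x * D' y)
    (hσ : ∀ x, F (σ x) = σ' (F x)) (h1 : D 1 = 0) (h1' : D' 1 = 0) {s : Set R}
    (hs : ∀ x ∈ s, F (D x) = D' (F x)) {x : R} (hx : x ∈ Algebra.adjoin k s) :
    F (D x) = D' (F x) := by
  induction hx using Algebra.adjoin_induction with
  | mem x hx => exact hs x hx
  | algebraMap c => simp [Algebra.algebraMap_eq_smul_one, h1, h1']
  | add x y _ _ hx hy => rw [map_add, map_add, map_add, map_add, hx, hy]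
  | mul x y _ _ hx hy => rw [hD, map_add, map_mul, map_mul, map_mul, hD', hσ, hx, hy]

/-- An element of a generated subalgebra involves only finitely many generators, and directedness
puts them into one member of the family. -/
lemma mem_adjoin_sUnion_of_directedOn {c : Set (Set R)} (hne : c.Nonempty)
    (hc : DirectedOn (· ⊆ ·) c) {x : R} (hx : x ∈ Algebra.adjoin k (⋃₀ c)) :
    ∃ s ∈ c, x ∈ Algebra.adjoin k s := by
  induction hx using Algebra.adjoin_induction with
  | mem x hx =>
    obtain ⟨s, hs, hx⟩ := hx
    exact ⟨s, hs, Algebra.subset_adjoin hx⟩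
  | algebraMap a =>
    obtain ⟨s, hs⟩ := hne
    exact ⟨s, hs, Subalgebra.algebraMap_mem _ a⟩
  | add x y _ _ hx hy =>
    obtain ⟨s, hs, hx⟩ := hx
    obtain ⟨t, ht, hy⟩ := hy
    obtain ⟨r, hr, h, h'⟩ := hc s hs t ht
    exact ⟨r, hr, add_mem (Algebra.adjoin_mono h hx) (Algebra.adjoin_mono h' hy)⟩
  | mul x y _ _ hx hy =>
    obtain ⟨s, hs, hx⟩ := hx
    obtain ⟨t, ht, hy⟩ := hy
    obtain ⟨r, hr, h, h'⟩ := hc s hs t ht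
    exact ⟨r, hr, mul_mem (Algebra.adjoin_mono h hx) (Algebra.adjoin_mono h' hy)⟩

end GradedAlgebras

/-! ## Quasi-isomorphisms -/

namespace CDGA

variable {k : Type u} [Field k]

/-- The component of degree `n`. -/
noncomputable abbrev comp (A : CDGA k) (n : ℕ) : A →ₗ[k] A := GradedAlgebra.proj A.grading n

lemma comp_d (A : CDGA k) (n : ℕ) (a : A) : A.comp (n + 1) (A.d a) = A.d (A.comp n a) :=
  GradedAlgebra.linearMap_proj 1 A.d (fun _ _ h => A.d_mem h) n a

lemma comp_zero_d (A : CDGA k) (a : A) : A.comp 0 (A.d a) = 0 := by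
  refine LinearMap.congr_fun (f := (A.comp 0).comp A.d) (g := 0) (A.linearMap_ext fun n a h => ?_) a
  exact GradedAlgebra.proj_eq_zero (A.d_mem h) (by omega)

lemma comp_hom {A B : CDGA k} (f : A ⟶ B) (n : ℕ) (a : A) : B.comp n (f a) = f (A.comp n a) :=
  GradedAlgebra.linearMap_proj (𝒜 := A.grading) (ℬ := B.grading) 0 f.toAlgHom.toLinearMap (fun _ _ h => f.map_mem h) n a

lemma comp_mem (A : CDGA k) (n : ℕ) (a : A) : A.comp n a ∈ A.grading n :=
  GradedAlgebra.proj_mem _ n a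

lemma comp_eq_self {A : CDGA k} {n : ℕ} {a : A} (h : a ∈ A.grading n) : A.comp n a = a :=
  GradedAlgebra.proj_eq_self h

lemma comp_d_of_mem {A : CDGA k} {n : ℕ} {a b : A} (h : A.d a = b) (hb : b ∈ A.grading (n + 1)) :
    A.d (A.comp n a) = b := by
  rw [← comp_d, h, comp_eq_self hb]

/-- This removes the case distinction on `n`: a coboundary may be witnessed by any element, since
the component of the right degree serves as well, and nothing of degree 0 is a nonzero `d b`. -/
lemma mem_coboundaries {A : CDGA k} {n : ℕ} {a : A} :
    a ∈ A.coboundaries n ↔ a ∈ A.grading n ∧ ∃ b, A.d b = a := by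
  cases n with
  | zero =>
    refine ⟨fun h => ?_, fun ⟨h, b, hb⟩ => ?_⟩
    · have h' : a = 0 := h
      exact h' ▸ ⟨zero_mem _, 0, map_zero _⟩
    · change a = 0
      rw [← comp_eq_self h, ← hb, comp_zero_d]
  | succ n =>
    refine ⟨?_, fun ⟨h, b, hb⟩ => ⟨A.comp n b, A.comp_mem n b, comp_d_of_mem hb h⟩⟩
    rintro ⟨b, hb, rfl⟩
    exact ⟨A.d_mem hb, b, rfl⟩

lemma cohomology_mk_eq_zero_iff {A : CDGA k} {n : ℕ} (x : A.cocycles n) :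
    (Submodule.Quotient.mk x : A.cohomology n) = 0 ↔ ∃ b, A.d b = x :=
  (Submodule.Quotient.mk_eq_zero _).trans
    (mem_coboundaries.trans ⟨fun h => h.2, fun h => ⟨x.2.1, h⟩⟩)

lemma cohomologyMap_injective_iff {A B : CDGA k} (f : A ⟶ B) (n : ℕ) :
    Function.Injective (cohomologyMap f n) ↔
      ∀ a ∈ A.grading n, A.d a = 0 → (∃ b, B.d b = f a) → ∃ b, A.d b = a := by
  rw [injective_iff_map_eq_zero]
  constructor
  · rintro h a ha hda ⟨b, hb⟩
    exact (cohomology_mk_eq_zero_iff _).mp (h (Submodule.Quotient.mk ⟨a, ha, hda⟩)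
      ((cohomology_mk_eq_zero_iff _).mpr ⟨b, hb⟩))
  · intro h x hx
    obtain ⟨⟨a, ha, hda⟩, rfl⟩ := Submodule.Quotient.mk_surjective _ x
    exact (cohomology_mk_eq_zero_iff _).mpr (h a ha hda ((cohomology_mk_eq_zero_iff _).mp hx))

lemma cohomologyMap_surjective_iff {A B : CDGA k} (f : A ⟶ B) (n : ℕ) :
    Function.Surjective (cohomologyMap f n) ↔
      ∀ b ∈ B.grading n, B.d b = 0 → ∃ a ∈ A.grading n, A.d a = 0 ∧ ∃ c, b = f a + B.d c := by
  constructor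
  · intro h b hb hdb
    obtain ⟨x, hx⟩ := h (Submodule.Quotient.mk ⟨b, hb, hdb⟩)
    obtain ⟨⟨a, ha, hda⟩, rfl⟩ := Submodule.Quotient.mk_surjective _ x
    have hx' := (Submodule.Quotient.eq _).mp hx.symm
    obtain ⟨c, hc⟩ := (mem_coboundaries.mp hx').2
    exact ⟨a, ha, hda, c, by rw [hc]; exact (add_sub_cancel _ _).symm⟩
  · intro h x
    obtain ⟨⟨b, hb, hdb⟩, rfl⟩ := Submodule.Quotient.mk_surjective _ x
    obtain ⟨a, ha, hda, c, hc⟩ := h b hb hdb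
    refine ⟨Submodule.Quotient.mk ⟨a, ha, hda⟩, Eq.symm ((Submodule.Quotient.eq _).mpr ?_)⟩
    refine mem_coboundaries.mpr ⟨sub_mem hb (f.map_mem ha), c, ?_⟩
    exact (sub_eq_of_eq_add' hc).symm

/-- Quasi-isomorphisms in terms of elements which need not be homogeneous. -/
lemma quasiIsos_iff {A B : CDGA k} (f : A ⟶ B) :
    quasiIsos k f ↔ (∀ a, A.d a = 0 → (∃ b, B.d b = f a) → ∃ b, A.d b = a) ∧
      ∀ b, B.d b = 0 → ∃ a, A.d a = 0 ∧ ∃ c, b = f a + B.d c := by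
  have e : quasiIsos k f ↔ ∀ n, Function.Injective (cohomologyMap f n) ∧
    Function.Surjective (cohomologyMap f n) := Iff.rfl
  simp only [e, cohomologyMap_injective_iff, cohomologyMap_surjective_iff]
  have hcl : ∀ {A : CDGA k} {a : A} (n : ℕ), A.d a = 0 → A.d (A.comp n a) = 0 := fun n h => by
    rw [← comp_d, h, map_zero]
  constructor
  · intro h
    constructor
    · rintro a ha ⟨b, hb⟩
      obtain ⟨N, hN⟩ := GradedAlgebra.exists_forall_ge_proj_eq_zero A.grading a
      -- Each component of a cocycle is a cocycle; finitely many are nonzero, so primitives can be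
      -- chosen one component at a time and added.
      have h1 : ∀ n, ∃ c, A.d c = A.comp n a := fun n => by
        refine (h n).1 _ (A.comp_mem n a) (hcl n ha) ?_
        rw [← comp_hom, ← hb]
        cases n with
        | zero => exact ⟨0, by rw [comp_zero_d, map_zero]⟩
        | succ n => exact ⟨B.comp n b, (comp_d _ _ _).symm⟩
      choose c hc using h1
      exact ⟨∑ i ∈ Finset.range N, c i, by
        simp only [map_sum, hc, comp, GradedAlgebra.sum_range_proj _ hN]⟩
    · intro b hb
      obtain ⟨N, hN⟩ := GradedAlgebra.exists_forall_ge_proj_eq_zero B.grading b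
      choose a _ hda c hc using fun n => (h n).2 _ (B.comp_mem n b) (hcl n hb)
      refine ⟨∑ i ∈ Finset.range N, a i, by simp [hda], ∑ i ∈ Finset.range N, c i, ?_⟩
      rw [map_sum, map_sum, ← Finset.sum_add_distrib, Finset.sum_congr rfl fun i _ => (hc i).symm]
      exact (GradedAlgebra.sum_range_proj _ hN).symm
  · rintro ⟨h, h'⟩ n
    refine ⟨fun a _ ha hb => h a ha hb, fun b hb hdb => ?_⟩
    obtain ⟨a, ha, c, hc⟩ := h' b hdb
    refine ⟨A.comp n a, A.comp_mem n a, hcl n ha, ?_⟩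
    rw [← comp_hom, ← comp_eq_self hb, hc, map_add]
    cases n with
    | zero => exact ⟨0, by rw [comp_zero_d, map_zero]⟩
    | succ n => exact ⟨B.comp n c, by rw [comp_d]⟩

/-- The algebraic inverse is automatically graded and compatible with `d`, because f commutes with
the projections and the differentials and is injective. -/
lemma isIso_of_bijective {A B : CDGA k} (f : A ⟶ B) (hf : Function.Bijective f) : IsIso f := by
  let e : A ≃ₐ[k] B := AlgEquiv.ofBijective f.toAlgHom hf
  have he : ∀ a, e a = f a := fun _ => rfl
  have hs : ∀ b, f (e.symm b) = b := e.apply_symm_apply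
  refine ⟨⟨e.symm.toAlgHom, fun {i b} hb => ?_, fun b => hf.1 ?_⟩, hom_ext fun a => ?_,
    hom_ext fun b => hs b⟩
  · have : A.comp i (e.symm b) = e.symm b := hf.1 (by rw [← comp_hom, hs, comp_eq_self hb])
    change e.symm b ∈ _
    rw [← this]
    exact A.comp_mem _ _
  · change f (e.symm (B.d b)) = f (A.d (e.symm b))
    rw [hs, hom_d, hs]
  · exact e.symm_apply_apply a

lemma bijective_of_isIso {A B : CDGA k} (f : A ⟶ B) [IsIso f] : Function.Bijective f :=
  Function.bijective_iff_has_inverse.mpr ⟨inv f, fun a => by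
    rw [← comp_apply, IsIso.hom_inv_id, id_apply], fun a => by
    rw [← comp_apply, IsIso.inv_hom_id, id_apply]⟩

lemma cohomologyMap_comp {A B D : CDGA k} (f : A ⟶ B) (g : B ⟶ D) (n : ℕ) :
    ⇑(cohomologyMap (f ≫ g) n) = cohomologyMap g n ∘ cohomologyMap f n := by
  funext x
  obtain ⟨a, rfl⟩ := Submodule.Quotient.mk_surjective _ x
  rfl

lemma quasiIsos_of_isIso {A B : CDGA k} (f : A ⟶ B) [IsIso f] : quasiIsos k f := by
  obtain ⟨hi, hs⟩ := bijective_of_isIso f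
  rw [quasiIsos_iff]
  refine ⟨fun a _ ⟨b, hb⟩ => ?_, fun b hb => ?_⟩
  · obtain ⟨c, rfl⟩ := hs b
    exact ⟨c, hi (by rw [hom_d, hb])⟩
  · obtain ⟨a, rfl⟩ := hs b
    exact ⟨a, hi (by rw [hom_d, hb, map_zero]), 0, by simp⟩

instance : (quasiIsos k).HasTwoOutOfThreeProperty where
  comp_mem f g hf hg n := by
    rw [cohomologyMap_comp]
    exact (hg n).comp (hf n)
  of_postcomp f g hg hfg n := by
    have := hfg n
    rw [cohomologyMap_comp] at this
    exact (Function.Bijective.of_comp_iff' (hg n) _).mp this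
  of_precomp f g hf hfg n := by
    have := hfg n
    rw [cohomologyMap_comp] at this
    exact (Function.Bijective.of_comp_iff _ (hf n)).mp this

end CDGA

/-! ## Limits of dga's -/

namespace CDGA

variable {k : Type u} [Field k]

variable (k) in
/-- The zero algebra. -/
noncomputable def zero : CDGA k where
  carrier := PUnit.{u + 1}
  grading _ := ⊤
  gradedAlgebra :=
    letI : SetLike.GradedMonoid fun _ : ℕ => (⊤ : Submodule k PUnit.{u + 1}) :=
      { one_mem := trivial, mul_mem := fun _ _ _ _ _ _ => trivial }
    GradedAlgebra.ofProj _ (fun _ => 0) (fun _ _ => trivial) (fun _ _ _ => rfl)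
      (fun _ _ _ _ _ => rfl) (fun _ => ⟨0, rfl⟩)
  mul_comm' _ _ := rfl
  d := 0
  d_mem _ := trivial
  d_d _ := rfl
  leibniz _ _ := rfl

variable (k) in
/-- The zero algebra is the final object. -/
noncomputable def zeroIsTerminal : IsTerminal (zero k) :=
  IsTerminal.ofUniqueHom
    (fun _ => ⟨{ toFun := fun _ => PUnit.unit, map_one' := rfl, map_mul' := fun _ _ => rfl,
                 map_zero' := rfl, map_add' := fun _ _ => rfl, commutes' := fun _ => rfl },
      fun _ => trivial, fun _ => rfl⟩)
    (fun _ _ => hom_ext fun _ => rfl)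

/-- The product of two dga's. -/
noncomputable def prod (A B : CDGA k) : CDGA k where
  carrier := A × B
  grading n := (A.grading n).prod (B.grading n)
  gradedAlgebra :=
    letI : SetLike.GradedMonoid fun n => (A.grading n).prod (B.grading n) :=
      { one_mem := ⟨SetLike.GradedOne.one_mem, SetLike.GradedOne.one_mem⟩
        mul_mem := fun _ _ _ _ hx hy =>
          ⟨SetLike.GradedMul.mul_mem hx.1 hy.1, SetLike.GradedMul.mul_mem hx.2 hy.2⟩ }
    GradedAlgebra.ofProj _ (fun n => (A.comp n).prodMap (B.comp n))
      (fun n x => ⟨A.comp_mem n x.1, B.comp_mem n x.2⟩)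
      (fun n x hx => Prod.ext (comp_eq_self hx.1) (comp_eq_self hx.2))
      (fun n m x hx h => Prod.ext (GradedAlgebra.proj_eq_zero hx.1 h)
        (GradedAlgebra.proj_eq_zero hx.2 h))
      (fun x => by
        obtain ⟨N, hN⟩ := GradedAlgebra.exists_forall_ge_proj_eq_zero A.grading x.1
        obtain ⟨M, hM⟩ := GradedAlgebra.exists_forall_ge_proj_eq_zero B.grading x.2
        refine ⟨max N M, Prod.ext ?_ ?_⟩
        · rw [Prod.fst_sum]
          exact GradedAlgebra.sum_range_proj _ fun n hn => hN n (le_trans (le_max_left _ _) hn)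
        · rw [Prod.snd_sum]
          exact GradedAlgebra.sum_range_proj _ fun n hn => hM n (le_trans (le_max_right _ _) hn))
  mul_comm' hx hy := Prod.ext (A.mul_comm' hx.1 hy.1) (B.mul_comm' hx.2 hy.2)
  d := A.d.prodMap B.d
  d_mem hx := ⟨A.d_mem hx.1, B.d_mem hx.2⟩
  d_d x := Prod.ext (A.d_d x.1) (B.d_d x.2)
  leibniz y hx := Prod.ext (A.leibniz y.1 hx.1) (B.leibniz y.2 hx.2)

/-- A subalgebra which is stable under the projections and the differential is a dga. -/
noncomputable def ofSubalgebra (A : CDGA k) (S : Subalgebra k A)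
    (hS : ∀ x ∈ S, ∀ n, A.comp n x ∈ S) (hd : ∀ x ∈ S, A.d x ∈ S) : CDGA k where
  carrier := S
  grading := GradedAlgebra.restrict A.grading S
  gradedAlgebra := GradedAlgebra.restrictGradedAlgebra A.grading S hS
  mul_comm' hx hy := Subtype.ext (A.mul_comm' hx hy)
  d := A.d.restrict (p := S.toSubmodule) (q := S.toSubmodule) hd
  d_mem hx := A.d_mem hx
  d_d x := Subtype.ext (A.d_d x)
  leibniz y hx := Subtype.ext (A.leibniz (y : A) hx)

section pullback

variable {A B D : CDGA k} (a : A ⟶ D) (b : B ⟶ D)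

/-- The fibre product `A ×_D B`. -/
noncomputable def fibreProduct : CDGA k :=
  ofSubalgebra (prod A B)
    (AlgHom.equalizer (a.toAlgHom.comp (AlgHom.fst k A B)) (b.toAlgHom.comp (AlgHom.snd k A B)))
    (fun x hx n => by
      have h : ∀ x : prod A B, (prod A B).comp n x = (A.comp n x.1, B.comp n x.2) := fun x => by
        have h1 := comp_hom (A := prod A B) (B := A) ⟨AlgHom.fst k A B, fun h => h.1, fun _ => rfl⟩ n x
        have h2 := comp_hom (A := prod A B) (B := B) ⟨AlgHom.snd k A B, fun h => h.2, fun _ => rfl⟩ n x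
        exact Prod.ext h1.symm h2.symm
      have hx' : a x.1 = b x.2 := hx
      rw [h]
      change a (A.comp n x.1) = b (B.comp n x.2)
      rw [← comp_hom, ← comp_hom, hx'])
    (fun x hx => by
      have hx' : a x.1 = b x.2 := hx
      change a (A.d x.1) = b (B.d x.2)
      rw [hom_d, hom_d, hx'])

/-- The first projection of the fibre product. -/
noncomputable def fibreProductFst : fibreProduct a b ⟶ A :=
  ⟨(AlgHom.fst k A B).comp (Subalgebra.val _), fun h => h.1, fun _ => rfl⟩

/-- The second projection of the fibre product. -/
noncomputable def fibreProductSnd : fibreProduct a b ⟶ B :=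
  ⟨(AlgHom.snd k A B).comp (Subalgebra.val _), fun h => h.2, fun _ => rfl⟩

variable {a b}

/-- The element of the fibre product given by a pair of elements with the same image. -/
def fibreProductMk (x : A) (y : B) (h : a x = b y) : fibreProduct a b := ⟨(x, y), h⟩

@[simp] lemma fibreProductFst_mk (x : A) (y : B) (h : a x = b y) :
    fibreProductFst a b (fibreProductMk x y h) = x := rfl

@[simp] lemma fibreProductSnd_mk (x : A) (y : B) (h : a x = b y) :
    fibreProductSnd a b (fibreProductMk x y h) = y := rfl

lemma fibreProduct_ext {x y : fibreProduct a b}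
    (h : fibreProductFst a b x = fibreProductFst a b y)
    (h' : fibreProductSnd a b x = fibreProductSnd a b y) : x = y :=
  Subtype.ext (Prod.ext h h')

lemma fibreProduct_condition : fibreProductFst a b ≫ a = fibreProductSnd a b ≫ b :=
  hom_ext fun x => x.2

/-- The universal property of the fibre product. -/
noncomputable def fibreProductLift {X : CDGA k} (f : X ⟶ A) (g : X ⟶ B) (h : f ≫ a = g ≫ b) :
    X ⟶ fibreProduct a b :=
  ⟨(f.toAlgHom.prod g.toAlgHom).codRestrict _ fun x => DFunLike.congr_fun h x,
    fun hx => ⟨f.map_mem hx, g.map_mem hx⟩, fun x => Subtype.ext (Prod.ext (hom_d f x) (hom_d g x))⟩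

@[simp] lemma fibreProductFst_lift {X : CDGA k} (f : X ⟶ A) (g : X ⟶ B) (h : f ≫ a = g ≫ b)
    (x : X) : fibreProductFst a b (fibreProductLift f g h x) = f x := rfl

@[simp] lemma fibreProductSnd_lift {X : CDGA k} (f : X ⟶ A) (g : X ⟶ B) (h : f ≫ a = g ≫ b)
    (x : X) : fibreProductSnd a b (fibreProductLift f g h x) = g x := rfl

variable (a b) in
lemma isPullback_fibreProduct : IsPullback (fibreProductFst a b) (fibreProductSnd a b) a b :=
  ⟨⟨fibreProduct_condition⟩, ⟨PullbackCone.IsLimit.mk _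
    (fun s => fibreProductLift s.fst s.snd s.condition)
    (fun _ => hom_ext fun _ => rfl) (fun _ => hom_ext fun _ => rfl)
    (fun _ _ h h' => hom_ext fun x => fibreProduct_ext (DFunLike.congr_fun h x)
      (DFunLike.congr_fun h' x))⟩⟩

/-- Pull-back squares in terms of elements. -/
lemma isPullback_iff {X : CDGA k} {f : X ⟶ A} {g : X ⟶ B} :
    IsPullback f g a b ↔ f ≫ a = g ≫ b ∧ (∀ x y, f x = f y → g x = g y → x = y) ∧
      ∀ α β, a α = b β → ∃ x, f x = α ∧ g x = β := by
  constructor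
  · intro h
    have hP := isPullback_fibreProduct a b
    let e := h.isoIsPullback A B hP
    have h1 : ∀ x, fibreProductFst a b (e.hom x) = f x := fun x =>
      DFunLike.congr_fun (h.isoIsPullback_hom_fst A B hP) x
    have h2 : ∀ x, fibreProductSnd a b (e.hom x) = g x := fun x =>
      DFunLike.congr_fun (h.isoIsPullback_hom_snd A B hP) x
    have he := bijective_of_isIso e.hom
    refine ⟨h.w, fun x y hf hg => he.1 (fibreProduct_ext ?_ ?_), fun α β hαβ => ?_⟩
    · rw [h1, h1, hf]
    · rw [h2, h2, hg]
    · obtain ⟨x, hx⟩ := he.2 (fibreProductMk α β hαβ)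
      exact ⟨x, by rw [← h1, hx, fibreProductFst_mk], by rw [← h2, hx, fibreProductSnd_mk]⟩
  · rintro ⟨w, hi, hs⟩
    have : IsIso (fibreProductLift f g w) := by
      refine isIso_of_bijective _ ⟨fun x y hxy => hi _ _ ?_ ?_, fun y => ?_⟩
      · rw [← fibreProductFst_lift f g w, hxy, fibreProductFst_lift]
      · rw [← fibreProductSnd_lift f g w, hxy, fibreProductSnd_lift]
      · obtain ⟨x, h1, h2⟩ := hs _ _ (DFunLike.congr_fun (fibreProduct_condition (a := a) (b := b)) y)
        exact ⟨x, fibreProduct_ext h1 h2⟩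
    exact IsPullback.of_iso (isPullback_fibreProduct a b) (asIso (fibreProductLift f g w)).symm
      (Iso.refl _) (Iso.refl _) (Iso.refl _)
      (by rw [Iso.refl_hom, Category.comp_id, Iso.symm_hom, asIso_inv, IsIso.eq_inv_comp]; rfl)
      (by rw [Iso.refl_hom, Category.comp_id, Iso.symm_hom, asIso_inv, IsIso.eq_inv_comp]; rfl)
      (by simp) (by simp)

end pullback

instance : HasTerminal (CDGA k) := (zeroIsTerminal k).hasTerminal

instance : HasPullbacks (CDGA k) :=
  have {A B D : CDGA k} {a : A ⟶ D} {b : B ⟶ D} : HasLimit (cospan a b) :=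
    (isPullback_fibreProduct a b).hasPullback
  hasPullbacks_of_hasLimit_cospan _

instance : HasFiniteProducts (CDGA k) :=
  have : HasFiniteLimits (CDGA k) := hasFiniteLimits_of_hasTerminal_and_pullbacks
  inferInstance

lemma subsingleton_terminal : Subsingleton (⊤_ (CDGA k)) := by
  have h := bijective_of_isIso (terminalIsTerminal.uniqueUpToIso (zeroIsTerminal k)).hom
  exact ⟨fun x y => h.1 (Subsingleton.elim (α := PUnit) _ _)⟩

lemma isPullback_prod (A B : CDGA k) :
    IsPullback (Limits.prod.fst : A ⨯ B ⟶ A) Limits.prod.snd (terminal.from A) (terminal.from B) :=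
  IsPullback.of_hasBinaryProduct' A B

lemma prod_ext {A B : CDGA k} {x y : (A ⨯ B : CDGA k)}
    (h : (Limits.prod.fst : A ⨯ B ⟶ A) x = (Limits.prod.fst : A ⨯ B ⟶ A) y)
    (h' : (Limits.prod.snd : A ⨯ B ⟶ B) x = (Limits.prod.snd : A ⨯ B ⟶ B) y) : x = y :=
  (isPullback_iff.mp (isPullback_prod A B)).2.1 _ _ h h'

lemma exists_prod {A B : CDGA k} (a : A) (b : B) : ∃ x : (A ⨯ B : CDGA k),
    (Limits.prod.fst : A ⨯ B ⟶ A) x = a ∧ (Limits.prod.snd : A ⨯ B ⟶ B) x = b :=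
  (isPullback_iff.mp (isPullback_prod A B)).2.2 _ _ (subsingleton_terminal.elim _ _)

end CDGA

/-! ## The P-category of dga's -/

namespace CDGA

variable {k : Type u} [Field k]

/-! ### Surjections and quasi-isomorphisms under fibre products -/

section pullback

variable {X A B D : CDGA k} {f : X ⟶ A} {g : X ⟶ B} {a : A ⟶ D} {b : B ⟶ D}

/-- The kernel of a surjective quasi-isomorphism is acyclic. A primitive y of z in B has closed
image, which is the image of a cocycle c up to an exact term; surjectivity lifts that term to B, and
subtracting both moves y into the kernel. -/
lemma exists_d_eq_of_trivialFib (hb : Function.Surjective b) (hw : quasiIsos k b) {z : B}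
    (hz : B.d z = 0) (hbz : b z = 0) : ∃ y, b y = 0 ∧ B.d y = z := by
  obtain ⟨hi, hs⟩ := (quasiIsos_iff b).mp hw
  obtain ⟨y, rfl⟩ := hi z hz ⟨0, by rw [hbz, map_zero]⟩
  obtain ⟨c, hc, e, he⟩ := hs (b y) (by rw [← hom_d, hbz])
  obtain ⟨e, rfl⟩ := hb e
  refine ⟨y - c - B.d e, ?_, by rw [map_sub, map_sub, hc, B.d_d, sub_zero, sub_zero]⟩
  rw [map_sub, map_sub, he, hom_d]
  abel

lemma exists_closed_lift_of_trivialFib (hb : Function.Surjective b) (hw : quasiIsos k b) {z : D}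
    (hz : D.d z = 0) : ∃ y, B.d y = 0 ∧ b y = z := by
  obtain ⟨c, hc, e, rfl⟩ := ((quasiIsos_iff b).mp hw).2 z hz
  obtain ⟨e, rfl⟩ := hb e
  exact ⟨c + B.d e, by rw [map_add, hc, B.d_d, add_zero], by rw [map_add, hom_d]⟩

lemma surjective_fst_of_isPullback (h : IsPullback f g a b) (hb : Function.Surjective b) :
    Function.Surjective f := fun α => by
  obtain ⟨β, hβ⟩ := hb (a α)
  obtain ⟨x, hx, -⟩ := (isPullback_iff.mp h).2.2 α β hβ.symm
  exact ⟨x, hx⟩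

lemma quasiIsos_fst_of_isPullback (h : IsPullback f g a b) (hb : Function.Surjective b)
    (hw : quasiIsos k b) : quasiIsos k f := by
  obtain ⟨w, hext, hex⟩ := isPullback_iff.mp h
  have hw' : ∀ x, a (f x) = b (g x) := fun x => DFunLike.congr_fun w x
  refine (quasiIsos_iff f).mpr ⟨fun x hx ⟨α, hα⟩ => ?_, fun α hα => ?_⟩
  · obtain ⟨β, hβ⟩ := hb (a α)
    -- The lift β of a(α) has the wrong differential in general; the error lies in the acyclic
    -- kernel of b, so β can be corrected without changing its image.
    obtain ⟨κ, hκ, hκ'⟩ := exists_d_eq_of_trivialFib hb hw (z := g x - B.d β)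
      (by rw [map_sub, ← hom_d, hx, map_zero, B.d_d, sub_zero])
      (by rw [map_sub, ← hw', ← hα, hom_d, hom_d, hβ, sub_self])
    obtain ⟨ξ, h1, h2⟩ := hex α (β + κ) (by rw [map_add, hβ, hκ, add_zero])
    refine ⟨ξ, hext _ _ (by rw [hom_d, h1, hα]) ?_⟩
    rw [hom_d, h2, map_add, hκ', add_sub_cancel]
  · obtain ⟨β, hβ, hβ'⟩ := exists_closed_lift_of_trivialFib hb hw (z := a α)
      (by rw [← hom_d, hα, map_zero])
    obtain ⟨ξ, h1, h2⟩ := hex α β hβ'.symm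
    refine ⟨ξ, hext _ _ ?_ ?_, 0, by rw [h1, map_zero, add_zero]⟩
    · rw [hom_d, h1, hα, map_zero]
    · rw [hom_d, h2, hβ, map_zero]

lemma quasiIsos_snd_of_isPullback (h : IsPullback f g a b) (hb : Function.Surjective b)
    (hw : quasiIsos k a) : quasiIsos k g := by
  obtain ⟨w, hext, hex⟩ := isPullback_iff.mp h
  have hw' : ∀ x, a (f x) = b (g x) := fun x => DFunLike.congr_fun w x
  obtain ⟨hi, hs⟩ := (quasiIsos_iff a).mp hw
  refine (quasiIsos_iff g).mpr ⟨fun x hx ⟨β, hβ⟩ => ?_, fun β hβ => ?_⟩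
  · obtain ⟨α, hα⟩ := hi (f x) (by rw [← hom_d, hx, map_zero])
      ⟨b β, by rw [← hom_d, hβ, hw']⟩
    -- The primitives α and β need not match over D, but their difference is closed there. It is
    -- represented by a cocycle γ of A up to an exact term, which lifts to B; both corrections are
    -- closed and leave the differentials unchanged.
    obtain ⟨γ, hγ, e, he⟩ := hs (a α - b β) (by
      rw [map_sub, ← hom_d, ← hom_d, hα, hβ, hw', sub_self])
    obtain ⟨η, rfl⟩ := hb e
    obtain ⟨ξ, h1, h2⟩ := hex (α - γ) (β + B.d η) (by
      rw [map_sub, map_add, hom_d, sub_eq_iff_eq_add, add_assoc, add_comm (D.d _), ← he]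
      abel)
    refine ⟨ξ, hext _ _ ?_ ?_⟩
    · rw [hom_d, h1, map_sub, hγ, sub_zero, hα]
    · rw [hom_d, h2, map_add, B.d_d, add_zero, hβ]
  · obtain ⟨γ, hγ, e, he⟩ := hs (b β) (by rw [← hom_d, hβ, map_zero])
    obtain ⟨η, rfl⟩ := hb e
    obtain ⟨ξ, h1, h2⟩ := hex γ (β - B.d η) (by rw [map_sub, he, hom_d, add_sub_cancel_right])
    refine ⟨ξ, hext _ _ ?_ ?_, η, by rw [h2, sub_add_cancel]⟩
    · rw [hom_d, h1, hγ, map_zero]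
    · rw [hom_d, h2, map_sub, hβ, B.d_d, sub_zero, map_zero]

lemma exists_poly_of_isPullback (h : IsPullback f g a b) {p : A[X]} {q : B[X]}
    (hpq : p.map a.toAlgHom.toRingHom = q.map b.toAlgHom.toRingHom) :
    ∃ r : X[X], r.map f.toAlgHom.toRingHom = p ∧ r.map g.toAlgHom.toRingHom = q := by
  have hc : ∀ i, a (p.coeff i) = b (q.coeff i) := fun i => by
    have := congrArg (fun r => r.coeff i) hpq
    simp only [coeff_map] at this
    exact this
  choose x hx hx' using fun i => (isPullback_iff.mp h).2.2 _ _ (hc i)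
  -- Lifting coefficientwise gives an infinite sequence; cutting it above both degrees turns it into
  -- a polynomial.
  let N := max p.natDegree q.natDegree + 1
  have hr : ∀ i, (∑ j ∈ Finset.range N, monomial j (x j)).coeff i = if i < N then x i else 0 := by
    intro i
    simp [coeff_monomial]
  refine ⟨∑ j ∈ Finset.range N, monomial j (x j), ?_, ?_⟩ <;> ext i <;> rw [coeff_map, hr] <;>
    split_ifs with hi
  · exact hx i
  · rw [map_zero, coeff_eq_zero_of_natDegree_lt]
    have := le_max_left p.natDegree q.natDegree
    omega
  · exact hx' i
  · rw [map_zero, coeff_eq_zero_of_natDegree_lt]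
    have := le_max_right p.natDegree q.natDegree
    omega

lemma poly_ext_of_isPullback (h : IsPullback f g a b) {p q : X[X]}
    (h1 : p.map f.toAlgHom.toRingHom = q.map f.toAlgHom.toRingHom)
    (h2 : p.map g.toAlgHom.toRingHom = q.map g.toAlgHom.toRingHom) : p = q := by
  ext i
  refine (isPullback_iff.mp h).2.1 _ _ ?_ ?_
  · have := congrArg (fun r => r.coeff i) h1
    simp only [coeff_map] at this
    exact this
  · have := congrArg (fun r => r.coeff i) h2
    simp only [coeff_map] at this
    exact this

end pullback

/-! ### The path `A[t, dt]` -/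

section path

variable [CharZero k] {A B : CDGA k}

/-- Termwise integration; the division by i + 1 takes place in the base field, of characteristic 0.
-/
lemma exists_derivative_eq (q : A[X]) : ∃ r : A[X], derivative r = q := by
  induction q using Polynomial.induction_on' with
  | add p q hp hq =>
    obtain ⟨r, rfl⟩ := hp
    obtain ⟨s, rfl⟩ := hq
    exact ⟨r + s, derivative_add⟩
  | monomial i a =>
    refine ⟨monomial (i + 1) (((i + 1 : ℕ) : k)⁻¹ • a), ?_⟩
    rw [derivative_monomial, Nat.add_sub_cancel, ← nsmul_eq_mul', ← Nat.cast_smul_eq_nsmul k,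
      smul_smul, mul_inv_cancel₀ (Nat.cast_ne_zero.mpr i.succ_ne_zero), one_smul]

lemma eq_C_of_derivative_eq_zero {p : A[X]} (h : derivative p = 0) : p = C (p.coeff 0) := by
  ext i
  cases i with
  | zero => simp
  | succ i =>
    have h1 := congrArg (fun q => q.coeff i) h
    simp only [coeff_derivative, coeff_zero, ← Nat.cast_succ, ← nsmul_eq_mul'] at h1
    rw [← Nat.cast_smul_eq_nsmul k] at h1
    rw [(smul_eq_zero.mp h1).resolve_left (Nat.cast_ne_zero.mpr i.succ_ne_zero),
      coeff_C_succ]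

/-- The Poincaré lemma: every cocycle of `A[t, dt]` is cohomologous to an element of `A`. -/
lemma exists_eq_incl_add_d {x : path A} (hx : (path A).d x = 0) :
    ∃ (a : A) (y : path A), x = path.incl A a + (path A).d y := by
  have h2 : derivative x.1 - coeffMap A.d x.2 = 0 := congrArg PathAlg.snd hx
  -- With x = p + dt·q and ∂r/∂t = q, subtracting d(r) removes the `dt`-part. What is left is
  -- closed, so its t-derivative vanishes and it is constant in t.
  obtain ⟨r, hr⟩ := exists_derivative_eq x.2
  have h3 : derivative (x.1 - coeffMap A.d r) = 0 := by
    rw [derivative_sub, PathAlg.derivative_coeffMap, hr, h2]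
  refine ⟨(x.1 - coeffMap A.d r).coeff 0, (⟨r, 0⟩ : PathAlg A), ?_⟩
  refine PathAlg.ext ?_ ?_
  · change x.1 = C ((x.1 - coeffMap A.d r).coeff 0) + coeffMap A.d r
    rw [← eq_C_of_derivative_eq_zero h3, sub_add_cancel]
  · change x.2 = 0 + (derivative r - coeffMap A.d 0)
    rw [hr, map_zero, sub_zero, zero_add]

/-- Evaluation at 0 is a retraction by a dga morphism, which gives injectivity; the Poincaré lemma
gives surjectivity. -/
lemma quasiIsos_incl (A : CDGA k) : quasiIsos k (path.incl A) := by
  refine (quasiIsos_iff _).mpr ⟨fun a _ ⟨y, hy⟩ => ⟨evalAt A 0 y, ?_⟩, fun x hx => ?_⟩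
  · rw [← hom_d, hy, evalAt_incl]
  · obtain ⟨a, y, rfl⟩ := exists_eq_incl_add_d hx
    refine ⟨a, ?_, y, rfl⟩
    rw [map_add, (path A).d_d, add_zero, ← hom_d] at hx
    rw [← evalAt_incl A 0 (A.d a), hx, map_zero]

lemma quasiIsos_evalAt (A : CDGA k) (i : Fin 2) : quasiIsos k (evalAt A i) := by
  refine (quasiIsos k).of_precomp (path.incl A) _ (quasiIsos_incl A) ?_
  have h : path.incl A ≫ evalAt A i = 𝟙 A := hom_ext fun a => evalAt_incl A i a
  rw [h]
  exact quasiIsos_of_isIso _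

/-- The universal property defines `pathMap`; this coefficientwise description lets surjectivity and
pull-back squares pass from `f` to `pathMap f`. -/
lemma pathMap_apply (f : A ⟶ B) (x : path A) :
    pathMap f x = (⟨x.1.map f.toAlgHom.toRingHom, x.2.map f.toAlgHom.toRingHom⟩ : PathAlg B) := by
  have h : ∀ p : A[X], PathAlg.eval (f ≫ path.incl B) (path.t B) (path.t_mem B) p =
      (⟨p.map f.toAlgHom.toRingHom, 0⟩ : PathAlg B) := by
    intro p
    induction p using Polynomial.induction_on' with
    | add p q hp hq =>
      rw [map_add, hp, hq]
      refine PathAlg.ext ?_ ?_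
      · exact (Polynomial.map_add _).symm
      · exact add_zero _
    | monomial i a =>
      rw [PathAlg.eval_monomial, Polynomial.map_monomial]
      change PathAlg.incl B (f a) * (PathAlg.t B) ^ i = _
      rw [PathAlg.t_pow, PathAlg.incl_apply]
      refine PathAlg.ext ?_ ?_
      · exact C_mul_X_pow_eq_monomial
      · simp
  refine (PathAlg.lift_apply (f ≫ path.incl B) (path.t B) (path.t_mem B) x).trans ?_
  have ht : (path B).d (path.t B) = (⟨0, 1⟩ : PathAlg B) := PathAlg.d_t
  rw [h, h, ht]
  refine PathAlg.ext ?_ ?_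
  · change x.1.map f.toAlgHom.toRingHom + 0 * x.2.map f.toAlgHom.toRingHom = _
    rw [zero_mul, add_zero]
  · change 0 + (1 * x.2.map f.toAlgHom.toRingHom + PathAlg.polySign B 0 * 0) = _
    rw [zero_add, one_mul, mul_zero, add_zero]

lemma surjective_pathMap {f : A ⟶ B} (hf : Function.Surjective f) :
    Function.Surjective (pathMap f) := fun y => by
  obtain ⟨p, hp⟩ := Polynomial.map_surjective f.toAlgHom.toRingHom hf y.1
  obtain ⟨q, hq⟩ := Polynomial.map_surjective f.toAlgHom.toRingHom hf y.2
  exact ⟨(⟨p, q⟩ : PathAlg A), (pathMap_apply f _).trans (PathAlg.ext hp hq)⟩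

lemma quasiIsos_pathMap {f : A ⟶ B} (hf : quasiIsos k f) : quasiIsos k (pathMap f) := by
  refine (quasiIsos k).of_precomp (path.incl A) _ (quasiIsos_incl A) ?_
  have h : path.incl A ≫ pathMap f = f ≫ path.incl B := hom_ext fun a => pathMap_incl f a
  rw [h]
  exact (quasiIsos k).comp_mem _ _ hf (quasiIsos_incl B)

lemma isPullback_pathMap {X D : CDGA k} {f : X ⟶ A} {g : X ⟶ B} {a : A ⟶ D} {b : B ⟶ D}
    (h : IsPullback f g a b) :
    IsPullback (pathMap f) (pathMap g) (pathMap a) (pathMap b) := by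
  refine isPullback_iff.mpr ⟨?_, fun x y h1 h2 => ?_, fun α β hαβ => ?_⟩
  · exact ((pathFunctor k).map_comp f a).symm.trans
      ((congrArg (pathFunctor k).map h.w).trans ((pathFunctor k).map_comp g b))
  · rw [pathMap_apply, pathMap_apply] at h1 h2
    obtain ⟨h1, h1'⟩ := PathAlg.mk.inj h1
    obtain ⟨h2, h2'⟩ := PathAlg.mk.inj h2
    exact PathAlg.ext (poly_ext_of_isPullback h h1 h2) (poly_ext_of_isPullback h h1' h2')
  · rw [pathMap_apply, pathMap_apply] at hαβ
    obtain ⟨h1, h2⟩ := PathAlg.mk.inj hαβ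
    obtain ⟨p, hp, hp'⟩ := exists_poly_of_isPullback h h1
    obtain ⟨q, hq, hq'⟩ := exists_poly_of_isPullback h h2
    exact ⟨(⟨p, q⟩ : PathAlg X), (pathMap_apply f _).trans (PathAlg.ext hp hq),
      (pathMap_apply g _).trans (PathAlg.ext hp' hq')⟩

lemma exists_path (a b : A) : ∃ x : path A, evalAt A 0 x = a ∧ evalAt A 1 x = b :=
  ⟨path.incl A a * (1 - path.t A) + path.incl A b * path.t A, by simp, by simp⟩

/-- This is (P₅) on elements. An arbitrary lift x has endpoints that differ from a and b by elements
of the kernel of f, so the interpolating correction with these differences fixes the ends and is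
killed by `pathMap f`. -/
lemma exists_path_lift {f : A ⟶ B} (hf : Function.Surjective f) (a b : A) (y : path B)
    (ha : f a = evalAt B 0 y) (hb : f b = evalAt B 1 y) :
    ∃ x : path A, pathMap f x = y ∧ evalAt A 0 x = a ∧ evalAt A 1 x = b := by
  obtain ⟨x, rfl⟩ := surjective_pathMap hf y
  have hn : ∀ i, evalAt B i (pathMap f x) = f (evalAt A i x) := fun i =>
    DFunLike.congr_fun (((functorialPath k).δ i).naturality f) x
  rw [hn] at ha hb
  refine ⟨x + path.incl A (a - evalAt A 0 x) * (1 - path.t A) +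
    path.incl A (b - evalAt A 1 x) * path.t A, ?_, ?_, ?_⟩
  · simp [ha, hb]
  · simp
  · simp

end path

lemma endpoints_fst [CharZero k] (A : CDGA k) (x : path A) :
    (Limits.prod.fst : A ⨯ A ⟶ A) ((functorialPath k).endpoints A x) = evalAt A 0 x :=
  DFunLike.congr_fun (f := (functorialPath k).endpoints A ≫ Limits.prod.fst)
    (prod.lift_fst _ _) x

lemma endpoints_snd [CharZero k] (A : CDGA k) (x : path A) :
    (Limits.prod.snd : A ⨯ A ⟶ A) ((functorialPath k).endpoints A x) = evalAt A 1 x :=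
  DFunLike.congr_fun (f := (functorialPath k).endpoints A ≫ Limits.prod.snd)
    (prod.lift_snd _ _) x

lemma prod_map_fst {A B : CDGA k} (f : A ⟶ B) (x : (A ⨯ A : CDGA k)) :
    (Limits.prod.fst : B ⨯ B ⟶ B) (prod.map f f x) = f ((Limits.prod.fst : A ⨯ A ⟶ A) x) :=
  DFunLike.congr_fun (f := prod.map f f ≫ Limits.prod.fst) (prod.map_fst _ _) x

lemma prod_map_snd {A B : CDGA k} (f : A ⟶ B) (x : (A ⨯ A : CDGA k)) :
    (Limits.prod.snd : B ⨯ B ⟶ B) (prod.map f f x) = f ((Limits.prod.snd : A ⨯ A ⟶ A) x) :=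
  DFunLike.congr_fun (f := prod.map f f ≫ Limits.prod.snd) (prod.map_snd _ _) x

theorem isPCategory (k : Type u) [Field k] [CharZero k] :
    IsPCategory (pathStructure k) (surjections k) (quasiIsos k) where
  fib_of_isIso f _ := (bijective_of_isIso f).2
  we_of_isIso f _ := quasiIsos_of_isIso f
  fib_comp _ _ hf hg := hg.comp hf
  we_twoOutOfThree := inferInstance
  fib_terminal _ := fun _ => ⟨0, subsingleton_terminal.elim _ _⟩
  we_ι := quasiIsos_incl
  fib_endpoints A := fun y => by
    obtain ⟨x, h0, h1⟩ := exists_path ((Limits.prod.fst : A ⨯ A ⟶ A) y)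
      ((Limits.prod.snd : A ⨯ A ⟶ A) y)
    exact ⟨x, prod_ext ((endpoints_fst A x).trans h0) ((endpoints_snd A x).trans h1)⟩
  trivialFib_δ i A := ⟨fun a => ⟨path.incl A a, evalAt_incl A i a⟩, quasiIsos_evalAt A i⟩
  hasPullback _ _ _ := inferInstance
  fib_fst h hb := surjective_fst_of_isPullback h hb
  trivialFib_fst h hb hw := ⟨surjective_fst_of_isPullback h hb, quasiIsos_fst_of_isPullback h hb hw⟩
  we_snd h hb hw := quasiIsos_snd_of_isPullback h hb hw
  fib_map _ hf := surjective_pathMap hf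
  we_map _ hf := quasiIsos_pathMap hf
  isPullback_map h _ := isPullback_pathMap h
  -- An element of the double mapping path consists of two elements of A and a path in B joining
  -- their images.
  fib_lift {X A B} f fst snd sq hf := fun z => by
    obtain ⟨w, hext, -⟩ := isPullback_iff.mp sq
    have hw : prod.map f f (fst z) = (functorialPath k).endpoints B (snd z) :=
      DFunLike.congr_fun w z
    obtain ⟨x, hx, h0, h1⟩ := exists_path_lift hf ((Limits.prod.fst : A ⨯ A ⟶ A) (fst z))
      ((Limits.prod.snd : A ⨯ A ⟶ A) (fst z)) (snd z)
      ((prod_map_fst f _).symm.trans ((congrArg (Limits.prod.fst : B ⨯ B ⟶ B) hw).trans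
        (endpoints_fst B _)))
      ((prod_map_snd f _).symm.trans ((congrArg (Limits.prod.snd : B ⨯ B ⟶ B) hw).trans
        (endpoints_snd B _)))
    refine ⟨x, hext _ _ ?_ ?_⟩
    · refine (DFunLike.congr_fun (sq.lift_fst _ _ _) x).trans (prod_ext ?_ ?_)
      · exact (endpoints_fst A x).trans h0
      · exact (endpoints_snd A x).trans h1
    · exact (DFunLike.congr_fun (sq.lift_snd _ _ _) x).trans hx

end CDGA

/-! ## Sullivan minimal dga's: connectedness and liftings -/

section LinearAlgebra

variable {k : Type*} [Field k] {U W : Type*} [AddCommGroup U] [Module k U] [AddCommGroup W]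
  [Module k W]

/-- A generalized inverse: a section of f over its range, extended to the whole target. -/
lemma LinearMap.exists_comp_comp_self (f : U →ₗ[k] W) : ∃ g : W →ₗ[k] U, ∀ x, f (g (f x)) = f x := by
  obtain ⟨h, hh⟩ := f.rangeRestrict.exists_rightInverse_of_surjective f.range_rangeRestrict
  obtain ⟨g, hg⟩ := LinearMap.exists_extend h
  refine ⟨g, fun x => ?_⟩
  have h1 : g (f x) = h ⟨f x, x, rfl⟩ := LinearMap.congr_fun hg ⟨f x, x, rfl⟩
  have h2 := congrArg Subtype.val (LinearMap.congr_fun hh ⟨f x, x, rfl⟩)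
  rw [h1]
  exact h2

/-- The limit of a sequence of linear maps which is eventually constant at every point. -/
lemma LinearMap.exists_eventually_eq (g : ℕ → U →ₗ[k] W)
    (h : ∀ x, ∃ m, ∀ j, m ≤ j → g j x = g m x) :
    ∃ φ : U →ₗ[k] W, ∀ x, ∃ m, ∀ j, m ≤ j → φ x = g j x := by
  choose m hm using h
  have key : ∀ x j, m x ≤ j → g (m x) x = g j x := fun x j hj => (hm x j hj).symm
  refine ⟨⟨⟨fun x => g (m x) x, fun x y => ?_⟩, fun c x => ?_⟩, fun x => ⟨m x, key x⟩⟩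
  · rw [key (x + y) (m (x + y) + (m x + m y)) (by omega), map_add,
      ← key x (m (x + y) + (m x + m y)) (by omega), ← key y (m (x + y) + (m x + m y)) (by omega)]
  · dsimp only
    rw [key (c • x) (m (c • x) + m x) (by omega), map_smul, ← key x (m (c • x) + m x) (by omega),
      RingHom.id_apply]

end LinearAlgebra

namespace CDGA

variable {k : Type u} [Field k]

lemma map_sign {A B : CDGA k} (f : A →ₐ[k] B)
    (hf : ∀ n, ∀ a ∈ A.grading n, f a ∈ B.grading n) (a : A) : f (A.sign a) = B.sign (f a) := by
  refine LinearMap.congr_fun (f := f.toLinearMap.comp A.sign.toLinearMap)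
    (g := B.sign.toLinearMap.comp f.toLinearMap) (A.linearMap_ext fun n a h => ?_) a
  simp [A.sign_of_mem h, B.sign_of_mem (hf n a h)]

lemma d_one (A : CDGA k) : A.d 1 = 0 := PathAlg.d_one

lemma map_d_of_mem_adjoin {A B : CDGA k} {f : A →ₐ[k] B}
    (hf : ∀ n, ∀ a ∈ A.grading n, f a ∈ B.grading n) {s : Set A}
    (hs : ∀ a ∈ s, f (A.d a) = B.d (f a)) {a : A} (ha : a ∈ Algebra.adjoin k s) :
    f (A.d a) = B.d (f a) :=
  map_derivation_of_mem_adjoin f A.d B.d A.sign B.sign A.leibniz_sign B.leibniz_sign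
    (map_sign f hf) A.d_one B.d_one hs ha

lemma exists_algebraMap_of_zeroConnected {A : CDGA k} (h : zeroConnected k A) {a : A}
    (ha : a ∈ A.grading 0) (hda : A.d a = 0) : ∃ c : k, a = algebraMap k A c := by
  obtain ⟨c, hc⟩ := h.2 (Submodule.Quotient.mk ⟨a, ha, hda⟩)
  have h0 := (Submodule.Quotient.eq _).mp hc
  -- The coboundaries of degree 0 are zero by definition, so equality of classes is equality of
  -- elements.
  have h1 : algebraMap k A c - a = 0 := h0
  exact ⟨c, (sub_eq_zero.mp h1).symm⟩

/-- Morphisms are unital, so the unit of H⁰(B) factors as the unit of H⁰(A) followed by the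
bijection H⁰(f). -/
lemma zeroConnected_iff_of_quasiIsos {A B : CDGA k} {f : A ⟶ B} (hf : quasiIsos k f) :
    zeroConnected k A ↔ zeroConnected k B := by
  have h : ⇑B.unitCohomology = cohomologyMap f 0 ∘ A.unitCohomology := by
    funext c
    refine congrArg Submodule.Quotient.mk (Subtype.ext ?_)
    exact (f.toAlgHom.commutes c).symm
  unfold zeroConnected
  rw [h]
  exact (Function.Bijective.of_comp_iff' (hf 0) _).symm

/-! ### Consequences of freeness -/

namespace IsFreeOn

variable {A : CDGA k} {V : ℕ → Submodule k A} (hV : A.IsFreeOn V)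

include hV

/-- The subalgebra S generated by V is graded, so the universal property gives a morphism f from A
to S extending V → S. Composed with the inclusion it agrees on V with the identity, hence is the
identity by uniqueness, and every element lies in S. -/
lemma adjoin_eq_top : Algebra.adjoin k (⋃ n, (V n : Set A)) = ⊤ := by
  have hm : ∀ n (v : V n), (v : A) ∈ Algebra.adjoin k (⋃ n, (V n : Set A)) := fun n v =>
    Algebra.subset_adjoin (Set.mem_iUnion.mpr ⟨n, v.2⟩)
  generalize hS : Algebra.adjoin k (⋃ n, (V n : Set A)) = S at hm ⊢
  let _ : GradedAlgebra (GradedAlgebra.restrict A.grading S) :=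
    GradedAlgebra.restrictGradedAlgebra A.grading S fun x hx n => by
      rw [← hS] at hx ⊢
      refine GradedAlgebra.proj_mem_adjoin A.grading (fun x hx => ?_) hx n
      obtain ⟨n, hn⟩ := Set.mem_iUnion.mp hx
      exact ⟨n, hV.1 n hn⟩
  obtain ⟨f, ⟨hf, hf'⟩, -⟩ := hV.2 S (GradedAlgebra.restrict A.grading S)
    (fun ha hb => Subtype.ext (A.mul_comm' ha hb))
    (fun n => (V n).subtype.codRestrict S.toSubmodule (hm n)) (fun n v => hV.1 n v.2)
  obtain ⟨g, -, hg⟩ := hV.2 A A.grading A.mul_comm' (fun n => (V n).subtype)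
    (fun n v => hV.1 n v.2)
  have h1 := hg (S.val.comp f) ⟨fun n a ha => hf n a ha, fun n v => by
    rw [AlgHom.comp_apply, hf']; rfl⟩
  have h2 := hg (AlgHom.id k A) ⟨fun n a ha => ha, fun n v => rfl⟩
  rw [eq_top_iff]
  rintro x -
  have h3 : (f x : A) = x := DFunLike.congr_fun (h1.trans h2.symm) x
  exact h3 ▸ (f x).2

lemma algHom_ext {B : Type*} [Ring B] [Algebra k B] {f g : A →ₐ[k] B}
    (h : ∀ n, ∀ v ∈ V n, f v = g v) : f = g := by
  refine AlgHom.ext_of_adjoin_eq_top hV.adjoin_eq_top fun x hx => ?_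
  obtain ⟨n, hn⟩ := Set.mem_iUnion.mp hx
  exact h n x hn

lemma exists_algHom {B : CDGA k} (φ : ∀ n, V n →ₗ[k] B) (hφ : ∀ n v, φ n v ∈ B.grading n) :
    ∃ f : A →ₐ[k] B, (∀ n, ∀ a ∈ A.grading n, f a ∈ B.grading n) ∧
      ∀ n (v : V n), f v = φ n v :=
  (hV.2 B B.grading B.mul_comm' φ hφ).exists

lemma exists_algebraMap_eq_comp_zero (h0 : V 0 = ⊥) (a : A) :
    ∃ c : k, A.comp 0 a = algebraMap k A c := by
  refine GradedAlgebra.proj_zero_mem_of_mem_adjoin A.grading (s := ⋃ n, (V n : Set A))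
    (fun x hx => ?_) (by rw [hV.adjoin_eq_top]; trivial)
  obtain ⟨n, hn⟩ := Set.mem_iUnion.mp hx
  cases n with
  | zero =>
    rw [h0] at hn
    have h : x = 0 := hn
    exact ⟨0, h ▸ zero_mem _⟩
  | succ n => exact ⟨n, hV.1 _ hn⟩

/-- Sending V to 0 defines an augmentation from A to k, with k placed in degree 0; it retracts the
unit. -/
lemma algebraMap_injective : Function.Injective (algebraMap k A) := by
  let 𝒢 : ℕ → Submodule k k := fun n => if n = 0 then ⊤ else ⊥
  have h𝒢 : ∀ {n : ℕ} {a : k}, a ∈ 𝒢 n ↔ n = 0 ∨ a = 0 := by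
    intro n a
    by_cases hn : n = 0 <;> simp [𝒢, hn]
  let _ : SetLike.GradedMonoid 𝒢 :=
    { one_mem := h𝒢.mpr (Or.inl rfl)
      mul_mem := fun i j a b ha hb => by
        rw [h𝒢] at ha hb ⊢
        rcases ha with rfl | rfl
        · rcases hb with rfl | rfl
          · exact Or.inl rfl
          · exact Or.inr (mul_zero _)
        · exact Or.inr (zero_mul _) }
  let _ : GradedAlgebra 𝒢 := GradedAlgebra.ofProj 𝒢 (fun n => if n = 0 then LinearMap.id else 0)
    (fun n x => by rw [h𝒢]; by_cases hn : n = 0 <;> simp [hn])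
    (fun n x hx => by rw [h𝒢] at hx; rcases hx with rfl | rfl <;> simp)
    (fun n m x hx hnm => by
      rw [h𝒢] at hx
      rcases hx with rfl | rfl
      · simp [hnm.symm]
      · simp)
    (fun x => ⟨1, by simp⟩)
  obtain ⟨f, -⟩ := (hV.2 k 𝒢 (fun {i j a b} ha hb => by
    rw [h𝒢] at ha hb
    rcases ha with rfl | rfl
    · simp [mul_comm]
    · simp) (fun _ => 0) (fun n v => zero_mem _)).exists
  intro c d h
  simpa using congrArg f h

lemma zeroConnected (h0 : V 0 = ⊥) : zeroConnected k A := by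
  constructor
  · refine (injective_iff_map_eq_zero _).mpr fun c hc => ?_
    have h1 := (Submodule.Quotient.mk_eq_zero _).mp hc
    have h2 : algebraMap k A c = 0 := h1
    exact hV.algebraMap_injective (by rw [h2, map_zero])
  · intro x
    obtain ⟨⟨a, ha, hda⟩, rfl⟩ := Submodule.Quotient.mk_surjective _ x
    obtain ⟨c, hc⟩ := hV.exists_algebraMap_eq_comp_zero h0 a
    rw [comp_eq_self ha] at hc
    exact ⟨c, congrArg Submodule.Quotient.mk (Subtype.ext hc.symm)⟩

end IsFreeOn

lemma sullivanMinimal_le_zeroConnected : sullivanMinimal k ≤ zeroConnected k :=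
  fun _ ⟨_, h0, hV, _⟩ => hV.zeroConnected h0

/-! ### Lifting through surjective quasi-isomorphisms -/

section lifting

variable {M A B : CDGA k} {V : ℕ → Submodule k M} (hV : M.IsFreeOn V) {p : A ⟶ B}
  (hp : Function.Surjective p)

/-- Graded algebra morphisms which lift a given morphism, but need not commute with `d`. -/
structure AlgLift (p : A ⟶ B) (f : M ⟶ B) where
  hom : M →ₐ[k] A
  map_mem : ∀ n, ∀ a ∈ M.grading n, hom a ∈ A.grading n
  map_hom : ∀ a, p (hom a) = f a

include hV hp in
-- On generators one uses a linear section of p. It need not respect degrees, so its values are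
-- projected to the degree of the generator; p commutes with the projections.
lemma nonempty_algLift (f : M ⟶ B) : Nonempty (AlgLift p f) := by
  obtain ⟨s, hs⟩ := p.toAlgHom.toLinearMap.exists_rightInverse_of_surjective
    (LinearMap.range_eq_top.mpr hp)
  have hs' : ∀ b, p (s b) = b := fun b => LinearMap.congr_fun hs b
  obtain ⟨F, hF, hF'⟩ := hV.exists_algHom (B := A)
    (fun n => (A.comp n).comp (s.comp (f.toAlgHom.toLinearMap.comp (V n).subtype)))
    (fun n v => A.comp_mem n _)
  refine ⟨F, hF, fun a => ?_⟩
  refine DFunLike.congr_fun (f := p.toAlgHom.comp F) (g := f.toAlgHom)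
    (hV.algHom_ext fun n v hv => ?_) a
  refine (congrArg p (hF' n ⟨v, hv⟩)).trans ?_
  change p (A.comp n (s (f v))) = f v
  rw [← comp_hom, hs', comp_hom, comp_eq_self (hV.1 n hv)]

/-- A partial contraction of the kernel of a morphism. -/
lemma exists_contraction (p : A ⟶ B) (n : ℕ) : ∃ s : A →ₗ[k] A,
    (∀ a, s a ∈ A.grading n ∧ p (s a) = 0) ∧
      ∀ a ∈ A.grading n, p a = 0 → A.d (s (A.d a)) = A.d a := by
  -- Take a generalized inverse of d restricted to the part of degree n of the kernel of p.
  obtain ⟨g, hg⟩ := (A.d.comp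
    (A.grading n ⊓ LinearMap.ker p.toAlgHom.toLinearMap).subtype).exists_comp_comp_self
  exact ⟨(Submodule.subtype _).comp g, fun a => (g a).2, fun a ha ha' => hg ⟨a, ha, ha'⟩⟩

include hV in
/-- Correct a graded algebra morphism by a partial contraction. -/
lemma exists_correction {f : M ⟶ B} {s : ℕ → A →ₗ[k] A}
    (hs : ∀ n a, s n a ∈ A.grading n ∧ p (s n a) = 0) (F : AlgLift p f) :
    ∃ G : AlgLift p f, ∀ n, ∀ v ∈ V n,
      G.hom v = F.hom v + s n (F.hom (M.d v) - A.d (F.hom v)) := by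
  obtain ⟨G, hG, hG'⟩ := hV.exists_algHom (B := A)
    (fun n => (F.hom.toLinearMap + (s n).comp (F.hom.toLinearMap.comp M.d -
      A.d.comp F.hom.toLinearMap)).comp (V n).subtype)
    (fun n v => add_mem (F.map_mem n v (hV.1 n v.2)) (hs n _).1)
  refine ⟨⟨G, hG, fun a => ?_⟩, fun n v hv => hG' n ⟨v, hv⟩⟩
  refine DFunLike.congr_fun (f := p.toAlgHom.comp G) (g := f.toAlgHom)
    (hV.algHom_ext fun n v hv => ?_) a
  refine (congrArg p (hG' n ⟨v, hv⟩)).trans ?_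
  refine (map_add p _ _).trans ?_
  change p (F.hom v) + p (s n _) = f v
  rw [(hs n _).2, add_zero, F.map_hom]

include hV hp in
/-- Morphisms from a Sullivan dga lift through surjective quasi-isomorphisms. -/
lemma IsFreeOn.exists_lift (hw : quasiIsos k p) {E : ℕ → ℕ → Submodule k M}
    (hE : ∀ n, Monotone fun m => E m n) (hEV : ∀ n, ⨆ m, E m n = V n)
    (hE0 : ∀ n, ∀ x ∈ E 0 n, M.d x = 0)
    (hEd : ∀ m n, ∀ x ∈ E (m + 1) n, M.d x ∈ Algebra.adjoin k (⋃ j, (E m j : Set M)))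
    (f : M ⟶ B) : ∃ g : M ⟶ A, g ≫ p = f := by
  have hEV' : ∀ m n, E m n ≤ V n := fun m n => hEV n ▸ le_iSup (fun m => E m n) m
  choose s hs hs' using exists_contraction p
  -- One application of T subtracts the failure to commute with d on all generators at once, using
  -- the contraction, so no complements of V(m) in V(m+1) are chosen. After j applications the lift
  -- commutes with d on V(m) for all m < j, and T no longer changes it there.
  choose T hT using fun F : AlgLift p f => exists_correction hV hs F
  obtain ⟨F₀⟩ := nonempty_algLift hV hp f
  let F : ℕ → AlgLift p f := fun j => T^[j] F₀
  have hF : ∀ j, F (j + 1) = T (F j) := fun j => Function.iterate_succ_apply' T j F₀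
  have hstable : ∀ j n, ∀ v ∈ V n, (F j).hom (M.d v) = A.d ((F j).hom v) →
      (F (j + 1)).hom v = (F j).hom v := fun j n v hv h => by
    rw [hF, hT _ n v hv, h, sub_self, map_zero, add_zero]
  have hgood : ∀ j m, m < j → ∀ n, ∀ x ∈ E m n, (F j).hom (M.d x) = A.d ((F j).hom x) := by
    intro j
    induction j with
    | zero => exact fun m hm => absurd hm (Nat.not_lt_zero m)
    | succ j ih =>
      intro m hm n x hx
      -- By induction `F j` already commutes with d on the preceding stage, which generates a
      -- subalgebra containing dx, and the next correction does not move that subalgebra.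
      have h1 : A.d ((F j).hom (M.d x)) = 0 ∧
          (F (j + 1)).hom (M.d x) = (F j).hom (M.d x) := by
        cases m with
        | zero => rw [hE0 n x hx, map_zero, map_zero, map_zero]; exact ⟨rfl, rfl⟩
        | succ m =>
          have hm' : m < j := by omega
          have hx' := hEd m n x hx
          constructor
          · rw [← map_d_of_mem_adjoin (F j).map_mem (fun a ha => ?_) hx', M.d_d, map_zero]
            obtain ⟨i, hi⟩ := Set.mem_iUnion.mp ha
            exact ih m hm' i a hi
          · refine AlgHom.eqOn_adjoin_iff.mpr (fun a ha => ?_) hx'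
            obtain ⟨i, hi⟩ := Set.mem_iUnion.mp ha
            exact hstable j i a (hEV' m i hi) (ih m hm' i a hi)
      have hxV := hEV' m n hx
      have hxn := hV.1 n hxV
      -- The failure is closed and killed by p, hence exact inside the kernel of p. On such an
      -- element the contraction followed by d is the identity, so the correction removes it
      -- exactly.
      obtain ⟨y, hy, hy'⟩ := exists_d_eq_of_trivialFib hp hw
        (z := (F j).hom (M.d x) - A.d ((F j).hom x))
        (by rw [map_sub, h1.1, A.d_d, sub_zero])
        (by rw [map_sub, (F j).map_hom, hom_d, hom_d, (F j).map_hom, sub_self])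
      have he : (F j).hom (M.d x) - A.d ((F j).hom x) ∈ A.grading (n + 1) :=
        sub_mem ((F j).map_mem _ _ (M.d_mem hxn)) (A.d_mem ((F j).map_mem _ _ hxn))
      have hy'' := comp_d_of_mem hy' he
      have h2 := hs' n (A.comp n y) (A.comp_mem n y) (by rw [← comp_hom, hy, map_zero])
      rw [hy''] at h2
      rw [h1.2, hF, hT _ n x hxV, map_add, h2, add_sub_cancel]
  have hconst : ∀ m j, m + 1 ≤ j → ∀ n, ∀ x ∈ E m n, (F j).hom x = (F (m + 1)).hom x := by
    intro m j hj n x hx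
    induction j, hj using Nat.le_induction with
    | base => rfl
    | succ j hj ih => rw [hstable j n x (hEV' m n hx) (hgood j m hj n x hx), ih]
  have hmem : ∀ n, ∀ v ∈ V n, ∃ m, v ∈ E m n := fun n v hv => by
    rw [← hEV n] at hv
    exact (Submodule.mem_iSup_of_directed _ (hE n).directed_le).mp hv
  -- Every generator lies in some V(m), where the sequence is constant from index m + 1 on; the
  -- pointwise limit defines the lift.
  choose φ hφ using fun n => LinearMap.exists_eventually_eq
    (fun j => (F j).hom.toLinearMap.comp (V n).subtype) (fun v => by
      obtain ⟨m, hm⟩ := hmem n v v.2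
      exact ⟨m + 1, fun j hj => hconst m j hj n v hm⟩)
  obtain ⟨G, hG, hG'⟩ := hV.exists_algHom (B := A) φ (fun n v => by
    obtain ⟨m, hm⟩ := hφ n v
    rw [hm m le_rfl]
    exact (F m).map_mem n v (hV.1 n v.2))
  have hGF : ∀ m n, ∀ x ∈ E m n, ∀ j, m + 1 ≤ j → G x = (F j).hom x := by
    intro m n x hx j hj
    obtain ⟨i, hi⟩ := hφ n ⟨x, hEV' m n hx⟩
    rw [hG' n ⟨x, hEV' m n hx⟩, hi (max i j) (le_max_left _ _)]
    exact (hconst m _ (hj.trans (le_max_right _ _)) n x hx).trans (hconst m j hj n x hx).symm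
  have hd : ∀ n, ∀ v ∈ V n, G (M.d v) = A.d (G v) := by
    intro n v hv
    obtain ⟨m, hm⟩ := hmem n v hv
    rw [hGF m n v hm (m + 1) le_rfl, ← hgood (m + 1) m (Nat.lt_succ_self m) n v hm]
    cases m with
    | zero => rw [hE0 n v hm, map_zero, map_zero]
    | succ m =>
      refine AlgHom.eqOn_adjoin_iff.mpr (fun a ha => ?_) (hEd m n v hm)
      obtain ⟨i, hi⟩ := Set.mem_iUnion.mp ha
      exact hGF m i a hi _ (by omega)
  refine ⟨⟨G, fun {i a} ha => hG i a ha, fun a => ?_⟩, hom_ext fun a => ?_⟩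
  · refine map_d_of_mem_adjoin hG (s := ⋃ n, (V n : Set M)) (fun a ha => ?_)
      (by rw [hV.adjoin_eq_top]; trivial)
    obtain ⟨i, hi⟩ := Set.mem_iUnion.mp ha
    exact hd i a hi
  · refine DFunLike.congr_fun (f := p.toAlgHom.comp G) (g := f.toAlgHom)
      (hV.algHom_ext fun n v hv => ?_) a
    obtain ⟨m, hm⟩ := hmem n v hv
    exact (congrArg p (hGF m n v hm _ le_rfl)).trans ((F _).map_hom v)

end lifting

lemma exists_lift_of_sullivanMinimal {M A B : CDGA k} (hM : sullivanMinimal k M) {p : A ⟶ B}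
    (hp : Function.Surjective p) (hw : quasiIsos k p) (f : M ⟶ B) : ∃ g : M ⟶ A, g ≫ p = f := by
  obtain ⟨V, -, hV, ⟨E, hE, hEV, hE0, hEd⟩, -⟩ := hM
  exact hV.exists_lift hp hw hE hEV hE0 hEd f

end CDGA

/-! ## Morphisms in a localization -/

section Localization

variable {C : Type*} [Category* C] {D : Type*} [Category.{v} D] (L : C ⥤ D)
  (W : MorphismProperty C) [L.IsLocalization W]

/-- Suppose that the functor `F` inverts `W` and is generated by an element `x ∈ F(M)`. If there is
a natural transformation `F(B) → Hom(L(M), L(B))` which sends `x` to the identity, then it is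
bijective. -/
lemma bijective_app_of_isInvertedBy {M : C} {F : C ⥤ Type v} (hF : W.IsInvertedBy F) (x : F.obj M)
    (hx : ∀ {B : C} (y : F.obj B), ∃ f : M ⟶ B, F.map f x = y)
    (θ : F ⟶ L ⋙ coyoneda.obj (Opposite.op (L.obj M))) (hθ : θ.app M x = 𝟙 (L.obj M)) (B : C) :
    Function.Bijective (θ.app B) := by
  let F' := Localization.lift F hF L
  let e : L ⋙ F' ≅ F := Localization.fac F hF L
  have hL : ∀ f : M ⟶ B, θ.app B (F.map f x) = L.map f := fun f => by
    refine (NatTrans.naturality_apply θ f x).trans ?_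
    rw [hθ]
    exact Category.id_comp _
  constructor
  · intro y₁ y₂ h
    obtain ⟨f₁, rfl⟩ := hx y₁
    obtain ⟨f₂, rfl⟩ := hx y₂
    rw [hL, hL] at h
    -- F factors through L up to isomorphism, so morphisms identified by L are identified by F.
    have h' : F.map f₁ = F.map f₂ := by
      rw [← cancel_epi (e.hom.app M), ← e.hom.naturality, ← e.hom.naturality, Functor.comp_map,
        Functor.comp_map, h]
    rw [h']
  · intro α
    let _ : Localization.Lifting L W (L ⋙ coyoneda.obj (Opposite.op (L.obj M)))
      (coyoneda.obj (Opposite.op (L.obj M))) := ⟨Iso.refl _⟩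
    -- After extension to the localization, naturality may be applied to morphisms that do not come
    -- from C: the preimage of α is the image of x under the extended functor at α.
    let θ' : F' ⟶ coyoneda.obj (Opposite.op (L.obj M)) :=
      Localization.liftNatTrans L W F (L ⋙ coyoneda.obj (Opposite.op (L.obj M))) _ _ θ
    have hθ' : ∀ (Y : C) (z : F'.obj (L.obj Y)), θ'.app (L.obj Y) z = θ.app Y (e.hom.app Y z) := by
      intro Y z
      have := Localization.liftNatTrans_app L W F (L ⋙ coyoneda.obj (Opposite.op (L.obj M)))
        F' (coyoneda.obj (Opposite.op (L.obj M))) θ Y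
      exact congrArg (fun φ : F'.obj (L.obj Y) ⟶ (L.obj M ⟶ L.obj Y) => φ z) this
    refine ⟨e.hom.app B (F'.map α (e.inv.app M x)), ?_⟩
    rw [← hθ']
    refine (NatTrans.naturality_apply θ' α _).trans ?_
    rw [hθ']
    have h1 : e.hom.app M (e.inv.app M x) = x := by
      exact congrArg (fun φ : F.obj M ⟶ F.obj M => φ x) (e.inv_hom_id_app M)
    rw [h1, hθ]
    exact Category.id_comp _

end Localization

/-! ## Homotopy classes of morphisms from a Sullivan minimal dga -/

namespace CDGA

variable {k : Type u} [Field k]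

/-- Cocycles and primitives are chosen in each factor. This is needed to see that the map of (P₅) is
a quasi-isomorphism when v is. -/
lemma quasiIsos_prod_map {A B : CDGA k} {f : A ⟶ B} (hf : quasiIsos k f) :
    quasiIsos k (prod.map f f) := by
  obtain ⟨hi, hs⟩ := (quasiIsos_iff f).mp hf
  refine (quasiIsos_iff _).mpr ⟨fun x hx ⟨y, hy⟩ => ?_, fun y hy => ?_⟩
  · obtain ⟨a, ha⟩ := hi ((Limits.prod.fst : A ⨯ A ⟶ A) x) (by rw [← hom_d, hx, map_zero])
      ⟨(Limits.prod.fst : B ⨯ B ⟶ B) y, by rw [← hom_d, hy, prod_map_fst]⟩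
    obtain ⟨b, hb⟩ := hi ((Limits.prod.snd : A ⨯ A ⟶ A) x) (by rw [← hom_d, hx, map_zero])
      ⟨(Limits.prod.snd : B ⨯ B ⟶ B) y, by rw [← hom_d, hy, prod_map_snd]⟩
    obtain ⟨z, h1, h2⟩ := exists_prod a b
    exact ⟨z, prod_ext (by rw [hom_d, h1, ha]) (by rw [hom_d, h2, hb])⟩
  · obtain ⟨a, ha, c, hc⟩ := hs ((Limits.prod.fst : B ⨯ B ⟶ B) y) (by rw [← hom_d, hy, map_zero])
    obtain ⟨a', ha', c', hc'⟩ := hs ((Limits.prod.snd : B ⨯ B ⟶ B) y)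
      (by rw [← hom_d, hy, map_zero])
    obtain ⟨z, h1, h2⟩ := exists_prod a a'
    obtain ⟨x, h3, h4⟩ := exists_prod c c'
    refine ⟨z, prod_ext (by rw [hom_d, h1, ha, map_zero]) (by rw [hom_d, h2, ha', map_zero]), x,
      prod_ext ?_ ?_⟩
    · rw [map_add, prod_map_fst, h1, hom_d, h3, hc]
    · rw [map_add, prod_map_snd, h2, hom_d, h4, hc']

variable [CharZero k]

lemma homotopic_comp {M A B : CDGA k} {f g : M ⟶ A} (h : (functorialPath k).Homotopic f g)
    (w : A ⟶ B) : (functorialPath k).Homotopic (f ≫ w) (g ≫ w) := by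
  obtain ⟨H, rfl, rfl⟩ := h
  refine ⟨H ≫ (functorialPath k).P.map w, ?_, ?_⟩
  · rw [Category.assoc, ((functorialPath k).δ 0).naturality]; rfl
  · rw [Category.assoc, ((functorialPath k).δ 1).naturality]; rfl

lemma homotopic_refl {M A : CDGA k} (f : M ⟶ A) : (functorialPath k).Homotopic f f :=
  ⟨f ≫ (functorialPath k).ι.app A,
    by rw [Category.assoc, (functorialPath k).ι_δ]; exact Category.comp_id f,
    by rw [Category.assoc, (functorialPath k).ι_δ]; exact Category.comp_id f⟩

lemma endpoints_comp_fst (A : CDGA k) : (functorialPath k).endpoints A ≫ Limits.prod.fst =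
    ((functorialPath k).δ 0).app A := prod.lift_fst _ _

lemma endpoints_comp_snd (A : CDGA k) : (functorialPath k).endpoints A ≫ Limits.prod.snd =
    ((functorialPath k).δ 1).app A := prod.lift_snd _ _

section trivialFib

variable {M A B : CDGA k} (hM : sullivanMinimal k M) {v : A ⟶ B} (hv : Function.Surjective v)
  (hw : quasiIsos k v)

include hM hv hw

/-- For a surjective quasi-isomorphism v, the map from P(A) to the double mapping path of v is
surjective by (P₅) and a quasi-isomorphism by two out of three. The triple (f, g, H) is a morphism
from M to that double mapping path, and a lift of it is a homotopy from f to g. -/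
lemma homotopic_of_trivialFib {f g : M ⟶ A}
    (h : (functorialPath k).Homotopic (f ≫ v) (g ≫ v)) : (functorialPath k).Homotopic f g := by
  obtain ⟨H, h0, h1⟩ := h
  have sq := IsPullback.of_hasPullback (prod.map v v) ((functorialPath k).endpoints B)
  let vbar := sq.lift ((functorialPath k).endpoints A) ((functorialPath k).P.map v)
    ((functorialPath k).endpoints_naturality v)
  have hs : Function.Surjective vbar := (isPCategory k).fib_lift v sq hv
  have hq : quasiIsos k vbar := by
    -- The second projection is the pull-back of v × v along the surjection given by the endpoints,
    -- hence a quasi-isomorphism by (P₃); its composite with `vbar` is P(v).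
    refine (quasiIsos k).of_postcomp vbar _ (quasiIsos_snd_of_isPullback sq
      ((isPCategory k).fib_endpoints B) (quasiIsos_prod_map hw)) ?_
    rw [sq.lift_snd]
    exact quasiIsos_pathMap hw
  obtain ⟨K, hK⟩ := exists_lift_of_sullivanMinimal hM hs hq (sq.lift (prod.lift f g) H (by
    rw [prod.lift_map]
    refine Limits.prod.hom_ext ?_ ?_
    · rw [Category.assoc, endpoints_comp_fst, h0, prod.lift_fst]
    · rw [Category.assoc, endpoints_comp_snd, h1, prod.lift_snd]))
  have hK' : K ≫ (functorialPath k).endpoints A = prod.lift f g := by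
    rw [← sq.lift_fst ((functorialPath k).endpoints A) ((functorialPath k).P.map v)
      ((functorialPath k).endpoints_naturality v), ← Category.assoc, hK, sq.lift_fst]
  refine ⟨K, ?_, ?_⟩
  · rw [← endpoints_comp_fst, ← Category.assoc, hK']
    exact prod.lift_fst f g
  · rw [← endpoints_comp_snd, ← Category.assoc, hK']
    exact prod.lift_snd f g

/-- A chain of homotopies lifts link by link. Quantifying over all lifts of the two ends makes the
induction work: at a concatenation the middle map is lifted once and used on both sides. -/
lemma eqvGen_homotopic_of_trivialFib {f g : M ⟶ B}
    (h : Relation.EqvGen (functorialPath k).Homotopic f g) : ∀ f' g' : M ⟶ A, f' ≫ v = f →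
      g' ≫ v = g → Relation.EqvGen (functorialPath k).Homotopic f' g' := by
  induction h with
  | rel f g h =>
    rintro f' g' rfl rfl
    exact .rel _ _ (homotopic_of_trivialFib hM hv hw h)
  | refl f =>
    rintro f' g' rfl hg
    refine .rel _ _ (homotopic_of_trivialFib hM hv hw ?_)
    rw [hg]
    exact homotopic_refl _
  | symm f g _ ih => exact fun f' g' hf hg => .symm _ _ (ih g' f' hg hf)
  | trans f e g _ _ ih ih' =>
    intro f' g' hf hg
    obtain ⟨e', he⟩ := exists_lift_of_sullivanMinimal hM hv hw e
    exact .trans _ e' _ (ih f' e' hf he) (ih' e' g' he hg)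

end trivialFib

/-- The homotopy classes of morphisms from `M` to `A`. -/
def HomotopyClasses (M A : CDGA k) : Type u := Quot fun f g : M ⟶ A => (functorialPath k).Homotopic f g

namespace HomotopyClasses

variable {M A B D : CDGA k}

/-- The homotopy class of a morphism. -/
def mk (f : M ⟶ A) : HomotopyClasses M A := Quot.mk _ f

lemma mk_surjective : Function.Surjective (mk : (M ⟶ A) → HomotopyClasses M A) :=
  Quot.mk_surjective

/-- Composition with a morphism. -/
def map (w : A ⟶ B) : HomotopyClasses M A → HomotopyClasses M B :=
  Quot.map (fun f => f ≫ w) fun _ _ h => homotopic_comp h w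

@[simp] lemma map_mk (w : A ⟶ B) (f : M ⟶ A) : map w (mk f) = mk (f ≫ w) := rfl

lemma map_id : (map (𝟙 A) : HomotopyClasses M A → HomotopyClasses M A) = id := by
  funext x
  obtain ⟨f, rfl⟩ := mk_surjective x
  simp

lemma map_comp (w : A ⟶ B) (w' : B ⟶ D) :
    (map (w ≫ w') : HomotopyClasses M A → HomotopyClasses M D) = map w' ∘ map w := by
  funext x
  obtain ⟨f, rfl⟩ := mk_surjective x
  simp

lemma map_bijective_of_trivialFib (hM : sullivanMinimal k M) {v : A ⟶ B}
    (hv : Function.Surjective v) (hw : quasiIsos k v) :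
    Function.Bijective (map v : HomotopyClasses M A → HomotopyClasses M B) := by
  constructor
  · intro x y hxy
    obtain ⟨f, rfl⟩ := mk_surjective x
    obtain ⟨g, rfl⟩ := mk_surjective y
    exact Quot.eqvGen_sound
      (eqvGen_homotopic_of_trivialFib hM hv hw (Quot.eqvGen_exact hxy) f g rfl rfl)
  · intro y
    obtain ⟨g, rfl⟩ := mk_surjective y
    obtain ⟨f, rfl⟩ := exists_lift_of_sullivanMinimal hM hv hw g
    exact ⟨mk f, rfl⟩

/-- Quasi-isomorphisms induce bijections between homotopy classes: by Brown's factorization, this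
follows from the case of surjective quasi-isomorphisms. -/
lemma map_bijective (hM : sullivanMinimal k M) {w : A ⟶ B} (hw : quasiIsos k w) :
    Function.Bijective (map w : HomotopyClasses M A → HomotopyClasses M B) := by
  have sq := isPullback_fibreProduct w (evalAt B 0)
  have hev : Function.Surjective (evalAt B 0) := fun b => ⟨path.incl B b, evalAt_incl B 0 b⟩
  -- The fibre product is the mapping path of w: pairs of an element of A and a path in B starting
  -- at its image. Then w = v ∘ j, where v is the end of the path and j is a section of the
  -- surjective quasi-isomorphism π.
  let π := fibreProductFst w (evalAt B 0)
  have hπ : Function.Surjective π := surjective_fst_of_isPullback sq hev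
  have hπ' : quasiIsos k π := quasiIsos_fst_of_isPullback sq hev (quasiIsos_evalAt B 0)
  let j : A ⟶ fibreProduct w (evalAt B 0) := fibreProductLift (𝟙 A) (w ≫ path.incl B)
    (hom_ext fun a => by simp)
  have hj : j ≫ π = 𝟙 A := hom_ext fun a => rfl
  have hj' : quasiIsos k j := by
    refine (quasiIsos k).of_postcomp j π hπ' ?_
    rw [hj]
    exact quasiIsos_of_isIso _
  let v : fibreProduct w (evalAt B 0) ⟶ B := fibreProductSnd w (evalAt B 0) ≫ evalAt B 1
  have hv : j ≫ v = w := hom_ext fun a => evalAt_incl B 1 (w a)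
  have hv' : quasiIsos k v := by
    refine (quasiIsos k).of_precomp j v hj' ?_
    rw [hv]
    exact hw
  have hvs : Function.Surjective v := fun b => by
    -- Every b is the end of a path starting at 0, the image of 0 in A.
    obtain ⟨y, h0, h1⟩ := exists_path (0 : B) b
    exact ⟨fibreProductMk 0 y (by rw [map_zero, h0]), h1⟩
  have h1 := map_bijective_of_trivialFib (M := M) hM hπ hπ'
  have h2 : Function.Bijective (map π ∘ map j : HomotopyClasses M A → HomotopyClasses M A) := by
    rw [← map_comp, hj, map_id]
    exact Function.bijective_id
  rw [← hv, map_comp]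
  exact (map_bijective_of_trivialFib hM hvs hv').comp ((Function.Bijective.of_comp_iff' h1 _).mp h2)

end HomotopyClasses

/-! ## The functor to the homotopy category -/

lemma zeroConnected_path {A : CDGA k} (h : zeroConnected k A) : zeroConnected k (path A) :=
  (zeroConnected_iff_of_quasiIsos (quasiIsos_incl A)).mp h

/-- Homotopic morphisms have the same image in the homotopy category. -/
lemma map_Q_eq_of_homotopic {M A : ZeroConnectedCDGA k} {f g : M ⟶ A}
    (h : (functorialPath k).Homotopic f.hom g.hom) :
    (zeroConnectedQuasiIsos k).Q.map f = (zeroConnectedQuasiIsos k).Q.map g := by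
  obtain ⟨H, h0, h1⟩ := h
  let PA : ZeroConnectedCDGA k := ⟨path A.obj, zeroConnected_path A.property⟩
  let ι : A ⟶ PA := ObjectProperty.homMk (path.incl A.obj)
  let δ (i : Fin 2) : PA ⟶ A := ObjectProperty.homMk (evalAt A.obj i)
  let H' : M ⟶ PA := ObjectProperty.homMk H
  have hι : zeroConnectedQuasiIsos k ι := quasiIsos_incl A.obj
  have hδ : ∀ i, ι ≫ δ i = 𝟙 A := fun i =>
    InducedCategory.Hom.ext (hom_ext fun a => evalAt_incl A.obj i a)
  have := Localization.inverts (zeroConnectedQuasiIsos k).Q _ ι hι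
  -- Both evaluations have ι as a section, and Q inverts ι.
  have e : (zeroConnectedQuasiIsos k).Q.map (δ 0) = (zeroConnectedQuasiIsos k).Q.map (δ 1) := by
    rw [← cancel_epi ((zeroConnectedQuasiIsos k).Q.map ι), ← Functor.map_comp, ← Functor.map_comp,
      hδ, hδ]
  have hf : f = H' ≫ δ 0 := InducedCategory.Hom.ext h0.symm
  have hg : g = H' ≫ δ 1 := InducedCategory.Hom.ext h1.symm
  rw [hf, hg, Functor.map_comp, Functor.map_comp, e]

/-- The functor `[M, -]` on `0`-connected dga's. -/
def homotopyClassesFunctor (M : CDGA k) : ZeroConnectedCDGA k ⥤ Type (u + 1) where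
  -- The morphisms of the localization live one universe higher than those of dga's.
  obj A := ULift.{u + 1} (HomotopyClasses M A.obj)
  map w := TypeCat.ofHom fun x => ULift.up (HomotopyClasses.map w.hom x.down)
  map_id A := by
    ext x
    exact congrFun HomotopyClasses.map_id x.down
  map_comp w w' := by
    ext x
    exact congrFun (HomotopyClasses.map_comp w.hom w'.hom) x.down

lemma isInvertedBy_homotopyClassesFunctor {M : CDGA k} (hM : sullivanMinimal k M) :
    (zeroConnectedQuasiIsos k).IsInvertedBy (homotopyClassesFunctor M) := by
  intro A B w hw
  rw [isIso_iff_bijective]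
  have h := HomotopyClasses.map_bijective hM (w := w.hom) hw
  exact (Equiv.ulift.symm.bijective.comp h).comp Equiv.ulift.bijective

/-- The natural map from homotopy classes to morphisms in the homotopy category. -/
def homotopyClassesToHo (M : ZeroConnectedCDGA k) : homotopyClassesFunctor M.obj ⟶
    (zeroConnectedQuasiIsos k).Q ⋙
      coyoneda.obj (Opposite.op ((zeroConnectedQuasiIsos k).Q.obj M)) where
  app A := TypeCat.ofHom fun x => Quot.lift
    (fun f : M.obj ⟶ A.obj => (zeroConnectedQuasiIsos k).Q.map (ObjectProperty.homMk f : M ⟶ A))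
    (fun _ _ h => map_Q_eq_of_homotopic h) x.down
  naturality A B w := by
    ext ⟨x⟩
    obtain ⟨f, rfl⟩ := HomotopyClasses.mk_surjective x
    exact (zeroConnectedQuasiIsos k).Q.map_comp (ObjectProperty.homMk f : M ⟶ A) w

/-- The functor [M, -] inverts quasi-isomorphisms and is generated by the class of the identity,
which is sent to the identity. -/
lemma bijective_homotopyClassesToHo {M : ZeroConnectedCDGA k} (hM : sullivanMinimal k M.obj)
    (A : ZeroConnectedCDGA k) : Function.Bijective ((homotopyClassesToHo M).app A) := by
  refine bijective_app_of_isInvertedBy _ (zeroConnectedQuasiIsos k)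
    (isInvertedBy_homotopyClassesFunctor hM) (ULift.up (HomotopyClasses.mk (𝟙 M.obj)))
    (fun {B} y => ?_) _ ((zeroConnectedQuasiIsos k).Q.map_id M) A
  obtain ⟨f, hf⟩ := HomotopyClasses.mk_surjective y.down
  refine ⟨ObjectProperty.homMk f, ULift.ext _ _ ?_⟩
  refine Eq.trans ?_ hf
  exact congrArg HomotopyClasses.mk (Category.id_comp f)

/-- The inclusion of Sullivan minimal dga's induces an equivalence as soon as minimal models
exist. -/
theorem exists_isEquivalence_of_minimalModels
    (h : ∀ A : CDGA k, zeroConnected k A → ∃ (M : CDGA k) (_ : sullivanMinimal k M) (f : M ⟶ A),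
      quasiIsos k f) (hle : sullivanMinimal k ≤ zeroConnected k) :
    ∃ Φ : PiSullivanMinimal k ⥤ HoZeroConnected k,
        CategoryTheory.Quotient.functor (homotopyRel k) ⋙ Φ =
          ObjectProperty.ιOfLE hle ⋙ (zeroConnectedQuasiIsos k).Q ∧
        Φ.IsEquivalence := by
  let Q := (zeroConnectedQuasiIsos k).Q
  let J := ObjectProperty.ιOfLE hle ⋙ Q
  have hJ : ∀ (M N : SullivanMinimalCDGA k) (f g : M ⟶ N), homotopyRel k f g →
      J.map f = J.map g := fun M N f g hfg => map_Q_eq_of_homotopic hfg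
  refine ⟨CategoryTheory.Quotient.lift _ J hJ, CategoryTheory.Quotient.lift_spec _ _ _, ?_, ?_, ?_⟩
  · refine ⟨fun {X Y} a b hab => ?_⟩
    obtain ⟨f, rfl⟩ := (CategoryTheory.Quotient.functor (homotopyRel k)).map_surjective (X := X.as) (Y := Y.as) a
    obtain ⟨g, rfl⟩ := (CategoryTheory.Quotient.functor (homotopyRel k)).map_surjective (X := X.as) (Y := Y.as) b
    have h1 : J.map f = J.map g := hab
    have h2 := (bijective_homotopyClassesToHo (M := (ObjectProperty.ιOfLE hle).obj X.as)
      X.as.property ((ObjectProperty.ιOfLE hle).obj Y.as)).1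
      (a₁ := ULift.up (HomotopyClasses.mk f.hom)) (a₂ := ULift.up (HomotopyClasses.mk g.hom)) h1
    have h3 := Quot.eqvGen_exact (ULift.up_injective h2)
    -- Equality in [M, N] only gives a chain of homotopies; in the quotient category each link
    -- becomes an equality.
    have h4 : ∀ f g : X.as.obj ⟶ Y.as.obj, Relation.EqvGen (functorialPath k).Homotopic f g →
        (CategoryTheory.Quotient.functor (homotopyRel k)).map (ObjectProperty.homMk f : X.as ⟶ Y.as) =
          (CategoryTheory.Quotient.functor (homotopyRel k)).map (ObjectProperty.homMk g : X.as ⟶ Y.as) := by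
      intro f g h
      induction h with
      | rel f g h => exact CategoryTheory.Quotient.sound _ h
      | refl f => rfl
      | symm f g _ ih => exact ih.symm
      | trans f e g _ _ ih ih' => exact ih.trans ih'
    exact h4 _ _ h3
  · refine ⟨fun {X Y} α => ?_⟩
    obtain ⟨⟨x⟩, hx⟩ := (bijective_homotopyClassesToHo (M := (ObjectProperty.ιOfLE hle).obj X.as)
      X.as.property ((ObjectProperty.ιOfLE hle).obj Y.as)).2 α
    obtain ⟨f, rfl⟩ := HomotopyClasses.mk_surjective x
    exact ⟨(CategoryTheory.Quotient.functor (homotopyRel k)).map (ObjectProperty.homMk f : X.as ⟶ Y.as), hx⟩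
  · refine ⟨fun Y => ?_⟩
    have : Q.EssSurj := Localization.essSurj Q (zeroConnectedQuasiIsos k)
    let A := Q.objPreimage Y
    obtain ⟨M, hM, f, hf⟩ := h A.obj A.property
    let M' : SullivanMinimalCDGA k := ⟨M, hM⟩
    let f' : (ObjectProperty.ιOfLE hle).obj M' ⟶ A := ObjectProperty.homMk f
    have hf' : zeroConnectedQuasiIsos k f' := hf
    have := Localization.inverts Q (zeroConnectedQuasiIsos k) f' hf'
    exact ⟨(CategoryTheory.Quotient.functor (homotopyRel k)).obj M', ⟨asIso (Q.map f') ≪≫ Q.objObjPreimageIso Y⟩⟩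

end CDGA

/-! ## Free graded commutative algebras -/

section FreeGCA

variable (k : Type u) [Field k] {G : Type u} (deg : G → ℕ)

/-- The relations of graded commutativity between generators. -/
inductive FreeGCA.Rel : FreeAlgebra k G → FreeAlgebra k G → Prop
  | comm (x y : G) : FreeGCA.Rel (FreeAlgebra.ι k x * FreeAlgebra.ι k y)
      ((-1 : k) ^ (deg x * deg y) • (FreeAlgebra.ι k y * FreeAlgebra.ι k x))

/-- The free graded commutative algebra on generators `x` of degree `deg x`, over a field of
characteristic different from `2`. -/
def FreeGCA : Type u := RingQuot (FreeGCA.Rel k deg)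

namespace FreeGCA

noncomputable instance : Ring (FreeGCA k deg) := inferInstanceAs (Ring (RingQuot _))

noncomputable instance : Algebra k (FreeGCA k deg) := inferInstanceAs (Algebra k (RingQuot _))

/-- The quotient map from the free algebra. -/
noncomputable def ofFree : FreeAlgebra k G →ₐ[k] FreeGCA k deg := RingQuot.mkAlgHom k _

variable {k deg}

lemma ofFree_surjective : Function.Surjective (ofFree k deg) := RingQuot.mkAlgHom_surjective k _

variable (k deg) in
/-- The generators. -/
noncomputable def gen (x : G) : FreeGCA k deg := ofFree k deg (FreeAlgebra.ι k x)

lemma gen_mul_gen (x y : G) :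
    gen k deg x * gen k deg y = (-1 : k) ^ (deg x * deg y) • (gen k deg y * gen k deg x) := by
  have h := RingQuot.mkAlgHom_rel k (Rel.comm (k := k) (deg := deg) x y)
  rw [map_mul, map_smul, map_mul] at h
  exact h

section lift

variable {B : Type*} [Ring B] [Algebra k B]

/-- The universal property. -/
noncomputable def lift (f : G → B)
    (hf : ∀ x y, f x * f y = (-1 : k) ^ (deg x * deg y) • (f y * f x)) : FreeGCA k deg →ₐ[k] B :=
  RingQuot.liftAlgHom k ⟨FreeAlgebra.lift k f, fun _ _ h => by
    obtain ⟨x, y⟩ := h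
    simpa using hf x y⟩

@[simp] lemma lift_gen (f : G → B)
    (hf : ∀ x y, f x * f y = (-1 : k) ^ (deg x * deg y) • (f y * f x)) (x : G) :
    lift f hf (gen k deg x) = f x :=
  (RingQuot.liftAlgHom_mkAlgHom_apply k _ _ _).trans (FreeAlgebra.lift_ι_apply f x)

lemma algHom_ext {f g : FreeGCA k deg →ₐ[k] B} (h : ∀ x, f (gen k deg x) = g (gen k deg x)) :
    f = g := by
  have h1 : f.comp (ofFree k deg) = g.comp (ofFree k deg) := FreeAlgebra.hom_ext (funext h)
  ext a
  obtain ⟨a, rfl⟩ := ofFree_surjective a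
  exact DFunLike.congr_fun h1 a

end lift

lemma adjoin_range_gen : Algebra.adjoin k (Set.range (gen k deg)) = ⊤ := by
  have h := congrArg (Subalgebra.map (ofFree k deg)) (FreeAlgebra.adjoin_range_ι k G)
  rw [AlgHom.map_adjoin, ← Set.range_comp, Algebra.map_top,
    (AlgHom.range_eq_top _).mpr ofFree_surjective] at h
  exact h

variable (k deg) in
/-- The monomial of a list of generators. -/
noncomputable def word (l : List G) : FreeGCA k deg := (l.map (gen k deg)).prod

lemma word_nil : word k deg [] = 1 := rfl

lemma word_cons (x : G) (l : List G) : word k deg (x :: l) = gen k deg x * word k deg l :=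
  List.prod_cons

lemma word_append (l l' : List G) : word k deg (l ++ l') = word k deg l * word k deg l' := by
  simp [word]

variable (k deg) in
/-- The subspace spanned by the monomials of degree `n`. -/
noncomputable def grading (n : ℕ) : Submodule k (FreeGCA k deg) :=
  Submodule.span k {w | ∃ l : List G, (l.map deg).sum = n ∧ word k deg l = w}

lemma word_mem (l : List G) : word k deg l ∈ grading k deg (l.map deg).sum :=
  Submodule.subset_span ⟨l, rfl, rfl⟩

lemma gen_mem (x : G) : gen k deg x ∈ grading k deg (deg x) :=
  Submodule.subset_span ⟨[x], by simp, by simp [word]⟩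

instance : SetLike.GradedMonoid (grading k deg) where
  one_mem := Submodule.subset_span ⟨[], rfl, rfl⟩
  mul_mem i j a b ha hb := by
    have h := Submodule.mul_mem_mul ha hb
    rw [grading, grading, Submodule.span_mul_span] at h
    refine Submodule.span_le.mpr ?_ h
    rintro _ ⟨_, ⟨l, rfl, rfl⟩, _, ⟨l', rfl, rfl⟩, rfl⟩
    exact Submodule.subset_span ⟨l ++ l', by simp, word_append l l'⟩

/-- Transport along an equality of degrees, needed because `deg x + deg y` and `deg y + deg x` index
different summands. -/
lemma of_eq_of {i j : ℕ} (h : i = j) {a : grading k deg i} {b : grading k deg j}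
    (hab : (a : FreeGCA k deg) = b) :
    DirectSum.of (fun n => grading k deg n) i a = DirectSum.of (fun n => grading k deg n) j b := by
  subst h
  rw [Subtype.ext hab]

variable (k deg) in
/-- The decomposition into homogeneous components. -/
noncomputable def decomposeHom : FreeGCA k deg →ₐ[k] DirectSum ℕ fun n => grading k deg n :=
  lift (fun x => DirectSum.of (fun n => grading k deg n) (deg x) ⟨gen k deg x, gen_mem x⟩)
    (fun x y => by
      rw [DirectSum.of_mul_of, DirectSum.of_mul_of, ← DirectSum.lof_eq_of k, ← DirectSum.lof_eq_of k,
        ← map_smul]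
      exact of_eq_of (add_comm _ _) (gen_mul_gen x y))

noncomputable instance : GradedAlgebra (grading k deg) :=
  GradedAlgebra.ofAlgHom _ (decomposeHom k deg)
    (algHom_ext fun x => by
      rw [AlgHom.comp_apply, decomposeHom, lift_gen, DirectSum.coeAlgHom_of]
      rfl)
    (fun n a => by
      obtain ⟨a, ha⟩ := a
      dsimp only
      have hw : ∀ l : List G, decomposeHom k deg (word k deg l) =
          DirectSum.of (fun n => grading k deg n) (l.map deg).sum ⟨word k deg l, word_mem l⟩ := by
        intro l
        induction l with
        | nil => exact map_one _
        | cons x l ih =>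
          refine (congrArg (decomposeHom k deg) (word_cons x l)).trans ?_
          rw [map_mul, ih, decomposeHom, lift_gen, DirectSum.of_mul_of]
          exact of_eq_of (by simp) (word_cons x l).symm
      induction ha using Submodule.span_induction with
      | mem a h =>
        obtain ⟨l, rfl, rfl⟩ := h
        exact hw l
      | zero => rw [map_zero]; exact (map_zero (DirectSum.of (fun n => grading k deg n) n)).symm
      | add a b ha hb iha ihb =>
        rw [map_add, iha, ihb, ← map_add]
        rfl
      | smul c a ha iha =>
        rw [map_smul, iha, ← DirectSum.lof_eq_of k, ← map_smul]
        rfl)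

/-- Linear statements about homogeneous elements may be checked on monomials. -/
lemma mem_of_word_mem {n : ℕ} {B : Type*} [AddCommGroup B] [Module k B] (f : FreeGCA k deg →ₗ[k] B)
    (V : Submodule k B) (h : ∀ l : List G, (l.map deg).sum = n → f (word k deg l) ∈ V)
    {a : FreeGCA k deg} (ha : a ∈ grading k deg n) : f a ∈ V := by
  have h1 : grading k deg n ≤ V.comap f := Submodule.span_le.mpr (by
    rintro _ ⟨l, hl, rfl⟩
    exact h l hl)
  exact h1 ha

lemma map_mem_of_gen_mem {B : Type*} [Ring B] [Algebra k B] (ℬ : ℕ → Submodule k B)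
    [SetLike.GradedMonoid ℬ] (f : FreeGCA k deg →ₐ[k] B) (hf : ∀ x, f (gen k deg x) ∈ ℬ (deg x))
    (n : ℕ) (a : FreeGCA k deg) (ha : a ∈ grading k deg n) : f a ∈ ℬ n := by
  refine mem_of_word_mem f.toLinearMap (ℬ n) (fun l hl => ?_) ha
  subst hl
  clear ha
  induction l with
  | nil => exact (map_one f).symm ▸ SetLike.GradedOne.one_mem (A := ℬ)
  | cons x l ih =>
    rw [word_cons, List.map_cons, List.sum_cons]
    exact (map_mul f _ _).symm ▸ SetLike.GradedMul.mul_mem (hf x) ih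

lemma word_mul_gen (x : G) (l : List G) :
    word k deg l * gen k deg x =
      (-1 : k) ^ ((l.map deg).sum * deg x) • (gen k deg x * word k deg l) := by
  induction l with
  | nil => simp [word_nil]
  | cons y l ih =>
    rw [word_cons, mul_assoc, ih, mul_smul_comm, ← mul_assoc, gen_mul_gen y x, smul_mul_assoc,
      smul_smul, mul_assoc, ← pow_add, List.map_cons, List.sum_cons, add_mul, add_comm]

lemma word_mul_word (l l' : List G) :
    word k deg l * word k deg l' =
      (-1 : k) ^ ((l.map deg).sum * (l'.map deg).sum) • (word k deg l' * word k deg l) := by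
  induction l' with
  | nil => simp [word_nil]
  | cons x l' ih =>
    rw [word_cons, ← mul_assoc, word_mul_gen, smul_mul_assoc, mul_assoc, ih, mul_smul_comm,
      smul_smul, ← pow_add, mul_assoc, List.map_cons, List.sum_cons, mul_add]

/-- Both sides are bilinear, so the commutation rule for monomials suffices. -/
lemma mul_comm_of_mem {i j : ℕ} {a b : FreeGCA k deg} (ha : a ∈ grading k deg i)
    (hb : b ∈ grading k deg j) : a * b = (-1 : k) ^ (i * j) • (b * a) := by
  rw [← sub_eq_zero, ← Submodule.mem_bot k]
  refine mem_of_word_mem (LinearMap.mulRight k b - (-1 : k) ^ (i * j) • LinearMap.mulLeft k b) ⊥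
    (fun l hl => ?_) ha
  refine mem_of_word_mem (LinearMap.mulLeft k (word k deg l) - (-1 : k) ^ (i * j) •
    LinearMap.mulRight k (word k deg l)) ⊥ (fun l' hl' => ?_) hb
  rw [Submodule.mem_bot, LinearMap.sub_apply, sub_eq_zero, ← hl, ← hl']
  exact word_mul_word l l'

variable (k deg) in
/-- The sign automorphism. -/
noncomputable def sign : FreeGCA k deg →ₐ[k] FreeGCA k deg :=
  lift (fun x => (-1 : k) ^ deg x • gen k deg x) fun x y => by
    rw [smul_mul_smul_comm, smul_mul_smul_comm, gen_mul_gen, smul_comm,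
      mul_comm ((-1 : k) ^ deg y)]

lemma sign_gen (x : G) : sign k deg (gen k deg x) = (-1 : k) ^ deg x • gen k deg x :=
  lift_gen _ _ x

lemma sign_of_mem {n : ℕ} {a : FreeGCA k deg} (ha : a ∈ grading k deg n) :
    sign k deg a = (-1 : k) ^ n • a := by
  rw [← sub_eq_zero, ← Submodule.mem_bot k]
  refine mem_of_word_mem ((sign k deg).toLinearMap - (-1 : k) ^ n • LinearMap.id) ⊥
    (fun l hl => ?_) ha
  rw [Submodule.mem_bot, LinearMap.sub_apply, sub_eq_zero, ← hl]
  change sign k deg (word k deg l) = (-1 : k) ^ (l.map deg).sum • word k deg l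
  clear hl
  induction l with
  | nil => simp [word_nil]
  | cons x l ih =>
    rw [word_cons, map_mul, ih, sign_gen, smul_mul_smul_comm, ← pow_add, List.map_cons,
      List.sum_cons]

/-! ### Derivations of free graded commutative algebras -/

section derivation

variable (z : G → FreeGCA k deg) (hz : ∀ x, z x ∈ grading k deg (deg x + 1))

/-- The morphism to triangular matrices which encodes a derivation. -/
noncomputable def triangular : FreeGCA k deg →ₐ[k] Matrix (Fin 2) (Fin 2) (FreeGCA k deg) :=
  lift (fun x => !![sign k deg (gen k deg x), z x; 0, gen k deg x]) fun x y => by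
    have h1 := congrArg (sign k deg) (gen_mul_gen (k := k) (deg := deg) x y)
    rw [map_mul, map_smul, map_mul] at h1
    -- The upper right entry of the commutation relation. Multiplicativity of the matrices with rows
    -- (σ(a), D a) and (0, a) is the skew Leibniz rule, so D exists once the matrices of the
    -- generators commute up to the prescribed sign.
    have h2 : sign k deg (gen k deg x) * z y + z x * gen k deg y = (-1 : k) ^ (deg x * deg y) •
        (sign k deg (gen k deg y) * z x + z y * gen k deg x) := by
      rw [sign_gen, sign_gen, smul_mul_assoc, smul_mul_assoc, mul_comm_of_mem (gen_mem x) (hz y),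
        mul_comm_of_mem (hz x) (gen_mem y), smul_add, smul_smul, smul_smul, ← pow_add, ← pow_add,
        add_comm]
      congr 2
      · congr 1
        ring
      · rw [mul_add, mul_one, add_comm (_ * _), ← add_assoc, pow_add, ← two_mul, pow_mul]
        simp
    ext i j
    fin_cases i <;> fin_cases j <;>
      simp [Matrix.mul_apply, Fin.sum_univ_two, h1, h2, ← gen_mul_gen]

lemma triangular_apply (a : FreeGCA k deg) :
    triangular z hz a 0 0 = sign k deg a ∧ triangular z hz a 1 0 = 0 ∧
      triangular z hz a 1 1 = a := by
  have ha : a ∈ Algebra.adjoin k (Set.range (gen k deg)) := by rw [adjoin_range_gen]; trivial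
  induction ha using Algebra.adjoin_induction with
  | mem a ha =>
    obtain ⟨x, rfl⟩ := ha
    simp [triangular]
  | algebraMap c => simp [Matrix.algebraMap_matrix_apply]
  | add a b _ _ ha hb => simp [ha, hb]
  | mul a b _ _ ha hb => simp [Matrix.mul_apply, Fin.sum_univ_two, ha, hb]

/-- The derivation of degree `1` with prescribed values on the generators. -/
noncomputable def derivation : FreeGCA k deg →ₗ[k] FreeGCA k deg :=
  (Matrix.entryLinearMap k (FreeGCA k deg) 0 1).comp (triangular z hz).toLinearMap

lemma derivation_gen (x : G) : derivation z hz (gen k deg x) = z x := by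
  simp [derivation, triangular]

lemma derivation_mul (a b : FreeGCA k deg) : derivation z hz (a * b) =
    derivation z hz a * b + sign k deg a * derivation z hz b := by
  simp [derivation, Matrix.mul_apply, Fin.sum_univ_two, triangular_apply, add_comm]

lemma derivation_one : derivation z hz 1 = 0 := by
  simp [derivation]

lemma derivation_mem {n : ℕ} {a : FreeGCA k deg} (ha : a ∈ grading k deg n) :
    derivation z hz a ∈ grading k deg (n + 1) := by
  refine mem_of_word_mem (derivation z hz) _ (fun l hl => ?_) ha
  subst hl
  clear ha
  induction l with
  | nil =>
    rw [word_nil, derivation_one]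
    exact zero_mem _
  | cons x l ih =>
    rw [word_cons, derivation_mul, derivation_gen, sign_gen, smul_mul_assoc, List.map_cons,
      List.sum_cons]
    refine add_mem ?_ (Submodule.smul_mem _ _ ?_)
    · rw [add_right_comm]
      exact SetLike.GradedMul.mul_mem (hz x) (word_mem l)
    · rw [add_assoc]
      exact SetLike.GradedMul.mul_mem (gen_mem x) ih

lemma derivation_sign (a : FreeGCA k deg) :
    derivation z hz (sign k deg a) = - sign k deg (derivation z hz a) := by
  induction a using DirectSum.Decomposition.inductionOn (grading k deg) with
  | zero => simp
  | @homogeneous n a =>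
    rw [sign_of_mem a.2, map_smul, sign_of_mem (derivation_mem z hz a.2), pow_succ, mul_neg_one,
      neg_smul, neg_neg]
  | add a b ha hb => simp only [map_add, ha, hb, neg_add]

/-- The square of D is an ordinary derivation: D anticommutes with the sign automorphism, so the
cross terms cancel. It therefore vanishes on an algebra when it vanishes on generators. -/
lemma derivation_derivation_of_mem_adjoin {s : Set (FreeGCA k deg)}
    (hs : ∀ a ∈ s, derivation z hz (derivation z hz a) = 0) {a : FreeGCA k deg}
    (ha : a ∈ Algebra.adjoin k s) : derivation z hz (derivation z hz a) = 0 := by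
  induction ha using Algebra.adjoin_induction with
  | mem a ha => exact hs a ha
  | algebraMap c => simp [Algebra.algebraMap_eq_smul_one, derivation_one]
  | add a b _ _ ha hb => rw [map_add, map_add, ha, hb, add_zero]
  | mul a b _ _ ha hb =>
    rw [derivation_mul, map_add, derivation_mul, derivation_mul, ha, hb, derivation_sign]
    simp

end derivation

end FreeGCA

end FreeGCA

/-! ## Criteria for Sullivan minimality -/

namespace CDGA

variable {k : Type u} [Field k]

section criteria

variable {M : CDGA k}

lemma mem_positivePart {a : M} : a ∈ M.positivePart ↔ M.comp 0 a = 0 := by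
  constructor
  · intro h
    have h1 : M.positivePart ≤ LinearMap.ker (M.comp 0) := iSup_le fun n a ha =>
      GradedAlgebra.proj_eq_zero ha n.succ_ne_zero
    exact h1 h
  · intro h
    obtain ⟨N, hN⟩ := GradedAlgebra.exists_forall_ge_proj_eq_zero M.grading a
    rw [← GradedAlgebra.sum_range_proj M.grading hN]
    refine sum_mem fun i _ => ?_
    cases i with
    | zero => exact h ▸ zero_mem _
    | succ i => exact Submodule.mem_iSup_of_mem i (M.comp_mem _ a)

lemma mem_positivePart_of_mem {n : ℕ} (hn : n ≠ 0) {a : M} (ha : a ∈ M.grading n) :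
    a ∈ M.positivePart :=
  mem_positivePart.mpr (GradedAlgebra.proj_eq_zero ha hn)

/-- The component of degree 0 is multiplicative, so M⁺ is an ideal, and therefore so is M⁺·M⁺. -/
lemma mul_mem_decomposables (a : M) {b : M} (hb : b ∈ M.positivePart * M.positivePart) :
    a * b ∈ M.positivePart * M.positivePart := by
  induction hb using Submodule.mul_induction_on' with
  | mem_mul_mem p hp q hq =>
    rw [← mul_assoc]
    refine Submodule.mul_mem_mul (mem_positivePart.mpr ?_) hq
    rw [comp, GradedAlgebra.proj_zero_mul, mem_positivePart.mp hp, mul_zero]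
  | add x _ y _ hx hy =>
    rw [mul_add]
    exact add_mem hx hy

lemma decomposables_mul_mem (a : M) {b : M} (hb : b ∈ M.positivePart * M.positivePart) :
    b * a ∈ M.positivePart * M.positivePart := by
  induction hb using Submodule.mul_induction_on' with
  | mem_mul_mem p hp q hq =>
    rw [mul_assoc]
    refine Submodule.mul_mem_mul hp (mem_positivePart.mpr ?_)
    rw [comp, GradedAlgebra.proj_zero_mul, mem_positivePart.mp hq, zero_mul]
  | add x _ y _ hx hy =>
    rw [add_mul]
    exact add_mem hx hy

variable {V : ℕ → Submodule k M} (hV : M.IsFreeOn V)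

include hV

/-- In an algebra generated in degrees `≤ n`, elements of degree `> n` are decomposable. -/
lemma comp_mem_decomposables {n : ℕ} {a : M}
    (ha : a ∈ Algebra.adjoin k (⋃ j ≤ n, (V j : Set M))) (i : ℕ) (hi : n < i) :
    M.comp i a ∈ M.positivePart * M.positivePart := by
  induction ha using Algebra.adjoin_induction generalizing i with
  | mem a ha =>
    simp only [Set.mem_iUnion] at ha
    obtain ⟨j, hj, ha⟩ := ha
    rw [comp, GradedAlgebra.proj_eq_zero (hV.1 j ha) (by omega)]
    exact zero_mem _
  | algebraMap c =>
    rw [comp, GradedAlgebra.proj_algebraMap_of_ne _ (by omega)]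
    exact zero_mem _
  | add a b _ _ iha ihb =>
    rw [map_add]
    exact add_mem (iha i hi) (ihb i hi)
  | mul a b _ _ iha ihb =>
    rw [comp, GradedAlgebra.proj_mul]
    refine sum_mem fun ij hij => ?_
    have hij' := Finset.HasAntidiagonal.mem_antidiagonal.mp hij
    by_cases h1 : ij.1 = 0
    · have h2 : ij.2 = i := by omega
      exact mul_mem_decomposables _ (h2 ▸ ihb i hi)
    · by_cases h2 : ij.2 = 0
      · have h3 : ij.1 = i := by omega
        exact decomposables_mul_mem _ (h3 ▸ iha i hi)
      · exact Submodule.mul_mem_mul (mem_positivePart_of_mem h1 (M.comp_mem _ _))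
          (mem_positivePart_of_mem h2 (M.comp_mem _ _))

/-- For a generator v of degree n, dv has degree n + 1 but lies in a subalgebra generated in degrees
at most n, hence is decomposable. Since the decomposables form an ideal, the Leibniz rule extends
this to all elements. -/
lemma d_mem_decomposables
    (h : ∀ n, ∀ v ∈ V n, M.d v ∈ Algebra.adjoin k (⋃ j ≤ n, (V j : Set M))) (a : M) :
    M.d a ∈ M.positivePart * M.positivePart := by
  have ha : a ∈ Algebra.adjoin k (⋃ n, (V n : Set M)) := by rw [hV.adjoin_eq_top]; trivial
  induction ha using Algebra.adjoin_induction with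
  | mem a ha =>
    obtain ⟨n, hn⟩ := Set.mem_iUnion.mp ha
    have h1 := comp_mem_decomposables hV (h n a hn) (n + 1) (Nat.lt_succ_self n)
    rwa [comp_eq_self (M.d_mem (hV.1 n hn))] at h1
  | algebraMap c =>
    rw [(M.algebraMap_mem_cocycles c).2]
    exact zero_mem _
  | add a b _ _ iha ihb =>
    rw [map_add]
    exact add_mem iha ihb
  | mul a b _ _ iha ihb =>
    rw [M.leibniz_sign]
    exact add_mem (decomposables_mul_mem b iha) (mul_mem_decomposables _ ihb)

end criteria

/-- The largest filtration of `V` with `d = 0` on `V(0)` and `d V(m+1) ⊆ Λ V(m)`. -/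
noncomputable def maxFiltration (M : CDGA k) (V : ℕ → Submodule k M) : ℕ → ℕ → Submodule k M
  | 0 => fun n => V n ⊓ LinearMap.ker M.d
  | m + 1 => fun n => V n ⊓ (Subalgebra.toSubmodule (Algebra.adjoin k
      (⋃ j, (maxFiltration M V m j : Set M)))).comap M.d

lemma maxFiltration_le (M : CDGA k) (V : ℕ → Submodule k M) (m n : ℕ) :
    maxFiltration M V m n ≤ V n := by
  cases m <;> exact inf_le_left

lemma monotone_maxFiltration (M : CDGA k) (V : ℕ → Submodule k M) (n : ℕ) :
    Monotone fun m => maxFiltration M V m n := by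
  refine monotone_nat_of_le_succ fun m => ?_
  induction m generalizing n with
  | zero =>
    refine inf_le_inf le_rfl fun a ha => ?_
    have ha' : M.d a = 0 := ha
    change M.d a ∈ Algebra.adjoin k _
    rw [ha']
    exact zero_mem _
  | succ m ih =>
    refine inf_le_inf le_rfl (Submodule.comap_mono ?_)
    exact Algebra.adjoin_mono (Set.iUnion_mono fun j => ih j)

/-- The differential of v involves finitely many elements, which occur together at some stage m;
then v occurs at stage m + 1. -/
lemma exists_mem_maxFiltration {M : CDGA k} {V : ℕ → Submodule k M} {n : ℕ} {v : M} (hv : v ∈ V n)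
    (hdv : M.d v ∈ Algebra.adjoin k (⋃ m, ⋃ j, (maxFiltration M V m j : Set M))) :
    ∃ m, v ∈ maxFiltration M V m n := by
  let c : ℕ → Set M := fun m => ⋃ j, (maxFiltration M V m j : Set M)
  have hc : Monotone c := fun _ _ h => Set.iUnion_mono fun j => monotone_maxFiltration M V j h
  rw [← Set.sUnion_range] at hdv
  obtain ⟨_, ⟨m, rfl⟩, hm⟩ := mem_adjoin_sUnion_of_directedOn (Set.range_nonempty c)
    hc.directed_le.directedOn_range hdv
  exact ⟨m + 1, hv, hm⟩

end CDGA

/-! ## Minimal models -/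

/-- The generators of minimal models: `mk n z a` stands for a generator `x` of degree `n` with
`d x = z` which is mapped to `a`. -/
inductive ModelGen (k A : Type u) : Type u
  | mk (n : ℕ) (z : FreeAlgebra.Pre k (ModelGen k A)) (a : A)

namespace ModelGen

variable {k A : Type u}

/-- The degree of a generator. -/
def deg : ModelGen k A → ℕ
  | mk n _ _ => n

/-- A representative of the differential of a generator. -/
def term : ModelGen k A → FreeAlgebra.Pre k (ModelGen k A)
  | mk _ z _ => z

/-- The image of a generator. -/
def val : ModelGen k A → A
  | mk _ _ a => a

end ModelGen

namespace CDGA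

variable {k : Type u} [Field k] (A : CDGA k)

/-- The algebra which contains the minimal models of `A`. -/
abbrev ModelAlg : Type u := FreeGCA k (ModelGen.deg : ModelGen k A → ℕ)

namespace ModelAlg

/-- The grading. -/
noncomputable abbrev gr : ℕ → Submodule k A.ModelAlg := FreeGCA.grading k ModelGen.deg

/-- The generators. -/
noncomputable abbrev gen (x : ModelGen k A) : A.ModelAlg := FreeGCA.gen k ModelGen.deg x

/-- The differentials of the generators. -/
noncomputable def dGen (x : ModelGen k A) : A.ModelAlg :=
  GradedAlgebra.proj (gr A) (x.deg + 1) (FreeGCA.ofFree k _ (Quot.mk _ x.term))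

lemma dGen_mem (x : ModelGen k A) : dGen A x ∈ gr A (x.deg + 1) :=
  GradedAlgebra.proj_mem _ _ _

/-- The derivation of `ModelAlg A`; its square is zero only on suitable subalgebras. -/
noncomputable def D : A.ModelAlg →ₗ[k] A.ModelAlg := FreeGCA.derivation (dGen A) (dGen_mem A)

lemma D_gen (x : ModelGen k A) : D A (gen A x) = dGen A x := FreeGCA.derivation_gen _ _ x

lemma D_mem {n : ℕ} {y : A.ModelAlg} (hy : y ∈ gr A n) : D A y ∈ gr A (n + 1) :=
  FreeGCA.derivation_mem _ _ hy

/-- The morphism of graded algebras to `A`. -/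
noncomputable def toBase : A.ModelAlg →ₐ[k] A :=
  FreeGCA.lift (fun x => A.comp x.deg x.val) fun _ _ =>
    A.mul_comm' (A.comp_mem _ _) (A.comp_mem _ _)

lemma toBase_gen (x : ModelGen k A) : toBase A (gen A x) = A.comp x.deg x.val :=
  FreeGCA.lift_gen _ _ x

lemma toBase_mem (n : ℕ) (y : A.ModelAlg) (hy : y ∈ gr A n) : toBase A y ∈ A.grading n :=
  FreeGCA.map_mem_of_gen_mem A.grading (toBase A)
    (fun x => by rw [toBase_gen]; exact A.comp_mem _ _) n y hy

lemma toBase_sign (y : A.ModelAlg) :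
    toBase A (FreeGCA.sign k ModelGen.deg y) = A.sign (toBase A y) := by
  refine DFunLike.congr_fun (f := (toBase A).comp (FreeGCA.sign k ModelGen.deg))
    (g := A.sign.comp (toBase A)) (FreeGCA.algHom_ext fun x => ?_) y
  rw [AlgHom.comp_apply, AlgHom.comp_apply, FreeGCA.sign_gen, map_smul,
    A.sign_of_mem (toBase_mem A _ _ (FreeGCA.gen_mem x))]

/-- This is what the recursive type of generators provides: any homogeneous z and a of degrees n + 1
and n are the differential and the image of some generator. In `dGen` and `toBase` the recorded data
are projected to the right degree, which does not change z and a. -/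
lemma exists_gen {n : ℕ} {z : A.ModelAlg} (hz : z ∈ gr A (n + 1)) {a : A} (ha : a ∈ A.grading n) :
    ∃ x : ModelGen k A, x.deg = n ∧ dGen A x = z ∧ toBase A (gen A x) = a := by
  obtain ⟨y, hy⟩ := FreeGCA.ofFree_surjective z
  obtain ⟨t, rfl⟩ := Quot.mk_surjective y
  refine ⟨ModelGen.mk n t a, rfl, ?_, ?_⟩
  · exact (congrArg (GradedAlgebra.proj (gr A) (n + 1)) hy).trans (GradedAlgebra.proj_eq_self hz)
  · rw [toBase_gen]
    exact comp_eq_self ha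

/-- The subalgebra generated by a set of generators. -/
noncomputable abbrev sub (S : Set (ModelGen k A)) : Subalgebra k A.ModelAlg :=
  Algebra.adjoin k (gen A '' S)

variable {A}

lemma sub_mono {S T : Set (ModelGen k A)} (h : S ⊆ T) : sub A S ≤ sub A T :=
  Algebra.adjoin_mono (Set.image_mono h)

lemma gen_mem_sub {S : Set (ModelGen k A)} {x : ModelGen k A} (hx : x ∈ S) :
    gen A x ∈ sub A S := Algebra.subset_adjoin ⟨x, hx, rfl⟩

lemma proj_mem_sub {S : Set (ModelGen k A)} {y : A.ModelAlg} (hy : y ∈ sub A S) (n : ℕ) :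
    GradedAlgebra.proj (gr A) n y ∈ sub A S :=
  GradedAlgebra.proj_mem_adjoin (gr A) (by
    rintro _ ⟨x, _, rfl⟩
    exact ⟨x.deg, FreeGCA.gen_mem x⟩) hy n

/-- Degrees are nonnegative, so the components of degree at most n of a product involve only such
components of the factors. -/
lemma mem_sub_deg_le {S : Set (ModelGen k A)} {y : A.ModelAlg} (hy : y ∈ sub A S) {n : ℕ}
    (hyn : y ∈ gr A n) : y ∈ sub A {x ∈ S | x.deg ≤ n} := by
  have key : ∀ j ≤ n, GradedAlgebra.proj (gr A) j y ∈ sub A {x ∈ S | x.deg ≤ n} := by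
    clear hyn
    induction hy using Algebra.adjoin_induction with
    | mem y hy =>
      obtain ⟨x, hx, rfl⟩ := hy
      intro j hj
      by_cases h : x.deg = j
      · subst h
        rw [GradedAlgebra.proj_eq_self (FreeGCA.gen_mem x)]
        exact gen_mem_sub ⟨hx, hj⟩
      · rw [GradedAlgebra.proj_eq_zero (FreeGCA.gen_mem x) h]
        exact zero_mem _
    | algebraMap c => exact fun j _ => proj_mem_sub (Subalgebra.algebraMap_mem _ c) j
    | add a b _ _ ha hb =>
      intro j hj
      rw [map_add]
      exact add_mem (ha j hj) (hb j hj)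
    | mul a b _ _ ha hb =>
      intro j hj
      rw [GradedAlgebra.proj_mul]
      refine sum_mem fun i hi => ?_
      have hi' := Finset.HasAntidiagonal.mem_antidiagonal.mp hi
      exact mul_mem (ha _ (by omega)) (hb _ (by omega))
  rw [← GradedAlgebra.proj_eq_self hyn]
  exact key n le_rfl

/-- The conditions on a set of generators to generate a Sullivan minimal dga with a morphism to
`A`. -/
structure IsModelSet (S : Set (ModelGen k A)) : Prop where
  pos : ∀ x ∈ S, x.deg ≠ 0
  mem : ∀ x ∈ S, dGen A x ∈ sub A {y ∈ S | y.deg ≤ x.deg}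
  closed : ∀ x ∈ S, D A (dGen A x) = 0
  compat : ∀ x ∈ S, toBase A (dGen A x) = A.d (toBase A (gen A x))
  nilpotent : ∀ T, (∀ x ∈ S, dGen A x ∈ sub A T → x ∈ T) → S ⊆ T

/-! ### The differential on the algebra of a model set, and adding a generator -/

namespace IsModelSet

variable {S : Set (ModelGen k A)} (hS : IsModelSet S)

include hS

lemma dGen_mem_sub {x : ModelGen k A} (hx : x ∈ S) : dGen A x ∈ sub A S :=
  sub_mono (fun _ h => h.1) (hS.mem x hx)

lemma D_mem_sub {y : A.ModelAlg} (hy : y ∈ sub A S) : D A y ∈ sub A S := by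
  induction hy using Algebra.adjoin_induction with
  | mem y hy =>
    obtain ⟨x, hx, rfl⟩ := hy
    rw [D_gen]
    exact hS.dGen_mem_sub hx
  | algebraMap c =>
    rw [Algebra.algebraMap_eq_smul_one, map_smul, D, FreeGCA.derivation_one, smul_zero]
    exact zero_mem _
  | add a b _ _ ha hb =>
    rw [map_add]
    exact add_mem ha hb
  | mul a b ha' _ ha hb =>
    have hs : FreeGCA.sign k ModelGen.deg a ∈ sub A S := by
      have h1 : (sub A S).map (FreeGCA.sign k ModelGen.deg) ≤ sub A S := by
        rw [AlgHom.map_adjoin]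
        refine Algebra.adjoin_le ?_
        rintro _ ⟨_, ⟨x, hx, rfl⟩, rfl⟩
        rw [FreeGCA.sign_gen]
        exact Subalgebra.smul_mem _ (gen_mem_sub hx) _
      exact h1 ⟨a, ha', rfl⟩
    rw [D, FreeGCA.derivation_mul]
    exact add_mem (mul_mem ha (by assumption)) (mul_mem hs hb)

lemma D_D {y : A.ModelAlg} (hy : y ∈ sub A S) : D A (D A y) = 0 := by
  refine FreeGCA.derivation_derivation_of_mem_adjoin _ _ ?_ hy
  rintro _ ⟨x, hx, rfl⟩
  rw [FreeGCA.derivation_gen]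
  exact hS.closed x hx

lemma toBase_D {y : A.ModelAlg} (hy : y ∈ sub A S) : toBase A (D A y) = A.d (toBase A y) := by
  refine map_derivation_of_mem_adjoin (toBase A) (D A) A.d _ A.sign
    (FreeGCA.derivation_mul _ _) A.leibniz_sign (toBase_sign A) (FreeGCA.derivation_one _ _)
    A.d_one ?_ hy
  rintro _ ⟨x, hx, rfl⟩
  rw [D_gen]
  exact hS.compat x hx

/-- A new generator can be added in the highest degree. -/
lemma insert {x : ModelGen k A} (hx : x.deg ≠ 0) (hSx : ∀ y ∈ S, y.deg ≤ x.deg)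
    (hdx : dGen A x ∈ sub A S) (hcl : D A (dGen A x) = 0)
    (hc : toBase A (dGen A x) = A.d (toBase A (gen A x))) : IsModelSet (insert x S) where
  pos := Set.forall_mem_insert.mpr ⟨hx, hS.pos⟩
  mem := Set.forall_mem_insert.mpr
    ⟨sub_mono (T := {y ∈ Insert.insert x S | y.deg ≤ x.deg})
        (fun y hy => ⟨Set.mem_insert_of_mem _ hy, hSx y hy⟩) hdx,
      fun y hy => sub_mono (T := {z ∈ Insert.insert x S | z.deg ≤ y.deg})
        (fun z hz => ⟨Set.mem_insert_of_mem _ hz.1, hz.2⟩) (hS.mem y hy)⟩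
  closed := Set.forall_mem_insert.mpr ⟨hcl, hS.closed⟩
  compat := Set.forall_mem_insert.mpr ⟨hc, hS.compat⟩
  nilpotent T hT := by
    have h := hS.nilpotent T fun y hy => hT y (Set.mem_insert_of_mem _ hy)
    exact Set.insert_subset (hT x (Set.mem_insert _ _) (sub_mono h hdx)) h

/-- The elements of degree `deg x` after adding a generator `x`. -/
lemma exists_sub_smul_mem {x : ModelGen k A} (hx : x.deg ≠ 0) {y : A.ModelAlg}
    (hy : y ∈ sub A (Insert.insert x S)) (hyn : y ∈ gr A x.deg) :
    ∃ c : k, y - c • gen A x ∈ sub A S := by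
  have hex : ∀ z ∈ sub A (Insert.insert x S),
      ∃ c : k, GradedAlgebra.proj (gr A) 0 z = algebraMap k _ c := by
    intro z hz
    refine GradedAlgebra.proj_zero_mem_of_mem_adjoin (gr A) ?_ hz
    rintro _ ⟨y, hy, rfl⟩
    have hy0 : y.deg ≠ 0 := by
      rcases hy with rfl | hy
      · exact hx
      · exact hS.pos y hy
    exact ⟨y.deg - 1, by rw [Nat.sub_add_cancel (Nat.pos_of_ne_zero hy0)]; exact FreeGCA.gen_mem y⟩
  -- The claim on lower components is carried along for the induction: in a product, x can enter the
  -- component of degree `deg x` only through a factor of degree 0, which is a scalar because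
  -- generators have positive degree.
  have key : (∀ j < x.deg, GradedAlgebra.proj (gr A) j y ∈ sub A S) ∧
      ∃ c : k, GradedAlgebra.proj (gr A) x.deg y - c • gen A x ∈ sub A S := by
    clear hyn
    induction hy using Algebra.adjoin_induction with
    | mem y hy =>
      obtain ⟨y, hy, rfl⟩ := hy
      rcases hy with rfl | hy
      · refine ⟨fun j hj => ?_, 1, ?_⟩
        · rw [GradedAlgebra.proj_eq_zero (FreeGCA.gen_mem y) (by omega)]
          exact zero_mem _
        · rw [GradedAlgebra.proj_eq_self (FreeGCA.gen_mem y), one_smul, sub_self]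
          exact zero_mem _
      · exact ⟨fun j _ => proj_mem_sub (gen_mem_sub hy) j, 0, by
          rw [zero_smul, sub_zero]
          exact proj_mem_sub (gen_mem_sub hy) _⟩
    | algebraMap c =>
      exact ⟨fun j _ => proj_mem_sub (Subalgebra.algebraMap_mem _ c) j, 0, by
        rw [zero_smul, sub_zero]
        exact proj_mem_sub (Subalgebra.algebraMap_mem _ c) _⟩
    | add a b _ _ ha hb =>
      obtain ⟨ha, c, hc⟩ := ha
      obtain ⟨hb, d, hd⟩ := hb
      refine ⟨fun j hj => ?_, c + d, ?_⟩
      · rw [map_add]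
        exact add_mem (ha j hj) (hb j hj)
      · rw [map_add, add_smul, add_sub_add_comm]
        exact add_mem hc hd
    | mul a b ha' hb' ha hb =>
      obtain ⟨ha, c, hc⟩ := ha
      obtain ⟨hb, d, hd⟩ := hb
      obtain ⟨e, he⟩ := hex a ha'
      obtain ⟨f, hf⟩ := hex b hb'
      refine ⟨fun j hj => ?_, e * d + c * f, ?_⟩
      · rw [GradedAlgebra.proj_mul]
        refine sum_mem fun i hi => ?_
        have hi' := Finset.HasAntidiagonal.mem_antidiagonal.mp hi
        exact mul_mem (ha _ (by omega)) (hb _ (by omega))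
      · obtain ⟨n, hn⟩ : ∃ n, x.deg = n + 1 := Nat.exists_eq_succ_of_ne_zero hx
        rw [hn] at ha hb hc hd ⊢
        -- Split off the summands of bidegree (0, n + 1) and (n + 1, 0), where one factor is a
        -- scalar; in the remaining ones both factors have degree below `deg x`.
        rw [GradedAlgebra.proj_mul, Finset.Nat.sum_antidiagonal_succ,
          Finset.Nat.sum_antidiagonal_eq_sum_range_succ_mk, Finset.sum_range_succ]
        simp only [Nat.sub_self]
        rw [he, hf]
        have h1 : ∀ p q r : A.ModelAlg, algebraMap k _ e * p + (r + q * algebraMap k _ f) -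
            (e * d + c * f) • gen A x = e • (p - d • gen A x) + f • (q - c • gen A x) + r := by
          intro p q r
          rw [← Algebra.commutes f q, ← Algebra.smul_def, ← Algebra.smul_def]
          module
        rw [h1]
        refine add_mem (add_mem (Subalgebra.smul_mem _ hd _) (Subalgebra.smul_mem _ hc _))
          (sum_mem fun i hi => ?_)
        have hi' := Finset.mem_range.mp hi
        exact mul_mem (ha _ (by omega)) (hb _ (by omega))
  rw [GradedAlgebra.proj_eq_self hyn] at key
  exact key.2

end IsModelSet

/-- Each condition concerns one generator at a time and persists when the set grows.
Well-foundedness is stated as an induction principle so that it too passes to unions, here without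
any directedness. -/
lemma isModelSet_sUnion {c : Set (Set (ModelGen k A))} (hc : ∀ S ∈ c, IsModelSet S) :
    IsModelSet (⋃₀ c) where
  pos := fun x ⟨S, hS, hx⟩ => (hc S hS).pos x hx
  mem := fun x ⟨S, hS, hx⟩ => sub_mono (T := {y ∈ ⋃₀ c | y.deg ≤ x.deg})
    (fun _ hy => ⟨⟨S, hS, hy.1⟩, hy.2⟩) ((hc S hS).mem x hx)
  closed := fun x ⟨S, hS, hx⟩ => (hc S hS).closed x hx
  compat := fun x ⟨S, hS, hx⟩ => (hc S hS).compat x hx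
  nilpotent T hT := Set.sUnion_subset fun S hS =>
    (hc S hS).nilpotent T fun x hx => hT x ⟨S, hS, hx⟩

/-- Injectivity of the cohomology in degree `n` of `sub A S → A`. -/
def InjOn (n : ℕ) (S : Set (ModelGen k A)) : Prop :=
  ∀ y ∈ sub A S, y ∈ gr A n → D A y = 0 → (∃ a, A.d a = toBase A y) → ∃ w ∈ sub A S, D A w = y

/-- Surjectivity of the cohomology in degree `n` of `sub A S → A`. -/
def SurjOn (n : ℕ) (S : Set (ModelGen k A)) : Prop :=
  ∀ a ∈ A.grading n, A.d a = 0 →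
    ∃ y ∈ sub A S, y ∈ gr A n ∧ D A y = 0 ∧ ∃ b, a = toBase A y + A.d b

/-- The elements of degree n in the larger algebra are m + cx with m in the old one. For c = 0 the
old injectivity applies; the hypothesis says that for c ≠ 0 no cocycle of this form becomes exact in
A. -/
lemma InjOn.insert {n : ℕ} {S : Set (ModelGen k A)} (h : InjOn n S) (hS : IsModelSet S)
    {x : ModelGen k A} (hx : x.deg = n) (hn : n ≠ 0)
    (hc : ∀ m ∈ sub A S, ∀ c : k, c ≠ 0 → D A m + c • dGen A x = 0 →
      ¬ ∃ a, A.d a = toBase A m + c • toBase A (gen A x)) : InjOn n (insert x S) := by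
  subst hx
  intro y hy hyn hdy hay
  obtain ⟨c, hcy⟩ := hS.exists_sub_smul_mem hn hy hyn
  have h1 : y = (y - c • gen A x) + c • gen A x := (sub_add_cancel _ _).symm
  by_cases hc0 : c = 0
  · rw [hc0, zero_smul, sub_zero] at hcy
    obtain ⟨w, hw, hw'⟩ := h y hcy hyn hdy hay
    exact ⟨w, sub_mono (Set.subset_insert x S) hw, hw'⟩
  · refine absurd ?_ (hc _ hcy c hc0 ?_)
    · rwa [h1, map_add, map_smul] at hay
    · rwa [h1, map_add, map_smul, D_gen] at hdy

/-- The inductive step: extend a set of generators in degree `n`. -/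
lemma exists_extension {n : ℕ} (hn : n ≠ 0) {S₀ : Set (ModelGen k A)} (hS₀ : IsModelSet S₀)
    (hdeg : ∀ x ∈ S₀, x.deg < n) (hinj : InjOn n S₀) :
    ∃ S, S₀ ⊆ S ∧ (∀ x ∈ S, x ∈ S₀ ∨ x.deg = n) ∧ IsModelSet S ∧ InjOn n S ∧ SurjOn n S ∧
      InjOn (n + 1) S := by
  obtain ⟨S, hS₀S, hmax⟩ := zorn_subset_nonempty
    {S | S₀ ⊆ S ∧ (∀ x ∈ S, x ∈ S₀ ∨ x.deg = n) ∧ IsModelSet S ∧ InjOn n S} (by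
      intro c hc hch hne
      refine ⟨⋃₀ c, ⟨?_, ?_, isModelSet_sUnion fun S hS => (hc hS).2.2.1, ?_⟩,
        fun S hS => Set.subset_sUnion_of_mem hS⟩
      · obtain ⟨S, hS⟩ := hne
        exact (hc hS).1.trans (Set.subset_sUnion_of_mem hS)
      · rintro x ⟨S, hS, hx⟩
        exact (hc hS).2.1 x hx
      · intro y hy hyn hdy hay
        -- A cocycle over the union already lives over one member of the chain, where injectivity
        -- provides a primitive.
        rw [sub, Set.sUnion_eq_biUnion, Set.image_iUnion₂, ← Set.sUnion_image] at hy
        have hdir : DirectedOn (· ⊆ ·) ((fun S => gen A '' S) '' c) := by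
          rintro _ ⟨S, hS, rfl⟩ _ ⟨T, hT, rfl⟩
          obtain ⟨U, hU, hSU, hTU⟩ := hch.directedOn S hS T hT
          exact ⟨_, ⟨U, hU, rfl⟩, Set.image_mono hSU, Set.image_mono hTU⟩
        obtain ⟨_, ⟨S, hS, rfl⟩, hyS⟩ := mem_adjoin_sUnion_of_directedOn (hne.image _)
          hdir hy
        obtain ⟨w, hw, hw'⟩ := (hc hS).2.2.2 y hyS hyn hdy hay
        exact ⟨w, sub_mono (Set.subset_sUnion_of_mem hS) hw, hw'⟩)
    S₀ ⟨subset_rfl, fun x hx => Or.inl hx, hS₀, hinj⟩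
  obtain ⟨-, hnew, hS, hSinj⟩ := hmax.prop
  have hle : ∀ x ∈ S, x.deg ≤ n := fun x hx =>
    (hnew x hx).elim (fun h => (hdeg x h).le) fun h => h.le
  -- By maximality, every generator of degree n that can be added without destroying injectivity in
  -- degree n is already in S.
  have key : ∀ x : ModelGen k A, x.deg = n → dGen A x ∈ sub A S → D A (dGen A x) = 0 →
      toBase A (dGen A x) = A.d (toBase A (gen A x)) →
      (∀ m ∈ sub A S, ∀ c : k, c ≠ 0 → D A m + c • dGen A x = 0 →
        ¬ ∃ a, A.d a = toBase A m + c • toBase A (gen A x)) → x ∈ S := by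
    intro x hx hdx hcl hco hc
    refine hmax.le_of_ge (y := insert x S) ⟨hS₀S.trans (Set.subset_insert x S), ?_, ?_, ?_⟩
      (Set.subset_insert x S) (Set.mem_insert x S)
    · exact Set.forall_mem_insert.mpr ⟨Or.inr hx, hnew⟩
    · exact hS.insert (hx ▸ hn) (hx ▸ hle) hdx hcl hco
    · exact hSinj.insert hS hx hn hc
  refine ⟨S, hS₀S, hnew, hS, hSinj, fun a ha hda => ?_, fun y hy hyn hdy ⟨a, ha⟩ => ?_⟩
  · by_contra hno
    -- For a class missed by the model, take a closed generator mapping to it. If some m + cx with c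
    -- ≠ 0 became exact, the class would already be the image of -c⁻¹m; so x lies in S and hits the
    -- class after all.
    obtain ⟨x, hx, hdx, rfl⟩ := exists_gen A (zero_mem (gr A (n + 1))) ha
    have hxS : x ∈ S := by
      refine key x hx (hdx ▸ zero_mem _) (by rw [hdx, map_zero]) (by rw [hdx, map_zero, hda]) ?_
      rintro m hm c hc hdm ⟨b, hb⟩
      rw [hdx, smul_zero, add_zero] at hdm
      -- Neither m nor the primitive b is assumed homogeneous, hence the projections to degrees n
      -- and n - 1; the subtraction is genuine because n ≠ 0.
      refine hno ⟨-(c⁻¹ • GradedAlgebra.proj (gr A) n m), neg_mem (Subalgebra.smul_mem _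
        (proj_mem_sub hm n) _), neg_mem (Submodule.smul_mem _ _ (GradedAlgebra.proj_mem _ n m)),
        ?_, A.comp (n - 1) (c⁻¹ • b), ?_⟩
      · have h1 := GradedAlgebra.linearMap_proj (𝒜 := gr A) (ℬ := gr A) 1 (D A)
          (fun _ _ h => D_mem A h) n m
        rw [map_neg, map_smul, ← h1, hdm, map_zero, smul_zero, neg_zero]
      · have h1 : A.comp n (toBase A m) = toBase A (GradedAlgebra.proj (gr A) n m) :=
          GradedAlgebra.linearMap_proj (𝒜 := gr A) (ℬ := A.grading) 0 (toBase A).toLinearMap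
            (fun _ _ h => toBase_mem A _ _ h) n m
        have h2 : A.d (A.comp (n - 1) (c⁻¹ • b)) = A.comp n (A.d (c⁻¹ • b)) := by
          rw [← comp_d, Nat.sub_add_cancel (Nat.pos_of_ne_zero hn)]
        rw [h2, map_neg, map_smul (toBase A), ← h1, map_smul A.d, hb, map_smul, map_add, smul_add,
          map_smul, smul_smul, inv_mul_cancel₀ hc, one_smul, neg_add_cancel_left, comp_eq_self ha]
    refine hno ⟨gen A x, gen_mem_sub hxS, hx ▸ FreeGCA.gen_mem x, by rw [D_gen, hdx], 0, ?_⟩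
    rw [map_zero, add_zero]
  · by_contra hno
    -- For a cocycle y of degree n + 1 that is exact in A but not in the model, take a generator
    -- with differential y, mapped to a primitive. A relation Dm + cy = 0 with c ≠ 0 would make y
    -- exact already; so x lies in S and kills y.
    obtain ⟨x, hx, rfl, hxa⟩ := exists_gen A hyn (A.comp_mem n a)
    have hxS : x ∈ S := by
      refine key x hx hy hdy ?_ ?_
      · rw [hxa, comp_d_of_mem ha (toBase_mem A _ _ hyn)]
      · rintro m hm c hc hdm -
        refine hno ⟨-(c⁻¹ • m), neg_mem (Subalgebra.smul_mem _ hm _), ?_⟩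
        rw [map_neg, map_smul, eq_neg_of_add_eq_zero_left hdm, smul_neg, neg_neg, smul_smul,
          inv_mul_cancel₀ hc, one_smul]
    exact hno ⟨gen A x, gen_mem_sub hxS, D_gen A x⟩

lemma mem_sub_empty {y : A.ModelAlg} (hy : y ∈ sub A (∅ : Set (ModelGen k A))) :
    ∃ c : k, y = algebraMap k _ c := by
  rw [sub, Set.image_empty, Algebra.adjoin_empty] at hy
  obtain ⟨c, hc⟩ := Algebra.mem_bot.mp hy
  exact ⟨c, hc.symm⟩

/-- The sets of generators which describe the minimal model up to degree `n`. -/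
structure IsModelUpTo (n : ℕ) (S : Set (ModelGen k A)) : Prop where
  isModelSet : IsModelSet S
  deg_le : ∀ x ∈ S, x.deg ≤ n
  injOn : InjOn n S
  surjOn : SurjOn n S
  injOn_succ : InjOn (n + 1) S

/-- The empty set generates k, so in degree 0 this is exactly 0-connectedness, and injectivity in
degree 1 is trivial since k has no degree 1 part. -/
lemma isModelUpTo_zero (hA : zeroConnected k A) :
    IsModelUpTo 0 (∅ : Set (ModelGen k A)) where
  isModelSet := ⟨by simp, by simp, by simp, by simp, fun T _ => Set.empty_subset T⟩
  deg_le := by simp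
  injOn := by
    rintro y hy - - ⟨a, ha⟩
    obtain ⟨c, rfl⟩ := mem_sub_empty hy
    rw [AlgHom.commutes] at ha
    have h1 : algebraMap k A c = 0 := by
      rw [← GradedAlgebra.proj_algebraMap_zero A.grading c, ← ha]
      exact comp_zero_d A a
    have h2 : c = 0 := by
      refine hA.1 ((Eq.trans ?_ (map_zero _).symm))
      refine (Submodule.Quotient.mk_eq_zero _).mpr ?_
      exact h1
    exact ⟨0, zero_mem _, by rw [h2, map_zero, map_zero]⟩
  surjOn a ha hda := by
    obtain ⟨c, rfl⟩ := exists_algebraMap_of_zeroConnected hA ha hda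
    refine ⟨algebraMap k _ c, Subalgebra.algebraMap_mem _ c, SetLike.algebraMap_mem_graded _ c, ?_,
      0, by rw [AlgHom.commutes, map_zero, add_zero]⟩
    rw [Algebra.algebraMap_eq_smul_one, map_smul, D, FreeGCA.derivation_one, smul_zero]
  injOn_succ := by
    rintro y hy hy1 - -
    obtain ⟨c, rfl⟩ := mem_sub_empty hy
    refine ⟨0, zero_mem _, ?_⟩
    rw [map_zero, ← GradedAlgebra.proj_eq_self hy1,
      GradedAlgebra.proj_algebraMap_of_ne (gr A) (Nat.succ_ne_zero 0)]

/-- Every `0`-connected dga has a set of generators of a minimal model. -/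
lemma exists_modelSet (hA : zeroConnected k A) : ∃ S : Set (ModelGen k A), IsModelSet S ∧
    (∀ n, InjOn n S) ∧ ∀ n, SurjOn n S := by
  have hstep : ∀ (n : ℕ) (S : {S : Set (ModelGen k A) // IsModelUpTo n S}),
      ∃ T : {T : Set (ModelGen k A) // IsModelUpTo (n + 1) T},
        S.1 ⊆ T.1 ∧ ∀ x ∈ T.1, x ∈ S.1 ∨ x.deg = n + 1 := by
    rintro n ⟨S, hS⟩
    obtain ⟨T, hST, hnew, hT, h1, h2, h3⟩ := exists_extension n.succ_ne_zero hS.isModelSet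
      (fun x hx => Nat.lt_succ_of_le (hS.deg_le x hx)) hS.injOn_succ
    refine ⟨⟨T, hT, fun x hx => ?_, h1, h2, h3⟩, hST, hnew⟩
    rcases hnew x hx with h | h
    · exact (hS.deg_le x h).trans n.le_succ
    · exact h.le
  choose next hnext hnew using hstep
  let s : ∀ n, {S : Set (ModelGen k A) // IsModelUpTo n S} := fun n =>
    Nat.rec ⟨∅, isModelUpTo_zero hA⟩ next n
  have hmono : Monotone fun n => (s n).1 := monotone_nat_of_le_succ fun n => hnext n (s n)
  -- Stage n + 1 adds generators of degree n + 1 only, so stage n already contains all generators of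
  -- degree at most n, and cohomology in degree n can be read off there.
  have hs : ∀ m n, ∀ x ∈ (s m).1, x.deg ≤ n → x ∈ (s n).1 := by
    intro m
    induction m with
    | zero => exact fun n x hx _ => hmono (Nat.zero_le n) hx
    | succ m ih =>
      intro n x hx hxn
      rcases hnew m (s m) x hx with h | h
      · exact ih n x h hxn
      · exact hmono (h ▸ hxn) hx
  let S : Set (ModelGen k A) := ⋃₀ Set.range fun n => (s n).1
  have hsS : ∀ n, (s n).1 ⊆ S := fun n => Set.subset_sUnion_of_mem ⟨n, rfl⟩
  have hSs : ∀ n, {x ∈ S | x.deg ≤ n} ⊆ (s n).1 := by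
    rintro n x ⟨⟨_, ⟨m, rfl⟩, hx⟩, hxn⟩
    exact hs m n x hx hxn
  refine ⟨S, isModelSet_sUnion ?_, fun n y hy hyn hdy hay => ?_, fun n a ha hda => ?_⟩
  · rintro _ ⟨n, rfl⟩
    exact (s n).2.isModelSet
  · obtain ⟨w, hw, hw'⟩ := (s n).2.injOn y (sub_mono (hSs n) (mem_sub_deg_le hy hyn)) hyn hdy hay
    exact ⟨w, sub_mono (hsS n) hw, hw'⟩
  · obtain ⟨y, hy, h⟩ := (s n).2.surjOn a ha hda
    exact ⟨y, sub_mono (hsS n) hy, h⟩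

/-! ### The dga of a set of generators -/

section model

variable {S : Set (ModelGen k A)} (hS : IsModelSet S)

/-- The dga generated by a set of generators. -/
noncomputable def model : CDGA k where
  carrier := sub A S
  grading := GradedAlgebra.restrict (gr A) (sub A S)
  gradedAlgebra := GradedAlgebra.restrictGradedAlgebra (gr A) (sub A S) fun _ hx n =>
    proj_mem_sub hx n
  mul_comm' hx hy := Subtype.ext (FreeGCA.mul_comm_of_mem hx hy)
  d := (D A).restrict (p := Subalgebra.toSubmodule (sub A S))
    (q := Subalgebra.toSubmodule (sub A S)) fun _ hx => hS.D_mem_sub hx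
  d_mem hx := D_mem A hx
  d_d x := Subtype.ext (hS.D_D x.2)
  leibniz {i x} y hx := Subtype.ext (by
    change D A (x.1 * y.1) = D A x.1 * y.1 + (-1 : k) ^ i • (x.1 * D A y.1)
    have hs : FreeGCA.sign k ModelGen.deg x.1 = (-1 : k) ^ i • x.1 := FreeGCA.sign_of_mem hx
    rw [D, FreeGCA.derivation_mul, hs, smul_mul_assoc])

/-- The generators of the model. -/
noncomputable def modelGen (x : ModelGen k A) (hx : x ∈ S) : model hS := ⟨gen A x, gen_mem_sub hx⟩

/-- The subspaces spanned by the generators of degree `n`. -/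
noncomputable def modelV (n : ℕ) : Submodule k (model hS) :=
  Submodule.span k {v | ∃ (x : ModelGen k A) (hx : x ∈ S), x.deg = n ∧ modelGen hS x hx = v}

lemma modelGen_mem (x : ModelGen k A) (hx : x ∈ S) : modelGen hS x hx ∈ modelV hS x.deg :=
  Submodule.subset_span ⟨x, hx, rfl, rfl⟩

lemma modelV_le {n : ℕ} {W : Submodule k (model hS)}
    (h : ∀ (x : ModelGen k A) (hx : x ∈ S), x.deg = n → modelGen hS x hx ∈ W) :
    modelV hS n ≤ W := Submodule.span_le.mpr (by
  rintro _ ⟨x, hx, hn, rfl⟩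
  exact h x hx hn)

lemma modelV_zero : modelV hS 0 = ⊥ :=
  le_bot_iff.mp (modelV_le hS fun x hx h => absurd h (hS.pos x hx))

/-- Sending the generators outside S to 0 extends the given data to the ambient free algebra, and
the resulting morphism is restricted. As φ is linear on the span of the generators, no basis of V is
needed. -/
lemma isFreeOn_modelV : (model hS).IsFreeOn (modelV hS) := by
  refine ⟨fun n => modelV_le hS fun x hx hn => hn ▸ FreeGCA.gen_mem x, ?_⟩
  intro B _ _ ℬ _ hℬ φ hφ
  classical
  let f : ModelGen k A → B := fun x =>
    if hx : x ∈ S then φ x.deg ⟨modelGen hS x hx, modelGen_mem hS x hx⟩ else 0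
  have hf : ∀ x, f x ∈ ℬ x.deg := fun x => by
    by_cases hx : x ∈ S
    · simp only [f, dif_pos hx]
      exact hφ _ _
    · simp only [f, dif_neg hx]
      exact zero_mem _
  let F : A.ModelAlg →ₐ[k] B := FreeGCA.lift f fun x y => hℬ (hf x) (hf y)
  have hF : ∀ x (hx : x ∈ S), F (gen A x) = φ x.deg ⟨modelGen hS x hx, modelGen_mem hS x hx⟩ :=
    fun x hx => (FreeGCA.lift_gen _ _ x).trans (dif_pos hx)
  have hFm := FreeGCA.map_mem_of_gen_mem ℬ F fun x => by
    rw [FreeGCA.lift_gen]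
    exact hf x
  refine ⟨F.comp (sub A S).val, ⟨fun n a ha => hFm n a.1 ha, fun n v => ?_⟩, ?_⟩
  · obtain ⟨v, hv⟩ := v
    change F v.1 = φ n ⟨v, hv⟩
    induction hv using Submodule.span_induction with
    | mem v h =>
      obtain ⟨x, hx, rfl, rfl⟩ := h
      exact hF x hx
    | zero => exact (map_zero F).trans (map_zero (φ n)).symm
    | add v w hv hw ihv ihw =>
      refine (map_add F _ _).trans ?_
      rw [ihv, ihw, ← map_add]
      rfl
    | smul c v hv ihv =>
      refine (map_smul F c _).trans ?_
      rw [ihv, ← map_smul]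
      rfl
  · rintro g ⟨-, hg⟩
    refine AlgHom.adjoin_ext fun y hy => ?_
    obtain ⟨x, hx, rfl⟩ := hy
    exact (hg x.deg ⟨modelGen hS x hx, modelGen_mem hS x hx⟩).trans (hF x hx).symm

/-- Compare generated subalgebras of the model and of the ambient algebra. -/
lemma mem_adjoin_of_mem_sub {T : Set (ModelGen k A)} {X : Set (model hS)}
    (hTX : ∀ x ∈ T, ∃ v ∈ X, v.1 = gen A x) {w : model hS} (hw : w.1 ∈ sub A T) :
    w ∈ Algebra.adjoin k X := by
  let ι : model hS →ₐ[k] A.ModelAlg := (sub A S).val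
  have h1 : sub A T ≤ (Algebra.adjoin k X).map ι := by
    rw [AlgHom.map_adjoin]
    refine Algebra.adjoin_mono ?_
    rintro _ ⟨x, hx, rfl⟩
    obtain ⟨v, hv, hvx⟩ := hTX x hx
    exact ⟨v, hv, hvx⟩
  obtain ⟨w', hw', h⟩ := h1 hw
  have h2 : w' = w := Subtype.ext h
  exact h2 ▸ hw'

/-- Well-foundedness of S is applied to the set T of generators that lie in some stage: if the
differential of x involves only such generators, then x lies in a stage as well. -/
lemma iSup_maxFiltration (n : ℕ) : ⨆ m, maxFiltration _ (modelV hS) m n = modelV hS n := by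
  refine le_antisymm (iSup_le fun m => maxFiltration_le _ _ m n) ?_
  let T : Set (ModelGen k A) := {x | ∃ (hx : x ∈ S) (m : ℕ),
    modelGen hS x hx ∈ maxFiltration _ (modelV hS) m x.deg}
  have hT : S ⊆ T := by
    refine hS.nilpotent T fun x hx hdx => ⟨hx, ?_⟩
    refine exists_mem_maxFiltration (modelGen_mem hS x hx) (mem_adjoin_of_mem_sub hS ?_
      (w := (model hS).d (modelGen hS x hx)) ((D_gen A x).symm ▸ hdx))
    rintro y ⟨hy, m, hm⟩
    exact ⟨modelGen hS y hy, Set.mem_iUnion.mpr ⟨m, Set.mem_iUnion.mpr ⟨_, hm⟩⟩, rfl⟩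
  refine modelV_le hS fun x hx hn => ?_
  obtain ⟨_, m, hm⟩ := hT hx
  exact Submodule.mem_iSup_of_mem m (hn ▸ hm)

/-- The largest filtration is the required one. Minimality comes from the bound on the degrees of
the generators occurring in the differential of a generator. -/
lemma sullivanMinimal_model : sullivanMinimal k (model hS) := by
  refine ⟨modelV hS, modelV_zero hS, isFreeOn_modelV hS, ⟨maxFiltration _ (modelV hS),
    monotone_maxFiltration _ _, iSup_maxFiltration hS, fun n x hx => hx.2, fun m n x hx => hx.2⟩,
    d_mem_decomposables (isFreeOn_modelV hS) fun n v hv => ?_⟩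
  have h1 : modelV hS n ≤ (Subalgebra.toSubmodule (Algebra.adjoin k
      (⋃ j ≤ n, (modelV hS j : Set (model hS))))).comap (model hS).d := by
    refine modelV_le hS fun x hx hn => ?_
    refine mem_adjoin_of_mem_sub hS (T := {y ∈ S | y.deg ≤ x.deg}) (fun y hy => ?_) ?_
    · refine ⟨modelGen hS y hy.1, ?_, rfl⟩
      simp only [Set.mem_iUnion]
      exact ⟨y.deg, hn ▸ hy.2, modelGen_mem hS y hy.1⟩
    · have h2 : ((model hS).d (modelGen hS x hx)).1 = dGen A x := D_gen A x
      rw [h2]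
      exact hS.mem x hx
  exact h1 hv

/-- The morphism from the model to `A`. -/
noncomputable def modelHom : model hS ⟶ A :=
  ⟨(toBase A).comp (sub A S).val, fun hx => toBase_mem A _ _ hx, fun x => hS.toBase_D x.2⟩

lemma quasiIsos_modelHom (hinj : ∀ n, InjOn n S) (hsurj : ∀ n, SurjOn n S) :
    quasiIsos k (modelHom hS) := by
  refine fun n => ⟨(cohomologyMap_injective_iff _ n).mpr ?_,
    (cohomologyMap_surjective_iff _ n).mpr ?_⟩
  · rintro y hy hdy hay
    obtain ⟨w, hw, hw'⟩ := hinj n y.1 y.2 hy (congrArg Subtype.val hdy) hay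
    exact ⟨⟨w, hw⟩, Subtype.ext hw'⟩
  · intro a ha hda
    obtain ⟨y, hy, hyn, hdy, b, hb⟩ := hsurj n a ha hda
    exact ⟨⟨y, hy⟩, hyn, Subtype.ext hdy, b, hb⟩

end model

end ModelAlg

/-- Every `0`-connected dga has a Sullivan minimal model. -/
theorem exists_minimalModel {A : CDGA k} (hA : zeroConnected k A) :
    ∃ (M : CDGA k) (_ : sullivanMinimal k M) (f : M ⟶ A), quasiIsos k f := by
  obtain ⟨S, hS, h1, h2⟩ := ModelAlg.exists_modelSet hA
  exact ⟨ModelAlg.model hS, ModelAlg.sullivanMinimal_model hS, ModelAlg.modelHom hS,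
    ModelAlg.quasiIsos_modelHom hS h1 h2⟩

end CDGA

/-! ### The theorem -/

theorem mainTheorem10 (k : Type u) [Field k] [CharZero k] :
    IsPCategory (CDGA.pathStructure k) (CDGA.surjections k) (CDGA.quasiIsos k) ∧
    ∃ hle : CDGA.sullivanMinimal k ≤ CDGA.zeroConnected k,
      ∃ Φ : CDGA.PiSullivanMinimal k ⥤ CDGA.HoZeroConnected k,
        CategoryTheory.Quotient.functor (CDGA.homotopyRel k) ⋙ Φ =
          ObjectProperty.ιOfLE hle ⋙ (CDGA.zeroConnectedQuasiIsos k).Q ∧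
        Φ.IsEquivalence :=
  ⟨CDGA.isPCategory k, CDGA.sullivanMinimal_le_zeroConnected,
    CDGA.exists_isEquivalence_of_minimalModels (fun _ hA => CDGA.exists_minimalModel hA) _⟩
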